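/- Let $m,p\ge 1$, $n=m+p$, $\epsilon>0$. Let $\Lambda=\mathrm{diag}(\lambda_1,\dots,\lambda_n)$ with $\lambda_i\in C^1([0,\infty)\times[0,1])$, $\lambda_i$ and $\partial_x\lambda_i$ bounded, and, for all $t\ge 0$, $x\in[0,1]$, $$\lambda_1(t,x)<\dots<\lambda_m(t,x)<-\epsilon<0<\epsilon<\lambda_{m+1}(t,x)<\dots<\lambda_n(t,x),\qquad \lambda_{i+1}(t,x)-\lambda_i(t,x)>\epsilon\quad(1\le i<n).$$ Let $M^1=(m^1_{ij}):[0,\infty)\times[0,1]\to\mathbb R^{n\times n}$ be continuous and bounded with $m^1_{ii}=0$ for all $i$, and let $Q^1:[0,\infty)\to\mathbb R^{p\times m}$ be continuous and bounded. Write $A=\begin{pmatrix}A_{--}&A_{-+}\\A_{+-}&A_{++}\end{pmatrix}$ for the block decomposition of an $n\times n$ matrix with $A_{--}\in\mathbb R^{m\times m}$, and let $$\mathcal T=\{(t,x,\xi):\ t>0,\ 0<\xi<x<1\}.$$ **Theorem 2.3.** There exists a matrix-valued function $K=(k_{ij})_{1\le i,j\le n}$ on $\overline{\mathcal T}$ such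 that: 1. $K$ is bounded. 2. For all $i,j\in\{1,\dots,n\}$ with $j\notin\{i+1,\dots,m\}$, $k_{ij}\in C^0(\overline{\mathcal T})$. 3. For all $1\le i<j\le m$ there is a function $\psi_{ij}\in C^1([0,\infty)\times[0,1])$ with values in $[0,1]$ satisfying, for all $t\ge0$, $x\in[0,1]$, $$\partial_t\psi_{ij}(t,x)+\lambda_i(t,x)\,\partial_x\psi_{ij}(t,x)-\lambda_j(t,\psi_{ij}(t,x))=0,\qquad \psi_{ij}(t,0)=0,$$ such that $k_{ij}\in C^0(\overline{\mathcal T^-_{ij}})\cap C^0(\overline{\mathcal T^+_{ij}})$, where $\mathcal T^-_{ij}=\{(t,x,\xi)\in\mathcal T:\xi<\psi_{ij}(t,x)\}$ and $\mathcal T^+_{ij}=\{(t,x,\xi)\in\mathcal T:\xi>\psi_{ij}(t,x)\}$; that is, the restrictions of $k_{ij}$ to the two sides $\{\xi<\psi_{ij}(t,x)\}$ and $\{\xi>\psi_{ij}(t,x)\}$ of $\overline{\mathcal T}$ extend continuously to $\overline{\mathcal T^-_{ij}}$ and $\overline{\mathcal T^+_{ij}}$. On the surface $\xi=\psi_{ij}(t,x)$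 itself (in particular at $(t,0,0)$), $k_{ij}$ is given the value of the extension from $\mathcal T^-_{ij}$. 4. $K$ is a broad solution in $\mathcal T$ of the kernel equations $$\partial_tK(t,x,\xi)+\Lambda(t,x)\partial_xK(t,x,\xi)+\partial_\xi K(t,x,\xi)\Lambda(t,\xi)+K(t,x,\xi)\big(\partial_\xi\Lambda(t,\xi)+M^1(t,\xi)\big)=0,$$ $$K(t,x,x)\Lambda(t,x)-\Lambda(t,x)K(t,x,x)=-M^1(t,x).$$ This means that for all $i,j$, for all $0\le s_1\le s_2$ and all $X,Y:[s_1,s_2]\to[0,1]$ with $X'(s)=\lambda_i(s,X(s))$, $Y'(s)=\lambda_j(s,Y(s))$ and $(s,X(s),Y(s))\in\overline{\mathcal T}$ on $[s_1,s_2]$, the integrand below is integrable and $$k_{ij}(s_2,X(s_2),Y(s_2))=k_{ij}(s_1,X(s_1),Y(s_1))-\int_{s_1}^{s_2}\Big(K(s,X(s),Y(s))\big(\partial_\xi\Lambda(s,Y(s))+M^1(s,Y(s))\big)\Big)_{ij}\,ds,$$ and that the second equation holds for all $t\ge0$ and $x\in(0,1]$. 5. The matrix $$G^2_{--}(t,x)=-K_{--}(t,x,0)\Lambda_{--}(t,0)-K_{-+}(t,x,0)\Lambda_{++}(t,0)Q^1(t)$$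 is strictly lower triangular for all $t\ge0$, $x\in[0,1]$ (its entries with $i\le j$ vanish), and it is continuous on $[0,\infty)\times[0,1]$. -/

import Mathlib

open Set

namespace VolterraKernel

/-- The closed strip `[0, ∞) × [0, 1]` of times and positions `(t, x)`. -/
def strip : Set (ℝ × ℝ) := Ici 0 ×ˢ Icc 0 1

/-- The infinite triangular prism `{(t, x, ξ) : t > 0, 0 < ξ < x < 1}`. -/
def prism : Set (ℝ × ℝ × ℝ) :=
  {q | 0 < q.1 ∧ q.2.1 ∈ Ioo (0 : ℝ) 1 ∧ q.2.2 ∈ Ioo (0 : ℝ) 1 ∧ q.2.2 < q.2.1}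

/-- The part of the prism strictly below the surface `ξ = ψ(t, x)`. -/
def prismBelow (ψ : ℝ → ℝ → ℝ) : Set (ℝ × ℝ × ℝ) :=
  {q | q ∈ prism ∧ q.2.2 < ψ q.1 q.2.1}

/-- The part of the prism strictly above the surface `ξ = ψ(t, x)`. -/
def prismAbove (ψ : ℝ → ℝ → ℝ) : Set (ℝ × ℝ × ℝ) :=
  {q | q ∈ prism ∧ ψ q.1 q.2.1 < q.2.2}

/-- Assumptions on the speeds `lam i = λ_i`: they are `C¹` on `[0, ∞) × [0, 1]`, bounded together
with their `x`-derivatives, the first `m` are `< -ε`, the last `p` are `> ε`, and consecutive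
speeds are separated by more than `ε`. -/
structure AdmissibleSpeeds {m p : ℕ} (ε : ℝ) (lam : Fin (m + p) → ℝ → ℝ → ℝ) : Prop where
  contDiffOn : ∀ i, ContDiffOn ℝ 1 (fun q : ℝ × ℝ => lam i q.1 q.2) strip
  bounded : ∃ C : ℝ, ∀ i, ∀ t x : ℝ, (t, x) ∈ strip →
    |lam i t x| ≤ C ∧ |derivWithin (fun y => lam i t y) (Icc 0 1) x| ≤ C
  neg : ∀ i : Fin m, ∀ t x : ℝ, (t, x) ∈ strip → lam (Fin.castAdd p i) t x < -ε
  pos : ∀ i : Fin p, ∀ t x : ℝ, (t, x) ∈ strip → ε < lam (Fin.natAdd m i) t x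
  gap : ∀ i j : Fin (m + p), i < j → ∀ t x : ℝ, (t, x) ∈ strip → ε < lam j t x - lam i t x

/-- Assumptions on the in-domain coupling `M`: continuous and bounded on `[0, ∞) × [0, 1]`, with
zero diagonal. -/
structure AdmissibleCoupling {n : ℕ} (M : ℝ → ℝ → Matrix (Fin n) (Fin n) ℝ) : Prop where
  continuousOn : ContinuousOn (fun q : ℝ × ℝ => M q.1 q.2) strip
  bounded : ∃ C : ℝ, ∀ t x : ℝ, (t, x) ∈ strip → ∀ i j, |M t x i j| ≤ C
  diag_zero : ∀ t x : ℝ, (t, x) ∈ strip → ∀ i, M t x i i = 0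

/-- Assumptions on the boundary coupling `Q`: continuous and bounded on `[0, ∞)`. -/
structure AdmissibleBoundary {m p : ℕ} (Q : ℝ → Matrix (Fin p) (Fin m) ℝ) : Prop where
  continuousOn : ContinuousOn Q (Ici 0)
  bounded : ∃ C : ℝ, ∀ t : ℝ, 0 ≤ t → ∀ i j, |Q t i j| ≤ C

/-- The diagonal matrix `Λ(t, x)` of the speeds. -/
def speedMatrix {n : ℕ} (lam : Fin n → ℝ → ℝ → ℝ) (t x : ℝ) : Matrix (Fin n) (Fin n) ℝ :=
  Matrix.diagonal fun i => lam i t x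

/-- The diagonal matrix `∂_x Λ(t, x)`, the derivative being one-sided at `x = 0` and `x = 1`. -/
noncomputable def speedMatrixDeriv {n : ℕ} (lam : Fin n → ℝ → ℝ → ℝ) (t x : ℝ) :
    Matrix (Fin n) (Fin n) ℝ :=
  Matrix.diagonal fun i => derivWithin (fun y => lam i t y) (Icc 0 1) x

/-- `X` is a characteristic of `∂_t + lamᵢ(t, x) ∂_x` in `[0, 1]` on the time interval
`[s₁, s₂]`. -/
def IsCharacteristic (lami : ℝ → ℝ → ℝ) (s₁ s₂ : ℝ) (X : ℝ → ℝ) : Prop :=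
  ∀ s ∈ Icc s₁ s₂, X s ∈ Icc (0 : ℝ) 1 ∧ HasDerivWithinAt X (lami s (X s)) (Icc s₁ s₂) s

/-- `K` is a broad solution (solution along the characteristics) of
`∂_t K + Λ(t,x) ∂_x K + ∂_ξ K Λ(t,ξ) + K (∂_ξ Λ(t,ξ) + M(t,ξ)) = 0` in the prism: for all `i, j`,
along every segment `s ↦ (s, X s, Y s)` contained in the closed prism of a characteristic curve of
`∂_t + λ_i(t,x) ∂_x + λ_j(t,ξ) ∂_ξ`, the equation for the entry `k_ij` holds in integrated form. -/
def SolvesAlongCharacteristics {n : ℕ} (lam : Fin n → ℝ → ℝ → ℝ)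
    (M : ℝ → ℝ → Matrix (Fin n) (Fin n) ℝ) (K : ℝ → ℝ → ℝ → Matrix (Fin n) (Fin n) ℝ) : Prop :=
  ∀ (i j : Fin n) (s₁ s₂ : ℝ) (X Y : ℝ → ℝ), s₁ ≤ s₂ →
    IsCharacteristic (lam i) s₁ s₂ X → IsCharacteristic (lam j) s₁ s₂ Y →
    (∀ s ∈ Icc s₁ s₂, (s, X s, Y s) ∈ closure prism) →
    IntervalIntegrable
      (fun s => (K s (X s) (Y s) * (speedMatrixDeriv lam s (Y s) + M s (Y s))) i j)
      MeasureTheory.volume s₁ s₂ ∧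
    K s₂ (X s₂) (Y s₂) i j = K s₁ (X s₁) (Y s₁) i j -
      ∫ s in s₁..s₂, (K s (X s) (Y s) * (speedMatrixDeriv lam s (Y s) + M s (Y s))) i j

/-- `K` is a broad solution of the kernel equations: it solves the hyperbolic system along the
characteristics, and `K(t,x,x) Λ(t,x) - Λ(t,x) K(t,x,x) = -M(t,x)` on the diagonal `ξ = x`
(away from the edge `x = 0`, where entries of `K` may have two different traces). -/
structure IsBroadSolution {n : ℕ} (lam : Fin n → ℝ → ℝ → ℝ)
    (M : ℝ → ℝ → Matrix (Fin n) (Fin n) ℝ) (K : ℝ → ℝ → ℝ → Matrix (Fin n) (Fin n) ℝ) : Prop where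
  alongChar : SolvesAlongCharacteristics lam M K
  diagonal : ∀ t x : ℝ, 0 ≤ t → x ∈ Ioc (0 : ℝ) 1 →
    K t x x * speedMatrix lam t x - speedMatrix lam t x * K t x x = -M t x

/-- `k` is continuous on the closure of each of the two parts of the prism cut out by the surface
`ξ = ψ(t, x)`: on the closed prism it coincides with a function continuous on the closure of the
lower part where `ξ ≤ ψ(t, x)`, and with a function continuous on the closure of the upper part
where `ξ > ψ(t, x)` (on the surface itself, `k` takes the value of the trace from below). -/
def PiecewiseContinuous (ψ : ℝ → ℝ → ℝ) (k : ℝ → ℝ → ℝ → ℝ) : Prop :=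
  ∃ f g : ℝ × ℝ × ℝ → ℝ,
    ContinuousOn f (closure (prismBelow ψ)) ∧ ContinuousOn g (closure (prismAbove ψ)) ∧
    ∀ q ∈ closure prism,
      (q.2.2 ≤ ψ q.1 q.2.1 → k q.1 q.2.1 q.2.2 = f q) ∧
      (ψ q.1 q.2.1 < q.2.2 → k q.1 q.2.1 q.2.2 = g q)

/-- `ψ ∈ C¹([0, ∞) × [0, 1])`, with values in `[0, 1]`, solves
`∂_t ψ + λ_i(t, x) ∂_x ψ - λ_j(t, ψ) = 0`, `ψ(t, 0) = 0`. -/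
structure IsInterface (lami lamj : ℝ → ℝ → ℝ) (ψ : ℝ → ℝ → ℝ) : Prop where
  contDiffOn : ContDiffOn ℝ 1 (fun q : ℝ × ℝ => ψ q.1 q.2) strip
  mem_Icc : ∀ t x : ℝ, (t, x) ∈ strip → ψ t x ∈ Icc (0 : ℝ) 1
  equation : ∀ t x : ℝ, (t, x) ∈ strip →
    derivWithin (fun s => ψ s x) (Ici 0) t + lami t x * derivWithin (fun y => ψ t y) (Icc 0 1) x
      - lamj t (ψ t x) = 0
  zero : ∀ t : ℝ, 0 ≤ t → ψ t 0 = 0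

section Blocks

variable {m p : ℕ}

/-- The block `A₋₋` (first `m` rows, first `m` columns). -/
def blockMM (A : Matrix (Fin (m + p)) (Fin (m + p)) ℝ) : Matrix (Fin m) (Fin m) ℝ :=
  A.submatrix (Fin.castAdd p) (Fin.castAdd p)

/-- The block `A₋₊` (first `m` rows, last `p` columns). -/
def blockMP (A : Matrix (Fin (m + p)) (Fin (m + p)) ℝ) : Matrix (Fin m) (Fin p) ℝ :=
  A.submatrix (Fin.castAdd p) (Fin.natAdd m)

/-- The block `A₊₊` (last `p` rows, last `p` columns). -/
def blockPP (A : Matrix (Fin (m + p)) (Fin (m + p)) ℝ) : Matrix (Fin p) (Fin p) ℝ :=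
  A.submatrix (Fin.natAdd m) (Fin.natAdd m)

/-- `G₋₋(t,x) = -K₋₋(t,x,0) Λ₋₋(t,0) - K₋₊(t,x,0) Λ₊₊(t,0) Q(t)`. -/
def gainMM (lam : Fin (m + p) → ℝ → ℝ → ℝ) (Q : ℝ → Matrix (Fin p) (Fin m) ℝ)
    (K : ℝ → ℝ → ℝ → Matrix (Fin (m + p)) (Fin (m + p)) ℝ) (t x : ℝ) :
    Matrix (Fin m) (Fin m) ℝ :=
  -(blockMM (K t x 0) * blockMM (speedMatrix lam t 0))
    - blockMP (K t x 0) * blockPP (speedMatrix lam t 0) * Q t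

end Blocks

end VolterraKernel

open VolterraKernel

open Set Filter Topology MeasureTheory
open scoped NNReal

/-!
The kernel equations for `k_ij` involve only the entries of row `i`, so the rows can be constructed
one at a time. Along the curves `(s, X s, Y s)` with `X' = λ_i` and `Y' = λ_j` the equations are
ordinary differential equations. Let `λ_i < 0`. Followed forward in time if `λ_i ≤ λ_j` and backward
otherwise, such a curve leaves the wedge `0 ≤ ξ ≤ x` either through the diagonal `ξ = x`, where the
algebraic equation prescribes `k_ij = m_ij / (λ_i - λ_j)`, or through the face `ξ = 0`, which only
happens for `i ≤ j ≤ m`; there `G_ij = 0` prescribes `k_ij` as a combination of the `k_il` with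
`l > m`. Comparing the times at which the two components reach `0` decides between the two exits,
and the surface on which these times agree is the interface `ξ = ψ_ij(t, x)`.

Multiplying by an amplitude removes the term `∂_ξ λ_j k_ij`. The remaining integral equations of a
row have a unique bounded solution: after division by the exponential of a clock that decreases
along every curve towards its exit, they become a contraction for the sup norm. Rows of positive
speed reduce to rows of negative speed by reversing time.
-/

namespace VolterraKernel

/-! ### Global integral curves -/

section IntegralCurve

variable {E : Type*} [NormedAddCommGroup E] [NormedSpace ℝ E] {v : ℝ → E → E} {K L : ℝ≥0}

theorem exists_hasDerivAt_Ioo_of_bounded [CompleteSpace E] (hK : ∀ t, LipschitzWith K (v t))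
    (hc : ∀ x, Continuous fun t => v t x) (hL : ∀ t x, ‖v t x‖ ≤ L) (t : ℝ) (x : E) (r : ℝ≥0) :
    ∃ X : ℝ → E, X t = x ∧ ∀ s ∈ Ioo (t - r) (t + r), HasDerivAt X (v s (X s)) s := by
  have ht : t ∈ Icc (t - r) (t + r) := ⟨by simp, by simp⟩
  have hP : IsPicardLindelof v (⟨t, ht⟩ : Icc (t - r : ℝ) (t + r)) x (L * r) 0 L K :=
    ⟨fun s _ => (hK s).lipschitzOnWith, fun y _ => (hc y).continuousOn, fun s _ y _ => hL s y,
      by simp⟩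
  obtain ⟨X, h0, hX⟩ := hP.exists_eq_forall_mem_Icc_hasDerivWithinAt₀
  exact ⟨X, h0, fun s hs => (hX s (Ioo_subset_Icc_self hs)).hasDerivAt (Icc_mem_nhds hs.1 hs.2)⟩

theorem exists_isIntegralCurve_of_bounded [CompleteSpace E] (hK : ∀ t, LipschitzWith K (v t))
    (hc : ∀ x, Continuous fun t => v t x) (hL : ∀ t x, ‖v t x‖ ≤ L) (t : ℝ) (x : E) :
    ∃ X : ℝ → E, X t = x ∧ IsIntegralCurve X v := by
  choose Y h0 hY using fun n : ℕ => exists_hasDerivAt_Ioo_of_bounded hK hc hL t x (n + 1)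
  simp only [NNReal.coe_add, NNReal.coe_natCast, NNReal.coe_one] at hY
  have agree : ∀ n m : ℕ, n ≤ m → EqOn (Y n) (Y m) (Ioo (t - (n + 1)) (t + (n + 1))) := by
    intro n m hnm
    have hnm' : (n : ℝ) ≤ m := by exact_mod_cast hnm
    have : (0 : ℝ) ≤ n := n.cast_nonneg
    exact ODE_solution_unique_of_mem_Ioo (v := v) (s := fun _ => univ) (K := K) (t₀ := t)
      (fun s _ => (hK s).lipschitzOnWith) ⟨by linarith, by linarith⟩
      (fun s hs => ⟨hY n s hs, trivial⟩)
      (fun s hs => ⟨hY m s ⟨by linarith [hs.1], by linarith [hs.2]⟩, trivial⟩)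
      ((h0 n).trans (h0 m).symm)
  have hmem (s : ℝ) : s ∈ Ioo (t - ((⌈|s - t|⌉₊ : ℕ) + 1)) (t + ((⌈|s - t|⌉₊ : ℕ) + 1)) := by
    have := abs_le.1 (Nat.le_ceil |s - t|)
    exact ⟨by linarith [this.1], by linarith [this.2]⟩
  have hglue : ∀ n : ℕ, ∀ s ∈ Ioo (t - ((n : ℝ) + 1)) (t + (n + 1)), Y ⌈|s - t|⌉₊ s = Y n s := by
    intro n s hs
    rcases le_total ⌈|s - t|⌉₊ n with h | h
    · exact agree _ _ h (hmem s)
    · exact (agree _ _ h hs).symm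
  refine ⟨fun s => Y ⌈|s - t|⌉₊ s, h0 _, fun s => ?_⟩
  refine (hY _ s (hmem s)).congr_of_eventuallyEq ?_
  filter_upwards [Ioo_mem_nhds (hmem s).1 (hmem s).2] with r hr using hglue _ r hr

theorem norm_sub_le_of_hasDerivAt {X X' : ℝ → E} {C : ℝ} (h : ∀ s, HasDerivAt X (X' s) s)
    (hC : ∀ s, ‖X' s‖ ≤ C) (a b : ℝ) : ‖X b - X a‖ ≤ C * |b - a| :=
  Convex.norm_image_sub_le_of_norm_hasDerivWithin_le (fun s _ => (h s).hasDerivWithinAt)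
    (fun s _ => hC s) convex_univ (mem_univ a) (mem_univ b)

/-- The integral curve of `v` through `x` at time `t`, a junk value if there is none. -/
noncomputable def flow (v : ℝ → E → E) (t : ℝ) (x : E) : ℝ → E :=
  Classical.epsilon fun X => X t = x ∧ IsIntegralCurve X v

end IntegralCurve

/-! ### Functions increasing at a positive rate -/

/-- `f` increases at rate at least `c`: the difference quotients of `f` are bounded below by `c`. -/
def IncreasesAtRate (c : ℝ) (f : ℝ → ℝ) : Prop := ∀ a b, a ≤ b → c * (b - a) ≤ f b - f a

namespace IncreasesAtRate

variable {c : ℝ} {f f' : ℝ → ℝ}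

theorem of_hasDerivAt (hf : ∀ s, HasDerivAt f (f' s) s) (hc : ∀ s, c ≤ f' s) :
    IncreasesAtRate c f := by
  intro a b hab
  refine Convex.mul_sub_le_image_sub_of_le_deriv convex_univ
    (continuous_iff_continuousAt.2 fun s => (hf s).continuousAt).continuousOn
    (fun s _ => (hf s).differentiableAt.differentiableWithinAt) (fun s _ => ?_) a trivial b trivial
    hab
  rw [(hf s).deriv]
  exact hc s

theorem mul_abs_sub_le (h : IncreasesAtRate c f) (a b : ℝ) : c * |b - a| ≤ |f b - f a| := by
  rcases le_total a b with hab | hab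
  · rw [abs_of_nonneg (sub_nonneg.2 hab)]
    exact (h a b hab).trans (le_abs_self _)
  · rw [abs_sub_comm b a, abs_sub_comm (f b), abs_of_nonneg (sub_nonneg.2 hab)]
    exact (h b a hab).trans (le_abs_self _)

theorem strictMono (h : IncreasesAtRate c f) (hc : 0 < c) : StrictMono f := by
  intro a b hab
  have := h a b hab.le
  have := mul_pos hc (sub_pos.2 hab)
  linarith

theorem sub_const (h : IncreasesAtRate c f) (r : ℝ) : IncreasesAtRate c fun s => f s - r :=
  fun a b hab => (h a b hab).trans_eq (by ring)

theorem exists_zero (h : IncreasesAtRate c f) (hc : 0 < c) (hf : Continuous f) :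
    ∃ s, f s = 0 := by
  have hleft := h (-(|f 0| / c)) 0 (neg_nonpos.2 (by positivity))
  have hright := h 0 (|f 0| / c) (by positivity)
  simp only [sub_neg_eq_add, zero_add, mul_div_cancel₀ _ hc.ne', sub_zero] at hleft hright
  exact mem_range_of_exists_le_of_exists_ge hf
    ⟨-(|f 0| / c), by linarith [le_abs_self (f 0)]⟩ ⟨|f 0| / c, by linarith [neg_abs_le (f 0)]⟩

theorem continuous_of_eq_zero {A : Type*} [TopologicalSpace A] {z : A → ℝ → ℝ} {ζ : A → ℝ}
    (h : ∀ a, IncreasesAtRate c (z a)) (hc : 0 < c) (hz : ∀ s, Continuous fun a => z a s)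
    (hζ : ∀ a, z a (ζ a) = 0) : Continuous ζ := by
  rw [continuous_iff_continuousAt]
  intro a₀
  rw [ContinuousAt, tendsto_iff_dist_tendsto_zero]
  refine squeeze_zero (g := fun a => |z a (ζ a₀)| / c) (fun _ => dist_nonneg) (fun a => ?_) ?_
  · have := (h a).mul_abs_sub_le (ζ a₀) (ζ a)
    rw [hζ, zero_sub, abs_neg] at this
    rwa [Real.dist_eq, le_div_iff₀ hc, mul_comm]
  · have := ((hz (ζ a₀)).abs.div_const c).tendsto a₀
    simpa [hζ] using this

end IncreasesAtRate

/-! ### Integrals of bounded functions -/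

theorem intervalIntegrable_of_bounded {f : ℝ → ℝ} {C : ℝ} (hf : Measurable f)
    (hC : ∀ s, |f s| ≤ C) (a b : ℝ) : IntervalIntegrable f volume a b :=
  (intervalIntegrable_const (c := C)).mono_fun' hf.aestronglyMeasurable
    (Eventually.of_forall hC)

theorem abs_integral_le_of_bounded {f : ℝ → ℝ} {C : ℝ} (hC : ∀ s, |f s| ≤ C) (a b : ℝ) :
    |∫ s in a..b, f s| ≤ C * |b - a| :=
  intervalIntegral.norm_integral_le_of_norm_le_const (f := f) (fun s _ => hC s)

theorem abs_integral_le_of_eq_zero_off_Icc {f : ℝ → ℝ} {C u v : ℝ} (huv : u ≤ v)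
    (hC : ∀ s, |f s| ≤ C) (h0 : ∀ s ∉ Icc u v, f s = 0) (a b : ℝ) :
    |∫ s in a..b, f s| ≤ C * (v - u) := by
  have hle : ∀ s, |f s| ≤ (Icc u v).indicator (fun _ => C) s := by
    intro s
    by_cases hs : s ∈ Icc u v
    · rw [indicator_of_mem hs]
      exact hC s
    · rw [indicator_of_notMem hs, h0 s hs, abs_zero]
  have hint : Integrable ((Icc u v).indicator fun _ => C) volume :=
    (integrable_indicator_iff measurableSet_Icc).2 (integrableOn_const (by simp))
  calc |∫ s in a..b, f s| ≤ ∫ s in uIoc a b, |f s| :=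
        intervalIntegral.norm_integral_le_integral_norm_uIoc (f := f)
    _ ≤ ∫ s in uIoc a b, (Icc u v).indicator (fun _ => C) s :=
        integral_mono_of_nonneg (Eventually.of_forall fun _ => abs_nonneg _) hint.integrableOn
          (Eventually.of_forall hle)
    _ ≤ ∫ s, (Icc u v).indicator (fun _ => C) s :=
        setIntegral_le_integral hint (Eventually.of_forall fun s => (abs_nonneg _).trans (hle s))
    _ = C * (v - u) := by
        rw [integral_indicator measurableSet_Icc, setIntegral_const, measureReal_def,
          Real.volume_Icc, ENNReal.toReal_ofReal (sub_nonneg.2 huv), smul_eq_mul, mul_comm]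

theorem continuousWithinAt_integral {A : Type*} [TopologicalSpace A] [FirstCountableTopology A]
    {F : A → ℝ → ℝ} {C : ℝ} {D : Set A} {p : A} {a b : A → ℝ} (hC : ∀ q s, |F q s| ≤ C)
    (hF : ∀ q, Measurable (F q)) (hc : ∀ᵐ s, ContinuousWithinAt (fun q => F q s) D p)
    (ha : ContinuousWithinAt a D p) (hb : ContinuousWithinAt b D p) :
    ContinuousWithinAt (fun q => ∫ s in a q..b q, F q s) D p := by
  have hi : ∀ q u v, IntervalIntegrable (F q) volume u v := fun q u v =>
    intervalIntegrable_of_bounded (hF q) (hC q) u v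
  have hfixed : ContinuousWithinAt (fun q => ∫ s in a p..b p, F q s) D p :=
    intervalIntegral.continuousWithinAt_of_dominated_interval (bound := fun _ => C)
      (Eventually.of_forall fun q => (hF q).aestronglyMeasurable)
      (Eventually.of_forall fun q => Eventually.of_forall fun s _ => hC q s)
      intervalIntegrable_const (hc.mono fun s hs _ => hs)
  have hsmall : ∀ u : A → ℝ, ContinuousWithinAt u D p →
      Tendsto (fun q => ∫ s in u p..u q, F q s) (𝓝[D] p) (𝓝 0) := by
    intro u hu
    refine squeeze_zero_norm (fun q => abs_integral_le_of_bounded (hC q) (u p) (u q)) ?_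
    simpa [ContinuousWithinAt] using (hu.sub_const (u p)).abs.const_mul C
  have hsplit : ∀ q, (∫ s in a p..b p, F q s) + (∫ s in b p..b q, F q s) -
      ∫ s in a p..a q, F q s = ∫ s in a q..b q, F q s := by
    intro q
    rw [intervalIntegral.integral_add_adjacent_intervals (hi _ _ _) (hi _ _ _),
      ← intervalIntegral.integral_add_adjacent_intervals (hi q (a p) (a q)) (hi q (a q) (b q)),
      add_sub_cancel_left]
  have hsum := (hfixed.tendsto.add (hsmall b hb)).sub (hsmall a ha)
  rw [add_zero, sub_zero] at hsum
  exact hsum.congr hsplit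

theorem abs_exp_sub_exp_le {u v B : ℝ} (hu : u ≤ B) (hv : v ≤ B) :
    |Real.exp u - Real.exp v| ≤ Real.exp B * |u - v| :=
  Convex.norm_image_sub_le_of_norm_hasDerivWithin_le
    (fun s _ => (Real.hasDerivAt_exp s).hasDerivWithinAt)
    (fun s hs => by rw [Real.norm_eq_abs, Real.abs_exp]; exact Real.exp_le_exp.2 hs)
    (convex_Iic B) hv hu

/-! ### Speeds of constant sign -/

/-- `l` is a bounded Lipschitz speed on `ℝ × ℝ` of constant sign `σ = ±1`, bounded away from zero
by `ε`. It stands for a speed extended from `[0, ∞) × [0, 1]`: its space derivative `l'` is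
continuous on `ℝ × [0, 1]`, vanishes outside, and may jump at `x ∈ {0, 1}`. -/
structure SignedSpeed (ε C σ : ℝ) (l l' : ℝ → ℝ → ℝ) : Prop where
  eps_pos : 0 < ε
  sign_mul_self : σ * σ = 1
  continuous : Continuous fun q : ℝ × ℝ => l q.1 q.2
  abs_le : ∀ t x, |l t x| ≤ C
  abs_sub_le : ∀ t x y, |l t x - l t y| ≤ C * |x - y|
  le_sign_mul : ∀ t x, ε ≤ σ * l t x
  hasDerivAt : ∀ t x, x ≠ 0 → x ≠ 1 → HasDerivAt (l t) (l' t x) x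
  continuousOn_deriv : ContinuousOn (fun q : ℝ × ℝ => l' q.1 q.2) (univ ×ˢ Icc 0 1)
  deriv_eq_zero : ∀ t x, x ∉ Icc (0 : ℝ) 1 → l' t x = 0
  abs_deriv_le : ∀ t x, |l' t x| ≤ C

/-- The time at which the integral curve of `l` through `(t, x)` reaches `0`. -/
noncomputable def hitTime (l : ℝ → ℝ → ℝ) (t x : ℝ) : ℝ :=
  Classical.epsilon fun s => flow l t x s = 0

/-- The solution of `∂ₜ a + l ∂ₓ a + l' a = 0` which equals `1` at `x = 0`. Multiplication by it
removes the zeroth-order term `∂ₓ l` from the equation `∂ₜ k + ∂ₓ (l k) = 0`. -/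
noncomputable def amplitude (l l' : ℝ → ℝ → ℝ) (t x : ℝ) : ℝ :=
  Real.exp (∫ s in t..hitTime l t x, l' s (flow l t x s))

theorem amplitude_pos (l l' : ℝ → ℝ → ℝ) (t x : ℝ) : 0 < amplitude l l' t x := Real.exp_pos _

namespace SignedSpeed

variable {ε C σ : ℝ} {l l' : ℝ → ℝ → ℝ} (hl : SignedSpeed ε C σ l l')
include hl

theorem sign_ne_zero : σ ≠ 0 := by
  rintro rfl
  simpa using hl.sign_mul_self

theorem abs_sign : |σ| = 1 := by
  rcases mul_self_eq_one_iff.1 hl.sign_mul_self with h | h <;> simp [h]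

theorem le_abs (t x : ℝ) : ε ≤ |l t x| := by
  calc ε ≤ |σ * l t x| := (hl.le_sign_mul t x).trans (le_abs_self _)
    _ = |l t x| := by rw [abs_mul, hl.abs_sign, one_mul]

theorem ne_zero (t x : ℝ) : l t x ≠ 0 := abs_pos.1 (hl.eps_pos.trans_le (hl.le_abs t x))

theorem bound_pos : 0 < C := hl.eps_pos.trans_le ((hl.le_abs 0 0).trans (hl.abs_le 0 0))

theorem bound_nonneg : 0 ≤ C := hl.bound_pos.le

theorem lipschitzWith (t : ℝ) : LipschitzWith C.toNNReal (l t) := by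
  refine LipschitzWith.of_dist_le_mul fun x y => ?_
  rw [Real.coe_toNNReal _ hl.bound_nonneg]
  exact hl.abs_sub_le t x y

theorem continuousAt_deriv (t : ℝ) {x : ℝ} (h0 : x ≠ 0) (h1 : x ≠ 1) :
    ContinuousAt (fun q : ℝ × ℝ => l' q.1 q.2) (t, x) := by
  by_cases hx : x ∈ Icc (0 : ℝ) 1
  · exact hl.continuousOn_deriv.continuousAt
      (prod_mem_nhds univ_mem (Icc_mem_nhds (hx.1.lt_of_ne' h0) (hx.2.lt_of_ne h1)))
  · refine (continuousAt_const (y := (0 : ℝ))).congr ?_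
    filter_upwards [(isClosed_Icc.preimage continuous_snd).isOpen_compl.mem_nhds hx] with q hq
    exact (hl.deriv_eq_zero q.1 q.2 hq).symm

theorem measurable_deriv : Measurable fun q : ℝ × ℝ => l' q.1 q.2 := by
  classical
  rw [← (univ ×ˢ Icc 0 1 : Set (ℝ × ℝ)).piecewise_same fun q => l' q.1 q.2]
  refine hl.continuousOn_deriv.measurable_piecewise (continuousOn_const (c := (0 : ℝ)).congr ?_)
    (MeasurableSet.univ.prod measurableSet_Icc)
  intro q hq
  exact hl.deriv_eq_zero q.1 q.2 fun hmem => hq ⟨trivial, hmem⟩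

/-! #### Integral curves -/

theorem curve_unique {X Y : ℝ → ℝ} (hX : IsIntegralCurve X l) (hY : IsIntegralCurve Y l) {t : ℝ}
    (h : X t = Y t) : X = Y :=
  ODE_solution_unique_univ (v := l) (s := fun _ => univ) (K := C.toNNReal)
    (fun t => (hl.lipschitzWith t).lipschitzOnWith) (fun s => ⟨hX s, trivial⟩)
    (fun s => ⟨hY s, trivial⟩) h

theorem flow_spec (t x : ℝ) : flow l t x t = x ∧ IsIntegralCurve (flow l t x) l := by
  refine Classical.epsilon_spec
    (exists_isIntegralCurve_of_bounded (L := C.toNNReal) hl.lipschitzWith (fun x => ?_) ?_ t x)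
  · exact hl.continuous.comp (by fun_prop : Continuous fun s : ℝ => (s, x))
  · simpa [hl.bound_nonneg] using hl.abs_le

theorem flow_self (t x : ℝ) : flow l t x t = x := (hl.flow_spec t x).1

theorem isIntegralCurve_flow (t x : ℝ) : IsIntegralCurve (flow l t x) l := (hl.flow_spec t x).2

theorem flow_curve {X : ℝ → ℝ} (hX : IsIntegralCurve X l) (t : ℝ) : flow l t (X t) = X :=
  hl.curve_unique (hl.isIntegralCurve_flow _ _) hX (t := t) (hl.flow_self _ _)

theorem abs_curve_sub_le {X : ℝ → ℝ} (hX : IsIntegralCurve X l) (a b : ℝ) :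
    |X b - X a| ≤ C * |b - a| :=
  norm_sub_le_of_hasDerivAt hX (fun s => hl.abs_le s _) a b

theorem increasesAtRate_curve {X : ℝ → ℝ} (hX : IsIntegralCurve X l) :
    IncreasesAtRate ε fun s => σ * X s :=
  .of_hasDerivAt (fun s => (hX s).const_mul σ) fun s => hl.le_sign_mul s _

theorem le_abs_curve_sub {X : ℝ → ℝ} (hX : IsIntegralCurve X l) (a b : ℝ) :
    ε * |b - a| ≤ |X b - X a| := by
  have := (hl.increasesAtRate_curve hX).mul_abs_sub_le a b
  rwa [← mul_sub, abs_mul, hl.abs_sign, one_mul] at this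

theorem curve_injective {X : ℝ → ℝ} (hX : IsIntegralCurve X l) : Function.Injective X :=
  fun _ _ h => ((hl.increasesAtRate_curve hX).strictMono hl.eps_pos).injective (congrArg _ h)

theorem ae_curve_ne {X : ℝ → ℝ} (hX : IsIntegralCurve X l) (c : ℝ) : ∀ᵐ s, X s ≠ c := by
  have : Set.Subsingleton {s | X s = c} := fun a ha b hb =>
    hl.curve_injective hX (Eq.trans ha (Eq.symm hb))
  simpa using (measure_eq_zero_iff_ae_notMem.1 (this.measure_zero volume))

theorem curve_ne {X Y : ℝ → ℝ} (hX : IsIntegralCurve X l) (hY : IsIntegralCurve Y l) {t : ℝ}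
    (h : X t ≠ Y t) (s : ℝ) : X s ≠ Y s :=
  fun hs => h (congrFun (hl.curve_unique hX hY hs) t)

theorem abs_slope_le (t : ℝ) {x y : ℝ} (h : x ≠ y) : |slope (l t) x y| ≤ C := by
  rw [slope_def_field, abs_div, div_le_iff₀ (abs_pos.2 (sub_ne_zero.2 h.symm))]
  exact hl.abs_sub_le t y x

theorem continuous_slope_curve {X Y : ℝ → ℝ} (hX : IsIntegralCurve X l)
    (hY : IsIntegralCurve Y l) (h : ∀ s, X s ≠ Y s) :
    Continuous fun s => slope (l s) (X s) (Y s) := by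
  simp only [slope_def_field]
  exact ((hl.continuous.comp (continuous_id.prodMk hY.continuous)).sub
    (hl.continuous.comp (continuous_id.prodMk hX.continuous))).div
    (hY.continuous.sub hX.continuous) fun s => sub_ne_zero.2 (h s).symm

theorem curve_sub_eq_mul_exp {X Y : ℝ → ℝ} (hX : IsIntegralCurve X l) (hY : IsIntegralCurve Y l)
    (h : ∀ s, X s ≠ Y s) (t s : ℝ) :
    Y s - X s = (Y t - X t) * Real.exp (∫ r in t..s, slope (l r) (X r) (Y r)) := by
  set a : ℝ → ℝ := fun s => slope (l s) (X s) (Y s) with ha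
  have hc : Continuous a := hl.continuous_slope_curve hX hY h
  have hI : ∀ s, HasDerivAt (fun s => ∫ r in t..s, a r) (a s) s := fun s =>
    intervalIntegral.integral_hasDerivAt_right (hc.intervalIntegrable _ _)
      (hc.stronglyMeasurableAtFilter _ _) hc.continuousAt
  have hW : ∀ s, HasDerivAt (fun s => (Y s - X s) * Real.exp (-∫ r in t..s, a r)) 0 s := by
    intro s
    have hslope : l s (Y s) - l s (X s) = a s * (Y s - X s) := by
      simp only [ha, slope_def_field, div_mul_cancel₀ _ (sub_ne_zero.2 (h s).symm)]
    refine (((hY s).sub (hX s)).mul (hI s).neg.exp).congr_deriv ?_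
    simp only [Pi.sub_apply, Pi.neg_apply, hslope]
    ring
  have hconst := is_const_of_deriv_eq_zero (fun s => (hW s).differentiableAt)
    (fun s => (hW s).deriv) s t
  simp only [intervalIntegral.integral_same, neg_zero, Real.exp_zero, mul_one] at hconst
  rw [← hconst, mul_assoc, ← Real.exp_add, neg_add_cancel, Real.exp_zero, mul_one]

theorem abs_curve_sub_curve_le {X Y : ℝ → ℝ} (hX : IsIntegralCurve X l)
    (hY : IsIntegralCurve Y l) (t s : ℝ) :
    |Y s - X s| ≤ |Y t - X t| * Real.exp (C * |s - t|) := by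
  by_cases h : X t = Y t
  · simp [hl.curve_unique hX hY h]
  have hne := hl.curve_ne hX hY h
  rw [hl.curve_sub_eq_mul_exp hX hY hne t s, abs_mul, Real.abs_exp]
  gcongr
  exact (le_abs_self _).trans
    (abs_integral_le_of_bounded (fun r => hl.abs_slope_le r (hne r)) t s)

theorem continuous_flow : Continuous fun q : ℝ × ℝ × ℝ => flow l q.1 q.2.1 q.2.2 := by
  rw [continuous_iff_continuousAt]
  rintro ⟨t₀, x₀, s₀⟩
  set X := flow l t₀ x₀
  have hX : IsIntegralCurve X l := hl.isIntegralCurve_flow _ _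
  have hXc := hX.continuous
  have hXt : X t₀ = x₀ := hl.flow_self _ _
  let g : ℝ × ℝ × ℝ → ℝ := fun q =>
    |q.2.1 - X q.1| * Real.exp (C * |q.2.2 - q.1|) + C * |q.2.2 - s₀|
  have hg : Continuous g := by fun_prop
  rw [ContinuousAt, tendsto_iff_dist_tendsto_zero]
  refine squeeze_zero (g := g) (fun _ => dist_nonneg) ?_ ?_
  · rintro ⟨t, x, s⟩
    have hinit := hl.abs_curve_sub_curve_le hX (hl.isIntegralCurve_flow t x) t s
    rw [hl.flow_self] at hinit
    calc |flow l t x s - X s₀| ≤ |flow l t x s - X s| + |X s - X s₀| := _root_.abs_sub_le _ _ _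
      _ ≤ g (t, x, s) := add_le_add hinit (hl.abs_curve_sub_le hX s₀ s)
  · simpa [g, hXt] using hg.tendsto (t₀, x₀, s₀)

/-! #### Hitting times -/

theorem flow_hitTime (t x : ℝ) : flow l t x (hitTime l t x) = 0 := by
  have hX := hl.isIntegralCurve_flow t x
  obtain ⟨s, hs⟩ := (hl.increasesAtRate_curve hX).exists_zero hl.eps_pos
    (continuous_const.mul hX.continuous)
  exact Classical.epsilon_spec (p := fun s => flow l t x s = 0)
    ⟨s, (mul_eq_zero.1 hs).resolve_left hl.sign_ne_zero⟩

theorem curve_hitTime {X : ℝ → ℝ} (hX : IsIntegralCurve X l) (t : ℝ) :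
    X (hitTime l t (X t)) = 0 := by
  have := hl.flow_hitTime t (X t)
  rwa [hl.flow_curve hX] at this

theorem hitTime_eq {X : ℝ → ℝ} (hX : IsIntegralCurve X l) {s : ℝ} (hs : X s = 0) (t : ℝ) :
    hitTime l t (X t) = s :=
  hl.curve_injective hX ((hl.curve_hitTime hX t).trans hs.symm)

theorem hitTime_curve {X : ℝ → ℝ} (hX : IsIntegralCurve X l) (t s : ℝ) :
    hitTime l t (X t) = hitTime l s (X s) :=
  hl.hitTime_eq hX (hl.curve_hitTime hX s) t

theorem hitTime_flow (t x s : ℝ) : hitTime l s (flow l t x s) = hitTime l t x := by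
  rw [hl.hitTime_curve (hl.isIntegralCurve_flow t x) s t, hl.flow_self]

theorem hitTime_zero (t : ℝ) : hitTime l t 0 = t := by
  have := hl.hitTime_eq (hl.isIntegralCurve_flow t 0) (hl.flow_self t 0) t
  rwa [hl.flow_self] at this

theorem continuous_hitTime : Continuous fun q : ℝ × ℝ => hitTime l q.1 q.2 := by
  refine IncreasesAtRate.continuous_of_eq_zero (z := fun q s => σ * flow l q.1 q.2 s)
    (fun q => hl.increasesAtRate_curve (hl.isIntegralCurve_flow _ _)) hl.eps_pos (fun s => ?_)
    fun q => by rw [hl.flow_hitTime, mul_zero]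
  exact continuous_const.mul (hl.continuous_flow.comp
    (by fun_prop : Continuous fun q : ℝ × ℝ => (q.1, q.2, s)))

theorem mul_abs_hitTime_sub_le (t x : ℝ) : ε * |hitTime l t x - t| ≤ |x| := by
  have := hl.le_abs_curve_sub (hl.isIntegralCurve_flow t x) t (hitTime l t x)
  rwa [hl.flow_hitTime, hl.flow_self, zero_sub, abs_neg] at this

/-! #### Amplitudes -/

theorem measurable_deriv_curve {X : ℝ → ℝ} (hX : Continuous X) :
    Measurable fun s => l' s (X s) :=
  hl.measurable_deriv.comp (measurable_id.prodMk hX.measurable)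

theorem intervalIntegrable_deriv {X : ℝ → ℝ} (hX : Continuous X) (a b : ℝ) :
    IntervalIntegrable (fun s => l' s (X s)) volume a b :=
  intervalIntegrable_of_bounded (hl.measurable_deriv_curve hX) (fun _ => hl.abs_deriv_le _ _) a b

theorem ae_continuousAt_deriv_flow (q : ℝ × ℝ) :
    ∀ᵐ s, ContinuousAt (fun q : ℝ × ℝ => l' s (flow l q.1 q.2 s)) q := by
  filter_upwards [hl.ae_curve_ne (hl.isIntegralCurve_flow q.1 q.2) 0,
    hl.ae_curve_ne (hl.isIntegralCurve_flow q.1 q.2) 1] with s h0 h1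
  have hc : Continuous fun q : ℝ × ℝ => (s, flow l q.1 q.2 s) :=
    continuous_const.prodMk (hl.continuous_flow.comp
      (by fun_prop : Continuous fun q : ℝ × ℝ => (q.1, q.2, s)))
  exact ContinuousAt.comp (f := fun q : ℝ × ℝ => (s, flow l q.1 q.2 s))
    (g := fun q : ℝ × ℝ => l' q.1 q.2) (hl.continuousAt_deriv s h0 h1) hc.continuousAt

theorem continuous_integral_deriv_flow {A : Type*} [TopologicalSpace A]
    [FirstCountableTopology A] {q : A → ℝ × ℝ} {a b : A → ℝ} (hq : Continuous q)
    (ha : Continuous a) (hb : Continuous b) :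
    Continuous fun p => ∫ s in a p..b p, l' s (flow l (q p).1 (q p).2 s) := by
  rw [continuous_iff_continuousAt]
  intro p
  rw [← continuousWithinAt_univ]
  refine continuousWithinAt_integral (C := C) (fun _ _ => hl.abs_deriv_le _ _)
    (fun p => hl.measurable_deriv_curve (hl.isIntegralCurve_flow _ _).continuous) ?_
    ha.continuousWithinAt hb.continuousWithinAt
  filter_upwards [hl.ae_continuousAt_deriv_flow (q p)] with s hs
  exact (ContinuousAt.comp (f := q) hs hq.continuousAt).continuousWithinAt

theorem continuous_amplitude : Continuous fun q : ℝ × ℝ => amplitude l l' q.1 q.2 :=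
  (hl.continuous_integral_deriv_flow continuous_id continuous_fst hl.continuous_hitTime).rexp

/-- A curve spends at most time `2 / ε` in `[0, 1]`, outside of which `l'` vanishes. -/
theorem abs_integral_deriv_curve_le {X : ℝ → ℝ} (hX : IsIntegralCurve X l) (a b : ℝ) :
    |∫ s in a..b, l' s (X s)| ≤ 2 * C / ε := by
  have hε := hl.eps_pos
  set T := hitTime l 0 (X 0)
  have hT : X T = 0 := hl.curve_hitTime hX 0
  have hoff : ∀ s ∉ Icc (T - 1 / ε) (T + 1 / ε), l' s (X s) = 0 := by
    refine fun s hs => hl.deriv_eq_zero s _ fun hXs => hs ?_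
    have hexit := hl.le_abs_curve_sub hX T s
    rw [hT, sub_zero, abs_of_nonneg hXs.1] at hexit
    have : |s - T| ≤ 1 / ε := by
      rw [le_div_iff₀ hε]
      linarith [hXs.2]
    obtain ⟨hlower, hupper⟩ := _root_.abs_le.1 this
    exact ⟨by linarith, by linarith⟩
  calc |∫ s in a..b, l' s (X s)| ≤ C * (T + 1 / ε - (T - 1 / ε)) :=
        abs_integral_le_of_eq_zero_off_Icc (by linarith [one_div_pos.2 hε])
          (fun _ => hl.abs_deriv_le _ _) hoff a b
    _ = 2 * C / ε := by ring

theorem amplitude_le (t x : ℝ) : amplitude l l' t x ≤ Real.exp (2 * C / ε) :=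
  Real.exp_le_exp.2 ((le_abs_self _).trans
    (hl.abs_integral_deriv_curve_le (hl.isIntegralCurve_flow t x) _ _))

theorem le_amplitude (t x : ℝ) : Real.exp (-(2 * C / ε)) ≤ amplitude l l' t x :=
  Real.exp_le_exp.2
    (_root_.abs_le.1 (hl.abs_integral_deriv_curve_le (hl.isIntegralCurve_flow t x) _ _)).1

theorem amplitude_curve {X : ℝ → ℝ} (hX : IsIntegralCurve X l) (s : ℝ) :
    amplitude l l' s (X s) = Real.exp (∫ r in s..hitTime l 0 (X 0), l' r (X r)) := by
  rw [amplitude, hl.flow_curve hX, hl.hitTime_curve hX s 0]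

theorem hasDerivAt_amplitude_curve {X : ℝ → ℝ} (hX : IsIntegralCurve X l) {s : ℝ}
    (h0 : X s ≠ 0) (h1 : X s ≠ 1) :
    HasDerivAt (fun s => amplitude l l' s (X s)) (-l' s (X s) * amplitude l l' s (X s)) s := by
  have hc : ContinuousAt (fun s => l' s (X s)) s :=
    ContinuousAt.comp (f := fun s => (s, X s)) (g := fun q : ℝ × ℝ => l' q.1 q.2)
      (hl.continuousAt_deriv s h0 h1) (continuousAt_id.prodMk hX.continuous.continuousAt)
  simp_rw [hl.amplitude_curve hX]
  rw [mul_comm]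
  exact (intervalIntegral.integral_hasDerivAt_left
    (hl.intervalIntegrable_deriv hX.continuous s (hitTime l 0 (X 0)))
    (hl.measurable_deriv_curve hX.continuous).stronglyMeasurable.stronglyMeasurableAtFilter
    hc).exp

theorem lipschitzWith_amplitude_curve {X : ℝ → ℝ} (hX : IsIntegralCurve X l) :
    LipschitzWith (Real.exp (2 * C / ε) * C).toNNReal fun s => amplitude l l' s (X s) := by
  have hi := hl.intervalIntegrable_deriv hX.continuous
  set T := hitTime l 0 (X 0)
  have hle : ∀ s, ∫ r in s..T, l' r (X r) ≤ 2 * C / ε := fun s =>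
    (le_abs_self _).trans (hl.abs_integral_deriv_curve_le hX s T)
  refine LipschitzWith.of_dist_le_mul fun a b => ?_
  rw [Real.coe_toNNReal _ (mul_nonneg (Real.exp_pos _).le hl.bound_nonneg), Real.dist_eq,
    Real.dist_eq, hl.amplitude_curve hX, hl.amplitude_curve hX, mul_assoc]
  refine (abs_exp_sub_exp_le (hle a) (hle b)).trans ?_
  gcongr
  rw [← intervalIntegral.integral_add_adjacent_intervals (hi a b) (hi b T), add_sub_cancel_right,
    abs_sub_comm]
  exact abs_integral_le_of_bounded (fun _ => hl.abs_deriv_le _ _) a b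

/-! #### Differentiability of the flow and of the hitting time -/

theorem tendsto_integral_slope_flow (t x s : ℝ) :
    Tendsto (fun y => ∫ r in t..s, slope (l r) (flow l t x r) (flow l t y r)) (𝓝[≠] x)
      (𝓝 (∫ r in t..s, l' r (flow l t x r))) := by
  have hX := hl.isIntegralCurve_flow t x
  have hne : ∀ᶠ y in 𝓝[≠] x, ∀ r, flow l t x r ≠ flow l t y r := by
    filter_upwards [self_mem_nhdsWithin] with y hy
    refine hl.curve_ne hX (hl.isIntegralCurve_flow t y) (t := t) ?_
    rw [hl.flow_self, hl.flow_self]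
    exact Ne.symm hy
  refine intervalIntegral.tendsto_integral_filter_of_dominated_convergence (fun _ => C) ?_ ?_
    intervalIntegrable_const ?_
  · filter_upwards [hne] with y hy using
      (hl.continuous_slope_curve hX (hl.isIntegralCurve_flow t y) hy).aestronglyMeasurable
  · filter_upwards [hne] with y hy using Eventually.of_forall fun r _ => hl.abs_slope_le r (hy r)
  · filter_upwards [hl.ae_curve_ne hX 0, hl.ae_curve_ne hX 1] with r h0 h1 _
    have hcont : Continuous fun y => flow l t y r :=
      hl.continuous_flow.comp (by fun_prop : Continuous fun y : ℝ => (t, y, r))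
    have hpunctured : Tendsto (fun y => flow l t y r) (𝓝[≠] x) (𝓝[≠] flow l t x r) :=
      tendsto_nhdsWithin_iff.2 ⟨hcont.continuousAt.mono_left nhdsWithin_le_nhds,
        hne.mono fun y hy => (hy r).symm⟩
    exact (hasDerivAt_iff_tendsto_slope.1 (hl.hasDerivAt r _ h0 h1)).comp hpunctured

theorem hasDerivAt_flow (t x s : ℝ) : HasDerivAt (fun y => flow l t y s)
    (Real.exp (∫ r in t..s, l' r (flow l t x r))) x := by
  rw [hasDerivAt_iff_tendsto_slope]
  refine ((Real.continuous_exp.tendsto _).comp (hl.tendsto_integral_slope_flow t x s)).congr' ?_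
  filter_upwards [self_mem_nhdsWithin] with y hy
  have hX := hl.isIntegralCurve_flow t x
  have hY := hl.isIntegralCurve_flow t y
  have hne : flow l t x t ≠ flow l t y t := by
    rw [hl.flow_self, hl.flow_self]
    exact Ne.symm hy
  rw [slope_def_field, hl.curve_sub_eq_mul_exp hX hY (hl.curve_ne hX hY hne) t s, hl.flow_self,
    hl.flow_self, Function.comp_apply, mul_div_cancel_left₀ _ (sub_ne_zero.2 hy)]

theorem isLittleO_flow (t x : ℝ) :
    (fun q : ℝ × ℝ × ℝ => flow l q.1 q.2.1 q.2.2 - q.2.1 - (q.2.2 - q.1) * l t x)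
      =o[𝓝 (t, x, t)] fun q => q.2.2 - q.1 := by
  rw [Asymptotics.isLittleO_iff]
  intro η hη
  have hc : Continuous fun q : ℝ × ℝ × ℝ => l q.2.2 (flow l q.1 q.2.1 q.2.2) :=
    hl.continuous.comp ((continuous_snd.comp continuous_snd).prodMk hl.continuous_flow)
  have hnear : ∀ᶠ q : ℝ × ℝ × ℝ in 𝓝 (t, x, t),
      |l q.2.2 (flow l q.1 q.2.1 q.2.2) - l t x| < η := by
    have := hc.tendsto (t, x, t)
    simp only [hl.flow_self] at this
    simpa [Real.dist_eq] using (tendsto_iff_dist_tendsto_zero.1 this).eventually (gt_mem_nhds hη)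
  obtain ⟨δ, hδ, hball⟩ := Metric.eventually_nhds_iff_ball.1 hnear
  refine Metric.eventually_nhds_iff_ball.2 ⟨δ, hδ, ?_⟩
  rintro ⟨t', x', s⟩ hq
  simp only [← ball_prod_same, mem_prod] at hq hball
  obtain ⟨ht', hx', hs⟩ := hq
  have hseg : ∀ r ∈ uIcc t' s, r ∈ Metric.ball t δ := by
    intro r hr
    rw [Real.ball_eq_Ioo] at ht' hs ⊢
    exact ordConnected_Ioo.uIcc_subset ht' hs hr
  have hd : ∀ r ∈ uIcc t' s, HasDerivWithinAt (fun r => flow l t' x' r - r * l t x)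
      (l r (flow l t' x' r) - l t x) (uIcc t' s) r := fun r _ => by
    have := (hl.isIntegralCurve_flow t' x' r).sub ((hasDerivAt_id r).mul_const (l t x))
    rw [one_mul] at this
    exact this.hasDerivWithinAt
  have := Convex.norm_image_sub_le_of_norm_hasDerivWithin_le (C := η) hd
    (fun r hr => (hball (t', x', r) ⟨ht', hx', hseg r hr⟩).le) (convex_uIcc _ _)
    left_mem_uIcc right_mem_uIcc
  rw [hl.flow_self] at this
  convert! this using 2
  simp only
  ring

theorem hasDerivAt_hitTime_zero (T : ℝ) : HasDerivAt (hitTime l T) (-(1 / l T 0)) 0 := by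
  have hT : hitTime l T 0 = T := hl.hitTime_zero T
  have hc : Continuous fun y => hitTime l T y :=
    hl.continuous_hitTime.comp (by fun_prop : Continuous fun y : ℝ => (T, y))
  have htends : Tendsto (fun y => (T, y, hitTime l T y)) (𝓝 0) (𝓝 (T, 0, T)) := by
    simpa [hT] using
      (by fun_prop : Continuous fun y => (T, y, hitTime l T y)).tendsto 0
  have hO : (fun y => hitTime l T y - T) =O[𝓝 0] fun y : ℝ => y := by
    refine Asymptotics.IsBigO.of_bound (1 / ε) (Eventually.of_forall fun y => ?_)
    rw [one_div, inv_mul_eq_div, le_div_iff₀' hl.eps_pos]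
    exact hl.mul_abs_hitTime_sub_le T y
  have ho := (((hl.isLittleO_flow T 0).comp_tendsto htends).trans_isBigO hO).const_mul_left
    (-(1 / l T 0))
  rw [hasDerivAt_iff_isLittleO]
  simp only [hT, sub_zero, smul_eq_mul]
  refine ho.congr_left fun y => ?_
  simp only [Function.comp, hl.flow_hitTime]
  have := hl.ne_zero T 0
  field_simp
  ring

theorem hasDerivAt_hitTime (t x : ℝ) :
    HasDerivAt (hitTime l t) (-(amplitude l l' t x / l (hitTime l t x) 0)) x := by
  set T := hitTime l t x
  have h0 : flow l t x T = 0 := hl.flow_hitTime t x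
  have hzero := hl.hasDerivAt_hitTime_zero T
  rw [← h0] at hzero
  have hcomp := hzero.comp x (hl.hasDerivAt_flow t x T)
  rw [(funext fun y => hl.hitTime_flow t y T : hitTime l T ∘ (fun y => flow l t y T) = hitTime l t),
    h0] at hcomp
  refine hcomp.congr_deriv ?_
  rw [amplitude]
  ring

theorem hasFDerivAt_flow_same_time (t x : ℝ) :
    HasFDerivAt (fun q : ℝ × ℝ => flow l q.1 q.2 t)
      (ContinuousLinearMap.snd ℝ ℝ ℝ - l t x • ContinuousLinearMap.fst ℝ ℝ ℝ) (t, x) := by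
  rw [hasFDerivAt_iff_isLittleO]
  have htends : Tendsto (fun q : ℝ × ℝ => (q.1, q.2, t)) (𝓝 (t, x)) (𝓝 (t, x, t)) :=
    (by fun_prop : Continuous fun q : ℝ × ℝ => (q.1, q.2, t)).tendsto _
  have hO : (fun q : ℝ × ℝ => t - q.1) =O[𝓝 (t, x)] fun q => q - (t, x) := by
    refine Asymptotics.IsBigO.of_bound 1 (Eventually.of_forall fun q => ?_)
    rw [one_mul, ← neg_sub, norm_neg]
    exact norm_fst_le (q - (t, x))
  refine (((hl.isLittleO_flow t x).comp_tendsto htends).trans_isBigO hO).congr_left fun q => ?_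
  simp only [Function.comp_apply, hl.flow_self, sub_apply, ContinuousLinearMap.coe_snd',
    Prod.snd_sub, smul_apply, ContinuousLinearMap.coe_fst', Prod.fst_sub, smul_eq_mul]
  ring

theorem hasFDerivAt_hitTime (t x : ℝ) : HasFDerivAt (fun q : ℝ × ℝ => hitTime l q.1 q.2)
    ((-(amplitude l l' t x / l (hitTime l t x) 0)) •
      (ContinuousLinearMap.snd ℝ ℝ ℝ - l t x • ContinuousLinearMap.fst ℝ ℝ ℝ)) (t, x) := by
  have hx : HasDerivAt (hitTime l t) (-(amplitude l l' t x / l (hitTime l t x) 0))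
      (flow l t x t) := by
    rw [hl.flow_self]
    exact hl.hasDerivAt_hitTime t x
  refine (hx.comp_hasFDerivAt (t, x) (hl.hasFDerivAt_flow_same_time t x)).congr_of_eventuallyEq
    (Eventually.of_forall fun q => ?_)
  exact (hl.hitTime_flow q.1 q.2 t).symm

theorem contDiff_hitTime : ContDiff ℝ 1 fun q : ℝ × ℝ => hitTime l q.1 q.2 := by
  refine contDiff_one_iff_hasFDerivAt.2 ⟨_, ?_, fun q => hl.hasFDerivAt_hitTime q.1 q.2⟩
  have hexit : Continuous fun q : ℝ × ℝ => l (hitTime l q.1 q.2) 0 :=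
    hl.continuous.comp (hl.continuous_hitTime.prodMk continuous_const)
  have hspeed := hl.continuous
  exact ((hl.continuous_amplitude.div hexit fun q => hl.ne_zero _ _).neg).smul
    (continuous_const.sub (hspeed.smul continuous_const))

theorem hasDerivAt_hitTime_comp {Y : ℝ → ℝ} {v s : ℝ} (hY : HasDerivAt Y v s) :
    HasDerivAt (fun s => hitTime l s (Y s))
      (-(amplitude l l' s (Y s) / l (hitTime l s (Y s)) 0) * (v - l s (Y s))) s := by
  have := (hl.hasFDerivAt_hitTime s (Y s)).comp_hasDerivAt s ((hasDerivAt_id s).prodMk hY)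
  simpa [Function.comp_def] using this

theorem hasFDerivAt_flow_init (t x s : ℝ) :
    HasFDerivAt (fun q : ℝ × ℝ => flow l q.1 q.2 s)
      (Real.exp (∫ r in t..s, l' r (flow l t x r)) •
        (ContinuousLinearMap.snd ℝ ℝ ℝ - l t x • ContinuousLinearMap.fst ℝ ℝ ℝ)) (t, x) := by
  have hx : HasDerivAt (fun y => flow l t y s) (Real.exp (∫ r in t..s, l' r (flow l t x r)))
      (flow l t x t) := by
    rw [hl.flow_self]
    exact hl.hasDerivAt_flow t x s
  refine (hx.comp_hasFDerivAt (t, x) (hl.hasFDerivAt_flow_same_time t x)).congr_of_eventuallyEq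
    (Eventually.of_forall fun q => ?_)
  simp only [Function.comp_apply, hl.flow_curve (hl.isIntegralCurve_flow q.1 q.2)]

theorem hasFDerivAt_flow (t x s : ℝ) :
    HasFDerivAt (fun q : (ℝ × ℝ) × ℝ => flow l q.1.1 q.1.2 q.2)
      ((Real.exp (∫ r in t..s, l' r (flow l t x r)) •
        (ContinuousLinearMap.snd ℝ ℝ ℝ - l t x • ContinuousLinearMap.fst ℝ ℝ ℝ)).comp
          (ContinuousLinearMap.fst ℝ (ℝ × ℝ) ℝ) +
        l s (flow l t x s) • ContinuousLinearMap.snd ℝ (ℝ × ℝ) ℝ) ((t, x), s) := by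
  have hinit := (hl.hasFDerivAt_flow_init t x s).comp ((t, x), s)
    (hasFDerivAt_fst (𝕜 := ℝ) (E := ℝ × ℝ) (F := ℝ))
  have htends : Tendsto (fun q : (ℝ × ℝ) × ℝ => (s, flow l q.1.1 q.1.2 s, q.2)) (𝓝 ((t, x), s))
      (𝓝 (s, flow l t x s, s)) := by
    have hc : Continuous fun q : (ℝ × ℝ) × ℝ => flow l q.1.1 q.1.2 s := hl.continuous_flow.comp
      (by fun_prop : Continuous fun q : (ℝ × ℝ) × ℝ => (q.1.1, q.1.2, s))
    exact (by fun_prop : Continuous fun q : (ℝ × ℝ) × ℝ =>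
      (s, flow l q.1.1 q.1.2 s, q.2)).tendsto _
  have hO : (fun q : (ℝ × ℝ) × ℝ => q.2 - s) =O[𝓝 ((t, x), s)] fun q => q - ((t, x), s) := by
    refine Asymptotics.IsBigO.of_bound 1 (Eventually.of_forall fun q => ?_)
    rw [one_mul]
    exact norm_snd_le (q - ((t, x), s))
  have hlast := ((hl.isLittleO_flow s (flow l t x s)).comp_tendsto htends).trans_isBigO hO
  rw [hasFDerivAt_iff_isLittleO]
  refine (hlast.add hinit.isLittleO).congr_left fun q => ?_
  simp only [Function.comp_apply, hl.flow_curve (hl.isIntegralCurve_flow q.1.1 q.1.2),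
    ContinuousLinearMap.smul_comp, ContinuousLinearMap.sub_comp, smul_apply, sub_apply,
    ContinuousLinearMap.comp_apply, ContinuousLinearMap.coe_fst', Prod.fst_sub,
    ContinuousLinearMap.coe_snd', Prod.snd_sub, smul_eq_mul, add_apply]
  ring

theorem contDiff_flow : ContDiff ℝ 1 fun q : (ℝ × ℝ) × ℝ => flow l q.1.1 q.1.2 q.2 := by
  refine contDiff_one_iff_hasFDerivAt.2 ⟨_, ?_, fun q => hl.hasFDerivAt_flow q.1.1 q.1.2 q.2⟩
  have hexp : Continuous fun q : (ℝ × ℝ) × ℝ =>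
      Real.exp (∫ r in q.1.1..q.2, l' r (flow l q.1.1 q.1.2 r)) :=
    (hl.continuous_integral_deriv_flow continuous_fst (by fun_prop) continuous_snd).rexp
  have hstart : Continuous fun q : (ℝ × ℝ) × ℝ => l q.1.1 q.1.2 :=
    hl.continuous.comp continuous_fst
  have hflow : Continuous fun q : (ℝ × ℝ) × ℝ => flow l q.1.1 q.1.2 q.2 :=
    hl.continuous_flow.comp (by fun_prop : Continuous fun q : (ℝ × ℝ) × ℝ => (q.1.1, q.1.2, q.2))
  have hend : Continuous fun q : (ℝ × ℝ) × ℝ => l q.2 (flow l q.1.1 q.1.2 q.2) :=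
    hl.continuous.comp (continuous_snd.prodMk hflow)
  exact ((hexp.smul (continuous_const.sub (hstart.smul continuous_const))).clm_comp
    continuous_const).add (hend.smul continuous_const)

end SignedSpeed

/-! ### Geometric convergence, exponential decay, integration by parts -/

theorem exists_tendstoUniformly_of_dist_le_geometric {α β : Type*} [PseudoMetricSpace β]
    [CompleteSpace β] {u : ℕ → α → β} {W : α → ℝ} {B : ℝ} (hW : ∀ a, W a ≤ B)
    (hu : ∀ a n, dist (u n a) (u (n + 1) a) ≤ W a / 2 / 2 ^ n) :
    ∃ v, TendstoUniformly u v atTop ∧ ∀ a n, dist (u n a) (v a) ≤ W a / 2 ^ n := by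
  choose v hv using fun a => cauchySeq_tendsto_of_complete (cauchySeq_of_le_geometric_two (hu a))
  have hdist : ∀ a n, dist (u n a) (v a) ≤ W a / 2 ^ n := fun a n =>
    dist_le_of_le_geometric_two_of_tendsto (hu a) (hv a) n
  refine ⟨v, Metric.tendstoUniformly_iff.2 fun η hη => ?_, hdist⟩
  have hgeo : Tendsto (fun n : ℕ => B / 2 ^ n) atTop (𝓝 0) :=
    tendsto_const_nhds.div_atTop (tendsto_pow_atTop_atTop_of_one_lt one_lt_two)
  filter_upwards [hgeo.eventually (gt_mem_nhds hη)] with n hn a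
  rw [dist_comm]
  exact ((hdist a n).trans (by gcongr; exact hW a)).trans_lt hn

theorem exists_fixedPoint_of_weight {α β : Type*} [MetricSpace β] [CompleteSpace β]
    {S : Set (α → β)}
    (hS : ∀ (u : ℕ → α → β) (v : α → β), (∀ n, u n ∈ S) → TendstoUniformly u v atTop → v ∈ S)
    {T : (α → β) → α → β} (hT : MapsTo T S S) {W : α → ℝ} {B : ℝ} (hW : ∀ a, W a ≤ B)
    (hcontr : ∀ u ∈ S, ∀ v ∈ S, ∀ K, 0 ≤ K → (∀ a, dist (u a) (v a) ≤ K * W a) →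
      ∀ a, dist (T u a) (T v a) ≤ K / 2 * W a)
    {u₀ : α → β} (h₀ : u₀ ∈ S) {K : ℝ} (hK : 0 ≤ K)
    (hK₀ : ∀ a, dist (u₀ a) (T u₀ a) ≤ K * W a) :
    ∃ u ∈ S, T u = u := by
  set u : ℕ → α → β := fun n => T^[n] u₀
  have hsucc : ∀ n, u (n + 1) = T (u n) := fun n => Function.iterate_succ_apply' T n u₀
  have huS : ∀ n, u n ∈ S := fun n => hT.iterate n h₀
  have hstep : ∀ n a, dist (u n a) (u (n + 1) a) ≤ K / 2 ^ n * W a := by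
    intro n
    induction n with
    | zero => simpa [u] using hK₀
    | succ n ih =>
      intro a
      rw [hsucc, hsucc (n + 1), pow_succ, ← div_div]
      exact hcontr _ (huS n) _ (huS (n + 1)) _ (by positivity) ih a
  obtain ⟨v, huv, hdist⟩ := exists_tendstoUniformly_of_dist_le_geometric (u := u)
    (W := fun a => 2 * K * W a) (B := 2 * K * B) (fun a => by gcongr; exact hW a)
    fun a n => (hstep n a).trans_eq (by ring)
  have hvS : v ∈ S := hS u v huS huv
  refine ⟨v, hvS, funext fun a => tendsto_nhds_unique ?_
    ((tendsto_add_atTop_iff_nat 1).2 (huv.tendsto_at a))⟩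
  have himage : ∀ n, dist (u (n + 1) a) (T v a) ≤ K * W a / 2 ^ n := fun n => by
    rw [hsucc]
    refine (hcontr _ (huS n) _ hvS (2 * K / 2 ^ n) (by positivity)
      (fun b => (hdist b n).trans_eq (by ring)) a).trans_eq (by ring)
  exact tendsto_iff_dist_tendsto_zero.2 (squeeze_zero (fun _ => dist_nonneg) himage
    (tendsto_const_nhds.div_atTop (tendsto_pow_atTop_atTop_of_one_lt one_lt_two)))

theorem abs_integral_le_of_exp_decay_of_le {f : ℝ → ℝ} {A κ a b : ℝ} (hκ : 0 < κ) (hA : 0 ≤ A)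
    (hab : a ≤ b) (hf : ∀ s ∈ Ioo a b, |f s| ≤ A * Real.exp (-(κ * (s - a)))) :
    |∫ s in a..b, f s| ≤ A / κ := by
  have hd : ∀ s ∈ uIcc a b, HasDerivAt (fun s => -(A / κ) * Real.exp (-(κ * (s - a))))
      (A * Real.exp (-(κ * (s - a)))) s := by
    intro s _
    have := ((((hasDerivAt_id s).sub_const a).const_mul κ).neg.exp).const_mul (-(A / κ))
    convert! this using 1
    simp only [id, Pi.neg_apply]
    field_simp
  have hint : IntervalIntegrable (fun s => A * Real.exp (-(κ * (s - a)))) volume a b :=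
    (by fun_prop : Continuous _).intervalIntegrable _ _
  have hae : ∀ᵐ s, s ∈ Ioc a b → ‖f s‖ ≤ A * Real.exp (-(κ * (s - a))) := by
    filter_upwards [Measure.ae_ne volume b] with s hsb hs
    exact hf s ⟨hs.1, lt_of_le_of_ne hs.2 hsb⟩
  have h := intervalIntegral.norm_integral_le_of_norm_le hab hae hint
  rw [intervalIntegral.integral_eq_sub_of_hasDerivAt hd hint] at h
  have : 0 ≤ A / κ * Real.exp (-(κ * (b - a))) := by positivity
  simp only [sub_self, mul_zero, neg_zero, Real.exp_zero] at h
  exact h.trans (by linarith)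

theorem abs_integral_le_of_exp_decay {f : ℝ → ℝ} {A κ a b : ℝ} (hκ : 0 < κ) (hA : 0 ≤ A)
    (hf : ∀ s ∈ uIoc a b, |f s| ≤ A * Real.exp (-(κ * |s - a|))) :
    |∫ s in a..b, f s| ≤ A / κ := by
  rcases le_total a b with hab | hab
  · refine abs_integral_le_of_exp_decay_of_le hκ hA hab fun s hs => ?_
    simpa only [abs_of_pos (sub_pos.2 hs.1)] using hf s (Ioc_subset_uIoc (Ioo_subset_Ioc_self hs))
  · have hreflect : ∫ s in a..b, f s = -∫ s in -a..-b, f (-s) := by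
      rw [intervalIntegral.integral_comp_neg, neg_neg, neg_neg, intervalIntegral.integral_symm]
    rw [hreflect, abs_neg]
    refine abs_integral_le_of_exp_decay_of_le hκ hA (neg_le_neg hab) fun s hs => ?_
    have := hf (-s) (by rw [uIoc_of_ge hab]; constructor <;> linarith [hs.1, hs.2])
    rwa [show -s - a = -(s - -a) by ring, abs_neg, abs_of_pos (sub_pos.2 hs.1)] at this

theorem mul_sub_mul_eq_integral {g g' v φ : ℝ → ℝ} {a b : ℝ} (hab : a ≤ b)
    {K : ℝ≥0} (hg : LipschitzWith K g)
    (hg' : ∀ᵐ s, s ∈ Icc a b → HasDerivAt g (g' s) s) (hφ : IntervalIntegrable φ volume a b)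
    (hv : ∀ s ∈ Icc a b, v s = v a - ∫ r in a..s, φ r) :
    g b * v b - g a * v a = ∫ s in a..b, (g' s * v s - g s * φ s) := by
  set V : ℝ → ℝ := fun s => v a - ∫ r in a..s, φ r
  have hV : AbsolutelyContinuousOnInterval V a b :=
    ((LipschitzWith.const (v a)).lipschitzOnWith.absolutelyContinuousOnInterval).sub
      (hφ.absolutelyContinuousOnInterval_intervalIntegral (by simp))
  have h := (hg.lipschitzOnWith.absolutelyContinuousOnInterval).integral_deriv_mul_eq_sub hV
  rw [show V a = v a by simp [V], show V b = v b from (hv b ⟨hab, le_rfl⟩).symm] at h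
  rw [← h]
  refine intervalIntegral.integral_congr_ae ?_
  filter_upwards [hg', hφ.ae_hasDerivAt_integral] with s hs1 hs2 hs
  have hs' : s ∈ uIcc a b := uIoc_subset_uIcc hs
  have hs'' : s ∈ Icc a b := by rwa [uIcc_of_le hab] at hs'
  have hderiv := (hs2 hs' a (by simp)).const_sub (v a)
  rw [(hs1 hs'').deriv, show deriv V s = -φ s from hderiv.deriv, hv s hs'']
  ring

/-! ### Hitting times along curves of another speed -/

/-- A lower bound for the rate at which `hitTime` changes along the integral curves of a speed that
stays at distance `ε` from the given one. -/
noncomputable def separationRate (ε C : ℝ) : ℝ := Real.exp (-(2 * C / ε)) / C * ε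

namespace SignedSpeed

variable {ε C σ : ℝ} {l l' : ℝ → ℝ → ℝ} (hl : SignedSpeed ε C σ l l')
include hl

theorem separationRate_pos : 0 < separationRate ε C :=
  mul_pos (div_pos (Real.exp_pos _) hl.bound_pos) hl.eps_pos

theorem le_sign_mul_amplitude_div (t x : ℝ) :
    Real.exp (-(2 * C / ε)) / C ≤ σ * (amplitude l l' t x / l (hitTime l t x) 0) := by
  have hpos : 0 < σ * l (hitTime l t x) 0 := hl.eps_pos.trans_le (hl.le_sign_mul _ _)
  have hle : σ * l (hitTime l t x) 0 ≤ C := by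
    refine (le_abs_self _).trans ?_
    rw [abs_mul, hl.abs_sign, one_mul]
    exact hl.abs_le _ _
  have heq : σ * (amplitude l l' t x / l (hitTime l t x) 0) =
      amplitude l l' t x / (σ * l (hitTime l t x) 0) := by
    have hσ := hl.sign_ne_zero
    have := hl.ne_zero (hitTime l t x) 0
    field_simp
    rw [pow_two, hl.sign_mul_self, one_mul]
  rw [heq]
  exact div_le_div₀ (amplitude_pos _ _ _ _).le (hl.le_amplitude t x) hpos hle

theorem increasesAtRate_hitTime {m : ℝ → ℝ → ℝ} {τ : ℝ} (h : ∀ t x, ε ≤ τ * (l t x - m t x))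
    {Y : ℝ → ℝ} (hY : IsIntegralCurve Y m) :
    IncreasesAtRate (separationRate ε C) (fun s => τ * σ * hitTime l s (Y s)) := by
  refine .of_hasDerivAt (fun s => (hl.hasDerivAt_hitTime_comp (hY s)).const_mul (τ * σ))
    fun s => ?_
  have hfactor := hl.le_sign_mul_amplitude_div s (Y s)
  have hnonneg : 0 ≤ Real.exp (-(2 * C / ε)) / C := div_nonneg (Real.exp_pos _).le hl.bound_nonneg
  calc separationRate ε C
      ≤ σ * (amplitude l l' s (Y s) / l (hitTime l s (Y s)) 0) * (τ * (l s (Y s) - m s (Y s))) :=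
        mul_le_mul hfactor (h s (Y s)) hl.eps_pos.le (hnonneg.trans hfactor)
    _ = _ := by ring

theorem ae_hitTime_ne {m : ℝ → ℝ → ℝ} {τ : ℝ} (h : ∀ t x, ε ≤ τ * (l t x - m t x))
    {Y : ℝ → ℝ} (hY : IsIntegralCurve Y m) (c : ℝ) : ∀ᵐ s, hitTime l s (Y s) ≠ c := by
  have hinj := ((hl.increasesAtRate_hitTime h hY).strictMono hl.separationRate_pos).injective
  have hsub : Set.Subsingleton {s | hitTime l s (Y s) = c} := fun a ha b hb =>
    hinj (congrArg (τ * σ * ·) (Eq.trans ha (Eq.symm hb)))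
  simpa using measure_eq_zero_iff_ae_notMem.1 (hsub.measure_zero volume)

end SignedSpeed

/-! ### Speeds of negative sign -/

namespace SignedSpeed

variable {ε C : ℝ} {l l' : ℝ → ℝ → ℝ} (hl : SignedSpeed ε C (-1) l l')
include hl

theorem curve_strictAnti {X : ℝ → ℝ} (hX : IsIntegralCurve X l) : StrictAnti X := by
  intro a b hab
  have := (hl.increasesAtRate_curve hX).strictMono hl.eps_pos hab
  linarith

theorem strictMono_hitTime (t : ℝ) : StrictMono (hitTime l t) := by
  intro x y hxy
  have hX := hl.isIntegralCurve_flow t x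
  have hY := hl.isIntegralCurve_flow t y
  have hne := hl.curve_ne hX hY (t := t) (by rw [hl.flow_self, hl.flow_self]; exact hxy.ne)
  have hlt : flow l t x (hitTime l t x) < flow l t y (hitTime l t x) := by
    rw [← sub_pos, hl.curve_sub_eq_mul_exp hX hY hne t, hl.flow_self, hl.flow_self]
    exact mul_pos (sub_pos.2 hxy) (Real.exp_pos _)
  rw [hl.flow_hitTime, ← hl.flow_hitTime t y] at hlt
  exact (hl.curve_strictAnti hY).lt_iff_gt.1 hlt

theorem le_hitTime {t x : ℝ} (hx : 0 ≤ x) : t ≤ hitTime l t x := by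
  have := (hl.strictMono_hitTime t).monotone hx
  rwa [hl.hitTime_zero] at this

theorem hitTime_le {t x : ℝ} (hx : x ≤ 1) : hitTime l t x ≤ t + 1 / ε := by
  have hle : ∀ y ∈ Icc (0 : ℝ) 1, hitTime l t y ≤ t + 1 / ε := fun y hy => by
    have := hl.mul_abs_hitTime_sub_le t y
    rw [abs_of_nonneg hy.1, abs_of_nonneg (sub_nonneg.2 (hl.le_hitTime hy.1))] at this
    have : hitTime l t y - t ≤ 1 / ε := by rw [le_div_iff₀ hl.eps_pos]; linarith [hy.2]
    linarith
  exact ((hl.strictMono_hitTime t).monotone hx).trans (hle 1 (by simp))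

end SignedSpeed

/-- The wedge `0 ≤ ξ ≤ x ≤ 1`, for all real times. -/
def wedge : Set (ℝ × ℝ × ℝ) := {P | 0 ≤ P.2.2 ∧ P.2.2 ≤ P.2.1 ∧ P.2.1 ≤ 1}

theorem isClosed_wedge : IsClosed wedge :=
  (isClosed_le continuous_const continuous_snd.snd).inter
    ((isClosed_le continuous_snd.snd continuous_snd.fst).inter
      (isClosed_le continuous_snd.fst continuous_const))

section Row

variable {ι : Type*}

/-- The speed `l j` exceeds `l i` by at least `ε`. -/
def IsAbove (ε : ℝ) (l : ι → ℝ → ℝ → ℝ) (i j : ι) : Prop := ∀ t x, l i t x + ε ≤ l j t x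

/-- A family of pairwise separated speeds, with a distinguished negative one. -/
structure RowSpeeds (ε C : ℝ) (i : ι) (σ : ι → ℝ) (l l' : ι → ℝ → ℝ → ℝ) : Prop where
  speed : ∀ j, SignedSpeed ε C (σ j) (l j) (l' j)
  neg : σ i = -1
  gap : ∀ j k, j ≠ k → IsAbove ε l j k ∨ IsAbove ε l k j

/-- The curve `s ↦ (s, X s, Y s)` through `P`, for `X` and `Y` trajectories of `l i` and `l j`. -/
noncomputable def charPath (l : ι → ℝ → ℝ → ℝ) (i j : ι) (P : ℝ × ℝ × ℝ) (s : ℝ) : ℝ × ℝ × ℝ :=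
  (s, flow (l i) P.1 P.2.1 s, flow (l j) P.1 P.2.2 s)

/-- The point at which `charPath l i j P` reaches the face `ξ = 0`. -/
noncomputable def exitPoint (l : ι → ℝ → ℝ → ℝ) (i j : ι) (P : ℝ × ℝ × ℝ) : ℝ × ℝ × ℝ :=
  charPath l i j P (hitTime (l j) P.1 P.2.2)

/-- The time at which the curve `charPath l i j P` meets the diagonal, that is, at which its two
components have the same hitting time for `l i`. -/
noncomputable def meetTime (l : ι → ℝ → ℝ → ℝ) (i j : ι) (P : ℝ × ℝ × ℝ) : ℝ :=
  Classical.epsilon fun s => hitTime (l i) s (flow (l j) P.1 P.2.2 s) = hitTime (l i) P.1 P.2.1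

open Classical in
/-- The sign of `side j P` tells whether the value at `P` is transported from the face `ξ = 0`
(nonnegative sign) or from the diagonal (negative sign). -/
noncomputable def side (ε : ℝ) (σ : ι → ℝ) (l : ι → ℝ → ℝ → ℝ) (i j : ι) (P : ℝ × ℝ × ℝ) : ℝ :=
  if j = i then 1
  else if IsAbove ε l i j ∧ σ j = -1 then hitTime (l i) P.1 P.2.1 - hitTime (l j) P.1 P.2.2
  else -1

/-- A function decreasing, at a rate uniform in the entry, along the curves `charPath` towards the
boundary point that prescribes the value of the entry. -/
noncomputable def clock (δ : ℝ) (l : ι → ℝ → ℝ → ℝ) (i : ι) (P : ℝ × ℝ × ℝ) : ℝ :=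
  (1 + δ) * (hitTime (l i) P.1 P.2.1 - P.1) - (hitTime (l i) P.1 P.2.2 - P.1)

theorem of_side_nonneg {ε : ℝ} {i : ι} {σ : ι → ℝ} {l : ι → ℝ → ℝ → ℝ} {j : ι} {P : ℝ × ℝ × ℝ}
    (h : 0 ≤ side ε σ l i j P) :
    j = i ∨ (IsAbove ε l i j ∧ σ j = -1) ∧ hitTime (l j) P.1 P.2.2 ≤ hitTime (l i) P.1 P.2.1 := by
  unfold side at h
  split_ifs at h with h1 h2
  · exact Or.inl h1
  · exact Or.inr ⟨h2, by linarith⟩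
  · norm_num at h

namespace RowSpeeds

variable {ε C : ℝ} {i : ι} {σ : ι → ℝ} {l l' : ι → ℝ → ℝ → ℝ} (H : RowSpeeds ε C i σ l l')
include H

theorem base : SignedSpeed ε C (-1) (l i) (l' i) := H.neg ▸ H.speed i

theorem eps_pos : 0 < ε := (H.speed i).eps_pos

theorem ne_of_isAbove {j k : ι} (h : IsAbove ε l j k) : j ≠ k := by
  rintro rfl
  have := h 0 0
  have := H.eps_pos
  linarith

theorem isAbove_of_pos {k : ι} (hk : σ k = 1) : IsAbove ε l i k := by
  intro t x
  have h1 := (H.speed k).le_sign_mul t x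
  have h2 := H.base.le_sign_mul t x
  have := H.eps_pos
  rw [hk] at h1
  linarith

theorem continuous_charPath (j : ι) :
    Continuous fun q : (ℝ × ℝ × ℝ) × ℝ => charPath l i j q.1 q.2 := by
  refine continuous_snd.prodMk (Continuous.prodMk ?_ ?_)
  · exact (H.speed i).continuous_flow.comp
      (by fun_prop : Continuous fun q : (ℝ × ℝ × ℝ) × ℝ => (q.1.1, q.1.2.1, q.2))
  · exact (H.speed j).continuous_flow.comp
      (by fun_prop : Continuous fun q : (ℝ × ℝ × ℝ) × ℝ => (q.1.1, q.1.2.2, q.2))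

theorem flow_charPath_fst (j : ι) (P : ℝ × ℝ × ℝ) (s : ℝ) :
    flow (l i) (charPath l i j P s).1 (charPath l i j P s).2.1 = flow (l i) P.1 P.2.1 :=
  (H.speed i).flow_curve ((H.speed i).isIntegralCurve_flow _ _) s

theorem flow_charPath_snd (j : ι) (P : ℝ × ℝ × ℝ) (s : ℝ) :
    flow (l j) (charPath l i j P s).1 (charPath l i j P s).2.2 = flow (l j) P.1 P.2.2 :=
  (H.speed j).flow_curve ((H.speed j).isIntegralCurve_flow _ _) s

theorem charPath_charPath (j : ι) (P : ℝ × ℝ × ℝ) (s : ℝ) :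
    charPath l i j (charPath l i j P s) = charPath l i j P := by
  funext r
  unfold charPath
  have h1 := H.flow_charPath_fst j P s
  have h2 := H.flow_charPath_snd j P s
  unfold charPath at h1 h2
  rw [h1, h2]

theorem hitTime_charPath_fst (j : ι) (P : ℝ × ℝ × ℝ) (s : ℝ) :
    hitTime (l i) (charPath l i j P s).1 (charPath l i j P s).2.1 = hitTime (l i) P.1 P.2.1 :=
  (H.speed i).hitTime_flow _ _ _

theorem hitTime_charPath_snd (j : ι) (P : ℝ × ℝ × ℝ) (s : ℝ) :
    hitTime (l j) (charPath l i j P s).1 (charPath l i j P s).2.2 = hitTime (l j) P.1 P.2.2 :=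
  (H.speed j).hitTime_flow _ _ _

theorem meetTime_charPath (j : ι) (P : ℝ × ℝ × ℝ) (s : ℝ) :
    meetTime l i j (charPath l i j P s) = meetTime l i j P := by
  unfold meetTime
  rw [H.flow_charPath_snd, H.hitTime_charPath_fst]

theorem side_charPath (j : ι) (P : ℝ × ℝ × ℝ) (s : ℝ) :
    side ε σ l i j (charPath l i j P s) = side ε σ l i j P := by
  unfold side
  rw [H.hitTime_charPath_fst, H.hitTime_charPath_snd]

theorem continuous_side (j : ι) : Continuous (side ε σ l i j) := by
  unfold side
  split_ifs
  · exact continuous_const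
  · exact ((H.speed i).continuous_hitTime.comp
      (by fun_prop : Continuous fun P : ℝ × ℝ × ℝ => (P.1, P.2.1))).sub
      ((H.speed j).continuous_hitTime.comp
      (by fun_prop : Continuous fun P : ℝ × ℝ × ℝ => (P.1, P.2.2)))
  · exact continuous_const

theorem side_of_split {j : ι} (h : IsAbove ε l i j) (hσ : σ j = -1) (P : ℝ × ℝ × ℝ) :
    side ε σ l i j P = hitTime (l i) P.1 P.2.1 - hitTime (l j) P.1 P.2.2 := by
  unfold side
  rw [if_neg (H.ne_of_isAbove h).symm, if_pos ⟨h, hσ⟩]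

theorem side_of_pos {k : ι} (hk : σ k = 1) (P : ℝ × ℝ × ℝ) : side ε σ l i k P = -1 := by
  unfold side
  rw [if_neg, if_neg]
  · rintro ⟨-, h⟩
    rw [hk] at h
    norm_num at h
  · rintro rfl
    rw [H.neg] at hk
    norm_num at hk

theorem ne_of_side_neg {j : ι} {P : ℝ × ℝ × ℝ} (h : side ε σ l i j P < 0) : j ≠ i := by
  rintro rfl
  simp only [side, ↓reduceIte] at h
  linarith

theorem sign_of_side_nonneg {j : ι} {P : ℝ × ℝ × ℝ} (h : 0 ≤ side ε σ l i j P) : σ j = -1 := by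
  rcases of_side_nonneg h with rfl | h
  · exact H.neg
  · exact h.1.2

theorem increasesAtRate_above {j : ι} (h : IsAbove ε l i j) {Y : ℝ → ℝ}
    (hY : IsIntegralCurve Y (l j)) :
    IncreasesAtRate (separationRate ε C) fun s => hitTime (l i) s (Y s) := by
  simpa using H.base.increasesAtRate_hitTime (τ := -1) (fun t x => by linarith [h t x]) hY

theorem increasesAtRate_below {j : ι} (h : IsAbove ε l j i) {Y : ℝ → ℝ}
    (hY : IsIntegralCurve Y (l j)) :
    IncreasesAtRate (separationRate ε C) fun s => -hitTime (l i) s (Y s) := by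
  simpa using H.base.increasesAtRate_hitTime (τ := 1) (fun t x => by linarith [h t x]) hY

theorem exists_sign {j k : ι} (hjk : j ≠ k) :
    ∃ τ : ℝ, τ ≠ 0 ∧ ∀ t x, ε ≤ τ * (l j t x - l k t x) := by
  rcases H.gap j k hjk with h | h
  · exact ⟨-1, by norm_num, fun t x => by linarith [h t x]⟩
  · exact ⟨1, one_ne_zero, fun t x => by linarith [h t x]⟩

theorem exists_increasesAtRate {j : ι} (hj : j ≠ i) :
    ∃ τ : ℝ, τ ≠ 0 ∧ ∀ Y, IsIntegralCurve Y (l j) →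
      IncreasesAtRate (separationRate ε C) fun s => τ * hitTime (l i) s (Y s) := by
  obtain ⟨τ, hτ, h⟩ := H.exists_sign hj.symm
  exact ⟨τ * -1, by simpa using hτ, fun Y hY => H.base.increasesAtRate_hitTime h hY⟩

theorem hitTime_meetTime {j : ι} (hj : j ≠ i) (P : ℝ × ℝ × ℝ) :
    hitTime (l i) (meetTime l i j P) (flow (l j) P.1 P.2.2 (meetTime l i j P)) =
      hitTime (l i) P.1 P.2.1 := by
  refine Classical.epsilon_spec
    (p := fun s => hitTime (l i) s (flow (l j) P.1 P.2.2 s) = hitTime (l i) P.1 P.2.1) ?_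
  obtain ⟨τ, hτ, hinc⟩ := H.exists_increasesAtRate hj
  have hY := (H.speed j).isIntegralCurve_flow P.1 P.2.2
  have hc : Continuous fun s => hitTime (l i) s (flow (l j) P.1 P.2.2 s) :=
    H.base.continuous_hitTime.comp (continuous_id.prodMk hY.continuous)
  obtain ⟨s, hs⟩ := ((hinc _ hY).sub_const (τ * hitTime (l i) P.1 P.2.1)).exists_zero
    H.base.separationRate_pos ((continuous_const.mul hc).sub continuous_const)
  exact ⟨s, mul_left_cancel₀ hτ (sub_eq_zero.1 hs)⟩

theorem continuous_meetTime {j : ι} (hj : j ≠ i) : Continuous (meetTime l i j) := by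
  obtain ⟨τ, -, hinc⟩ := H.exists_increasesAtRate hj
  have hξ : ∀ s, Continuous fun P : ℝ × ℝ × ℝ => hitTime (l i) s (flow (l j) P.1 P.2.2 s) :=
    fun s => H.base.continuous_hitTime.comp (continuous_const.prodMk
      ((H.speed j).continuous_flow.comp
        (by fun_prop : Continuous fun P : ℝ × ℝ × ℝ => (P.1, P.2.2, s))))
  have hx : Continuous fun P : ℝ × ℝ × ℝ => hitTime (l i) P.1 P.2.1 :=
    H.base.continuous_hitTime.comp (by fun_prop : Continuous fun P : ℝ × ℝ × ℝ => (P.1, P.2.1))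
  refine IncreasesAtRate.continuous_of_eq_zero
    (fun P => (hinc _ ((H.speed j).isIntegralCurve_flow P.1 P.2.2)).sub_const
      (τ * hitTime (l i) P.1 P.2.1)) H.base.separationRate_pos
    (fun s => (continuous_const.mul (hξ s)).sub (continuous_const.mul hx)) fun P => ?_
  rw [H.hitTime_meetTime hj P, sub_self]

theorem eq_meetTime {j : ι} (hj : j ≠ i) {P : ℝ × ℝ × ℝ} {s : ℝ}
    (hs : flow (l j) P.1 P.2.2 s = flow (l i) P.1 P.2.1 s) : s = meetTime l i j P := by
  obtain ⟨τ, -, hinc⟩ := H.exists_increasesAtRate hj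
  have h : hitTime (l i) s (flow (l j) P.1 P.2.2 s) = hitTime (l i) P.1 P.2.1 := by
    rw [hs]; exact H.base.hitTime_flow _ _ _
  exact ((hinc _ ((H.speed j).isIntegralCurve_flow P.1 P.2.2)).strictMono
    H.base.separationRate_pos).injective
      (congrArg (τ * ·) (h.trans (H.hitTime_meetTime hj P).symm))

theorem meetTime_diag {j : ι} (hj : j ≠ i) (t x : ℝ) : meetTime l i j (t, x, x) = t :=
  (H.eq_meetTime hj (by simp [(H.speed _).flow_self])).symm

theorem le_meetTime_of_above {j : ι} (h : IsAbove ε l i j) {P : ℝ × ℝ × ℝ} (hP : P.2.2 ≤ P.2.1) :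
    P.1 ≤ meetTime l i j P := by
  have hY := (H.speed j).isIntegralCurve_flow P.1 P.2.2
  have h2 := H.hitTime_meetTime (H.ne_of_isAbove h).symm P
  refine ((H.increasesAtRate_above h hY).strictMono H.base.separationRate_pos).le_iff_le.1 ?_
  simp only [h2, (H.speed j).flow_self]
  exact (H.base.strictMono_hitTime _).monotone hP

theorem meetTime_le_of_below {j : ι} (h : IsAbove ε l j i) {P : ℝ × ℝ × ℝ} (hP : P.2.2 ≤ P.2.1) :
    meetTime l i j P ≤ P.1 := by
  have hY := (H.speed j).isIntegralCurve_flow P.1 P.2.2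
  have h2 := H.hitTime_meetTime (H.ne_of_isAbove h) P
  refine ((H.increasesAtRate_below h hY).strictMono H.base.separationRate_pos).le_iff_le.1 ?_
  simp only [h2, (H.speed j).flow_self]
  exact neg_le_neg ((H.base.strictMono_hitTime _).monotone hP)

theorem side_diag_neg {j : ι} (hj : j ≠ i) {t x : ℝ} (hx : 0 < x) :
    side ε σ l i j (t, x, x) < 0 := by
  unfold side
  rw [if_neg hj]
  split_ifs with h
  · have hjs : SignedSpeed ε C (-1) (l j) (l' j) := h.2 ▸ H.speed j
    have hY := (H.speed j).isIntegralCurve_flow t x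
    have ht : t < hitTime (l j) t x := by
      have := hjs.strictMono_hitTime t hx
      rwa [hjs.hitTime_zero] at this
    have := (H.increasesAtRate_above h.1 hY).strictMono H.base.separationRate_pos ht
    simp only [(H.speed j).flow_self, (H.speed j).flow_hitTime, H.base.hitTime_zero] at this
    simpa using this
  · norm_num

theorem clock_forward {j : ι} (hj : j = i ∨ IsAbove ε l i j) (P : ℝ × ℝ × ℝ) {s : ℝ}
    (hs : P.1 ≤ s) : clock (separationRate ε C / 2) l i (charPath l i j P s) ≤
      clock (separationRate ε C / 2) l i P - separationRate ε C / 2 * (s - P.1) := by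
  have h1 := H.hitTime_charPath_fst j P s
  have h2 : hitTime (l i) P.1 P.2.2 ≤ hitTime (l i) s (flow (l j) P.1 P.2.2 s) := by
    rcases hj with rfl | hj
    · rw [H.base.hitTime_flow]
    · have := ((H.increasesAtRate_above hj ((H.speed j).isIntegralCurve_flow P.1 P.2.2)).strictMono
        H.base.separationRate_pos).monotone hs
      simpa [(H.speed j).flow_self] using this
  unfold clock
  rw [h1]
  simp only [charPath]
  linarith

theorem clock_backward {j : ι} (hj : IsAbove ε l j i) (P : ℝ × ℝ × ℝ) {s : ℝ}
    (hs : s ≤ P.1) : clock (separationRate ε C / 2) l i (charPath l i j P s) ≤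
      clock (separationRate ε C / 2) l i P - separationRate ε C / 2 * (P.1 - s) := by
  have h1 := H.hitTime_charPath_fst j P s
  have h2 := H.increasesAtRate_below hj ((H.speed j).isIntegralCurve_flow P.1 P.2.2) s P.1 hs
  simp only [(H.speed j).flow_self] at h2
  unfold clock
  rw [h1]
  simp only [charPath]
  linarith

theorem abs_clock_le {P : ℝ × ℝ × ℝ} (hP : P ∈ wedge) :
    |clock (separationRate ε C / 2) l i P| ≤ (1 + separationRate ε C / 2) * (1 / ε) := by
  obtain ⟨h0, h1, h2⟩ := hP
  have hδ := half_pos H.base.separationRate_pos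
  have hξ : 0 ≤ hitTime (l i) P.1 P.2.2 - P.1 := sub_nonneg.2 (H.base.le_hitTime h0)
  have hξ' : hitTime (l i) P.1 P.2.2 - P.1 ≤ 1 / ε := by
    linarith [H.base.hitTime_le (t := P.1) (h1.trans h2)]
  have hx : 0 ≤ hitTime (l i) P.1 P.2.1 - P.1 := sub_nonneg.2 (H.base.le_hitTime (h0.trans h1))
  have hx' : hitTime (l i) P.1 P.2.1 - P.1 ≤ 1 / ε := by
    linarith [H.base.hitTime_le (t := P.1) h2]
  unfold clock
  rw [abs_le]
  constructor <;> nlinarith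

theorem exitPoint_eq (j : ι) (P : ℝ × ℝ × ℝ) : exitPoint l i j P =
    (hitTime (l j) P.1 P.2.2, flow (l i) P.1 P.2.1 (hitTime (l j) P.1 P.2.2), 0) := by
  simp [exitPoint, charPath, (H.speed j).flow_hitTime]

theorem continuous_hitTime_snd (j : ι) :
    Continuous fun P : ℝ × ℝ × ℝ => hitTime (l j) P.1 P.2.2 :=
  (H.speed j).continuous_hitTime.comp (by fun_prop : Continuous fun P : ℝ × ℝ × ℝ => (P.1, P.2.2))

theorem continuous_exitPoint (j : ι) : Continuous (exitPoint l i j) :=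
  (H.continuous_charPath j).comp (continuous_id.prodMk (H.continuous_hitTime_snd j))

theorem le_hitTime_of_side_nonneg {j : ι} {P : ℝ × ℝ × ℝ} (hP : P ∈ wedge)
    (h : 0 ≤ side ε σ l i j P) : P.1 ≤ hitTime (l j) P.1 P.2.2 :=
  have hjs : SignedSpeed ε C (-1) (l j) (l' j) := H.sign_of_side_nonneg h ▸ H.speed j
  hjs.le_hitTime hP.1

theorem exitPoint_mem_wedge {j : ι} {P : ℝ × ℝ × ℝ} (hP : P ∈ wedge)
    (h : 0 ≤ side ε σ l i j P) : exitPoint l i j P ∈ wedge := by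
  have hanti := (H.base.curve_strictAnti ((H.speed i).isIntegralCurve_flow P.1 P.2.1)).antitone
  rw [H.exitPoint_eq]
  refine ⟨le_rfl, ?_, ?_⟩
  · have hle : hitTime (l j) P.1 P.2.2 ≤ hitTime (l i) P.1 P.2.1 := by
      rcases of_side_nonneg h with rfl | h
      · exact (H.base.strictMono_hitTime _).monotone hP.2.1
      · exact h.2
    simpa only [H.base.flow_hitTime] using hanti hle
  · have := hanti (H.le_hitTime_of_side_nonneg hP h)
    rw [H.base.flow_self] at this
    exact this.trans hP.2.2

theorem clock_exitPoint_le {j : ι} {P : ℝ × ℝ × ℝ} (hP : P ∈ wedge)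
    (h : 0 ≤ side ε σ l i j P) : clock (separationRate ε C / 2) l i (exitPoint l i j P) ≤
      clock (separationRate ε C / 2) l i P := by
  have ht := H.le_hitTime_of_side_nonneg hP h
  have hδ := H.base.separationRate_pos
  have := mul_nonneg (half_pos hδ).le (sub_nonneg.2 ht)
  have := H.clock_forward ((of_side_nonneg h).imp id fun h => h.1.1) P ht
  unfold exitPoint
  linarith

end RowSpeeds

end Row

/-! ### The integral equations of a row -/

theorem abs_sum_le_card_mul {ι : Type*} [Fintype ι] {f : ι → ℝ} {A : ℝ} (hf : ∀ k, |f k| ≤ A) :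
    |∑ k, f k| ≤ Fintype.card ι * A := by
  simpa [nsmul_eq_mul] using
    (Finset.abs_sum_le_sum_abs f Finset.univ).trans (Finset.sum_le_card_nsmul _ _ A fun k _ => hf k)

section Row

variable {ι : Type*}

/-- Coefficients and boundary data of one row `u = (u j)` of the kernel equations: the transport
equation of `u j` is coupled to the entries `u k` by `coupling k j`, the value of `u j` on the
diagonal `ξ = x` is `diagonal j`, and on the face `ξ = 0` it is
`face j + ∑ k, u k * reflection k j`. -/
structure RowData (ι : Type*) where
  coupling : ι → ι → ℝ → ℝ → ℝ
  diagonal : ι → ℝ → ℝ → ℝ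
  face : ι → ℝ → ℝ
  reflection : ι → ι → ℝ → ℝ

/-- Row data that are continuous and bounded by `N`, without self-coupling, and such that only
columns of positive speed are reflected. -/
structure RowData.Admissible (F : RowData ι) (N : ℝ) (i : ι) (σ : ι → ℝ) : Prop where
  coupling_cont : ∀ k j, Continuous fun q : ℝ × ℝ => F.coupling k j q.1 q.2
  coupling_bound : ∀ k j t x, |F.coupling k j t x| ≤ N
  coupling_self : ∀ j t x, F.coupling j j t x = 0
  diagonal_cont : ∀ j, j ≠ i → Continuous fun q : ℝ × ℝ => F.diagonal j q.1 q.2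
  diagonal_bound : ∀ j, j ≠ i → ∀ t x, |F.diagonal j t x| ≤ N
  face_cont : ∀ j, Continuous (F.face j)
  face_bound : ∀ j t, |F.face j t| ≤ N
  reflection_cont : ∀ k j, Continuous (F.reflection k j)
  reflection_bound : ∀ k j t, |F.reflection k j t| ≤ N
  reflection_eq_zero : ∀ k j t, σ k ≠ 1 → F.reflection k j t = 0

/-- The functions in which a row is sought: supported in the wedge, bounded, and continuous on each
side of the surfaces `side = 0`. -/
structure IsRow (ε : ℝ) (σ : ι → ℝ) (l : ι → ℝ → ℝ → ℝ) (i : ι) (u : ι × (ℝ × ℝ × ℝ) → ℝ) :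
    Prop where
  zero : ∀ j, ∀ P ∉ wedge, u (j, P) = 0
  bdd : ∃ B, ∀ a, |u a| ≤ B
  low : ∀ j, ContinuousOn (fun P => u (j, P)) (wedge ∩ {P | 0 ≤ side ε σ l i j P})
  high : ∀ j, ContinuousOn (fun P => u (j, P)) (wedge ∩ {P | side ε σ l i j P < 0})

theorem RowData.Admissible.nonneg {F : RowData ι} {N : ℝ} {i : ι} {σ : ι → ℝ}
    (hF : F.Admissible N i σ) : 0 ≤ N :=
  (abs_nonneg _).trans (hF.face_bound i 0)

theorem isRow_zero {ε : ℝ} {σ : ι → ℝ} {l : ι → ℝ → ℝ → ℝ} {i : ι} :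
    IsRow ε σ l i fun _ => 0 :=
  ⟨fun _ _ _ => rfl, ⟨0, fun _ => by simp⟩, fun _ => continuousOn_const,
    fun _ => continuousOn_const⟩

theorem isRow_of_tendstoUniformly {ε : ℝ} {i : ι} {σ : ι → ℝ} {l : ι → ℝ → ℝ → ℝ}
    {w : ℕ → ι × (ℝ × ℝ × ℝ) → ℝ} {v : ι × (ℝ × ℝ × ℝ) → ℝ} (hw : ∀ n, IsRow ε σ l i (w n))
    (hv : TendstoUniformly w v atTop) : IsRow ε σ l i v := by
  have hcomp : ∀ j, TendstoUniformly (fun n P => w n (j, P)) (fun P => v (j, P)) atTop :=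
    fun j => hv.comp fun P => (j, P)
  refine ⟨fun j P hP => ?_, ?_, fun j => ?_, fun j => ?_⟩
  · refine tendsto_nhds_unique (hv.tendsto_at (j, P)) ?_
    simp only [(hw _).zero j P hP]
    exact tendsto_const_nhds
  · obtain ⟨n, hn⟩ := (Metric.tendstoUniformly_iff.1 hv 1 one_pos).exists
    obtain ⟨B, hB⟩ := (hw n).bdd
    refine ⟨B + 1, fun a => ?_⟩
    have h1 := hn a
    rw [Real.dist_eq] at h1
    have h2 := abs_add_le (v a - w n a) (w n a)
    rw [sub_add_cancel] at h2
    linarith [hB a]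
  · exact (hcomp j).tendstoUniformlyOn.continuousOn
      (Frequently.of_forall fun n => (hw n).low j)
  · exact (hcomp j).tendstoUniformlyOn.continuousOn
      (Frequently.of_forall fun n => (hw n).high j)

namespace RowSpeeds

variable {ε C : ℝ} {i : ι} {σ : ι → ℝ} {l l' : ι → ℝ → ℝ → ℝ} (H : RowSpeeds ε C i σ l l')
  {u : ι × (ℝ × ℝ × ℝ) → ℝ}
include H

theorem measurable_row (hu : IsRow ε σ l i u) (k : ι) : Measurable fun P => u (k, P) := by
  classical
  have hw := isClosed_wedge.measurableSet
  have hs := (H.continuous_side k).measurable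
  have h1 : MeasurableSet (wedge ∩ {P | 0 ≤ side ε σ l i k P}) :=
    hw.inter (measurableSet_le measurable_const hs)
  have h2 : MeasurableSet (wedge ∩ {P | side ε σ l i k P < 0}) :=
    hw.inter (measurableSet_lt hs measurable_const)
  have m1 := (hu.low k).measurable_piecewise (continuousOn_const (c := (0 : ℝ))) h1
  have m2 := (hu.high k).measurable_piecewise (continuousOn_const (c := (0 : ℝ))) h2
  convert! m1.add m2 using 1
  funext P
  by_cases hP : P ∈ wedge
  · by_cases hsd : 0 ≤ side ε σ l i k P
    · simp [Set.piecewise, hP, hsd, not_lt.2 hsd]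
    · simp [Set.piecewise, hP, hsd, not_le.1 hsd]
  · simp [Set.piecewise, hP, hu.zero k P hP]

theorem continuousWithinAt_row (hu : IsRow ε σ l i u) {k : ι} {Q : ℝ × ℝ × ℝ} (hQ : Q ∈ wedge)
    (hside : side ε σ l i k Q ≠ 0) : ContinuousWithinAt (fun P => u (k, P)) wedge Q := by
  have hc := (H.continuous_side k).continuousAt (x := Q)
  rcases lt_or_gt_of_ne hside with hlt | hgt
  · refine (hu.high k Q ⟨hQ, hlt⟩).mono_of_mem_nhdsWithin ?_
    exact inter_mem self_mem_nhdsWithin (mem_nhdsWithin_of_mem_nhds (hc.eventually_lt_const hlt))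
  · refine (hu.low k Q ⟨hQ, hgt.le⟩).mono_of_mem_nhdsWithin ?_
    exact inter_mem self_mem_nhdsWithin (mem_nhdsWithin_of_mem_nhds
      ((hc.eventually_const_lt hgt).mono fun _ h => le_of_lt h))

theorem ae_side_ne {j k : ι} (hjk : k ≠ j) (P : ℝ × ℝ × ℝ) :
    ∀ᵐ s, side ε σ l i k (charPath l i j P s) ≠ 0 := by
  unfold side
  split_ifs
  · simp
  · obtain ⟨τ, -, hτ⟩ := H.exists_sign hjk
    filter_upwards [(H.speed k).ae_hitTime_ne hτ ((H.speed j).isIntegralCurve_flow P.1 P.2.2)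
      (hitTime (l i) P.1 P.2.1)] with s hs
    rw [H.hitTime_charPath_fst]
    exact sub_ne_zero.2 hs.symm
  · simp

theorem ae_ne_diag {j : ι} (hj : j ≠ i) (P : ℝ × ℝ × ℝ) :
    ∀ᵐ s, flow (l j) P.1 P.2.2 s ≠ flow (l i) P.1 P.2.1 s := by
  have : Set.Subsingleton {s | flow (l j) P.1 P.2.2 s = flow (l i) P.1 P.2.1 s} :=
    fun a ha b hb => (H.eq_meetTime hj ha).trans (H.eq_meetTime hj hb).symm
  simpa using (measure_eq_zero_iff_ae_notMem.1 (this.measure_zero volume))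

theorem flow_mono {t x y : ℝ} (hxy : x ≤ y) (s : ℝ) : flow (l i) t x s ≤ flow (l i) t y s := by
  refine (H.base.strictMono_hitTime s).le_iff_le.1 ?_
  rw [H.base.hitTime_flow, H.base.hitTime_flow]
  exact (H.base.strictMono_hitTime t).monotone hxy

theorem eventually_charPath_mem_wedge {j : ι} {P₀ : ℝ × ℝ × ℝ} {s : ℝ}
    (hs : charPath l i j P₀ s ∈ wedge) (h0 : flow (l j) P₀.1 P₀.2.2 s ≠ 0)
    (h1 : flow (l i) P₀.1 P₀.2.1 s ≠ 1)
    (hd : j ≠ i → flow (l j) P₀.1 P₀.2.2 s ≠ flow (l i) P₀.1 P₀.2.1 s) :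
    ∀ᶠ P in 𝓝[wedge] P₀, charPath l i j P s ∈ wedge := by
  have hc : Continuous fun P => charPath l i j P s :=
    (H.continuous_charPath j).comp (continuous_id.prodMk continuous_const)
  have hx : Continuous fun P => (charPath l i j P s).2.1 := hc.snd.fst
  have hξ : Continuous fun P => (charPath l i j P s).2.2 := hc.snd.snd
  have hpos : ∀ᶠ P in 𝓝[wedge] P₀, 0 < (charPath l i j P s).2.2 :=
    nhdsWithin_le_nhds (hξ.continuousAt.eventually_const_lt (lt_of_le_of_ne hs.1 h0.symm))
  have hlt_one : ∀ᶠ P in 𝓝[wedge] P₀, (charPath l i j P s).2.1 < 1 :=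
    nhdsWithin_le_nhds (hx.continuousAt.eventually_lt_const (lt_of_le_of_ne hs.2.2 h1))
  have hle : ∀ᶠ P in 𝓝[wedge] P₀, (charPath l i j P s).2.2 ≤ (charPath l i j P s).2.1 := by
    rcases eq_or_ne j i with rfl | hj
    · filter_upwards [self_mem_nhdsWithin] with P hP using H.flow_mono hP.2.1 s
    · filter_upwards [nhdsWithin_le_nhds (hξ.continuousAt.eventually_lt hx.continuousAt
        (lt_of_le_of_ne hs.2.1 (hd hj)))] with P hP using le_of_lt hP
  filter_upwards [hpos, hlt_one, hle] with P a1 a2 a3 using ⟨a1.le, a3, a2.le⟩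

theorem ae_continuousWithinAt_path (hu : IsRow ε σ l i u) {j k : ι} (hjk : k ≠ j)
    (P₀ : ℝ × ℝ × ℝ) :
    ∀ᵐ s, ContinuousWithinAt (fun P => u (k, charPath l i j P s)) wedge P₀ := by
  have hX := (H.speed i).isIntegralCurve_flow P₀.1 P₀.2.1
  have hY := (H.speed j).isIntegralCurve_flow P₀.1 P₀.2.2
  have hdiag : ∀ᵐ s, j ≠ i → flow (l j) P₀.1 P₀.2.2 s ≠ flow (l i) P₀.1 P₀.2.1 s :=
    eventually_imp_distrib_left.2 fun hj => H.ae_ne_diag hj P₀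
  filter_upwards [H.ae_side_ne hjk P₀, (H.speed i).ae_curve_ne hX 1, (H.speed j).ae_curve_ne hY 0,
    hdiag] with s hside h1 h0 hd
  have hc : Continuous fun P => charPath l i j P s :=
    (H.continuous_charPath j).comp (continuous_id.prodMk continuous_const)
  by_cases hQ : charPath l i j P₀ s ∈ wedge
  · exact (H.continuousWithinAt_row hu hQ hside).tendsto.comp (tendsto_nhdsWithin_iff.2
      ⟨hc.continuousAt.mono_left nhdsWithin_le_nhds, H.eventually_charPath_mem_wedge hQ h0 h1 hd⟩)
  · have hout : ∀ᶠ P in 𝓝[wedge] P₀, u (k, charPath l i j P s) = 0 := by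
      refine nhdsWithin_le_nhds ?_
      filter_upwards [hc.continuousAt.eventually
        (isClosed_wedge.isOpen_compl.mem_nhds hQ)] with P hP using hu.zero k _ hP
    exact continuousWithinAt_const.congr_of_eventuallyEq hout (hu.zero k _ hQ)

theorem continuousOn_pos (hu : IsRow ε σ l i u) {k : ι} (hk : σ k = 1) :
    ContinuousOn (fun P => u (k, P)) wedge := by
  refine (hu.high k).mono fun P hP => ⟨hP, ?_⟩
  rw [mem_ofPred_eq, H.side_of_pos hk]
  norm_num

end RowSpeeds

/-- `e` is a time up to which the entry `j` may be followed along `charPath l i j P` in the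
direction in which `clock` decreases. -/
def IsExitTime (ε : ℝ) (l : ι → ℝ → ℝ → ℝ) (i j : ι) (P : ℝ × ℝ × ℝ) (e : ℝ) : Prop :=
  ((j = i ∨ IsAbove ε l i j) ∧ P.1 ≤ e) ∨ (IsAbove ε l j i ∧ e ≤ P.1)

open Classical in
/-- The weight for which `rowStep` is a contraction. Columns of positive speed get the factor `1`
and all others the large factor `R`, because the former are reflected into the latter on the face
`ξ = 0`; the exponential makes the contribution of the integrals small. -/
noncomputable def rowWeight (δ L R : ℝ) (σ : ι → ℝ) (l : ι → ℝ → ℝ → ℝ) (i : ι)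
    (a : ι × (ℝ × ℝ × ℝ)) : ℝ :=
  if a.2 ∈ wedge then (if σ a.1 = 1 then 1 else R) * Real.exp (L * clock δ l i a.2) else 0

section Weight

variable {δ L R : ℝ} {σ : ι → ℝ} {l : ι → ℝ → ℝ → ℝ} {i : ι}

theorem rowWeight_le_mul_exp (hR : 1 ≤ R) (a : ι × (ℝ × ℝ × ℝ)) :
    rowWeight δ L R σ l i a ≤ R * Real.exp (L * clock δ l i a.2) := by
  have hexp := Real.exp_pos (L * clock δ l i a.2)
  unfold rowWeight
  split_ifs
  · exact mul_le_mul_of_nonneg_right hR hexp.le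
  · exact le_rfl
  · positivity

theorem exp_le_rowWeight (hR : 1 ≤ R) {a : ι × (ℝ × ℝ × ℝ)} (ha : a.2 ∈ wedge) :
    Real.exp (L * clock δ l i a.2) ≤ rowWeight δ L R σ l i a := by
  rw [rowWeight, if_pos ha]
  refine le_mul_of_one_le_left (Real.exp_pos _).le ?_
  split_ifs
  · exact le_rfl
  · exact hR

theorem rowWeight_nonneg (hR : 1 ≤ R) (a : ι × (ℝ × ℝ × ℝ)) : 0 ≤ rowWeight δ L R σ l i a := by
  by_cases ha : a.2 ∈ wedge
  · exact (Real.exp_pos _).le.trans (exp_le_rowWeight hR ha)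
  · exact (if_neg ha).ge

end Weight

namespace RowSpeeds

variable {ε C L R : ℝ} {i : ι} {σ : ι → ℝ} {l l' : ι → ℝ → ℝ → ℝ} (H : RowSpeeds ε C i σ l l')
include H

theorem clock_path_le {j : ι} {P : ℝ × ℝ × ℝ} {e : ℝ} (he : IsExitTime ε l i j P e) {s : ℝ}
    (hs : s ∈ uIoc P.1 e) : clock (separationRate ε C / 2) l i (charPath l i j P s) ≤
      clock (separationRate ε C / 2) l i P - separationRate ε C / 2 * |s - P.1| := by
  rcases he with ⟨hj, he⟩ | ⟨hj, he⟩
  · rw [uIoc_of_le he] at hs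
    rw [abs_of_nonneg (sub_nonneg.2 hs.1.le)]
    exact H.clock_forward hj P hs.1.le
  · rw [uIoc_of_ge he] at hs
    rw [abs_of_nonpos (sub_nonpos.2 hs.2), neg_sub]
    exact H.clock_backward hj P hs.2

theorem isExitTime_hitTime {j : ι} {P : ℝ × ℝ × ℝ} (hP : P ∈ wedge)
    (hside : 0 ≤ side ε σ l i j P) : IsExitTime ε l i j P (hitTime (l j) P.1 P.2.2) :=
  Or.inl ⟨(of_side_nonneg hside).imp id fun h => h.1.1, H.le_hitTime_of_side_nonneg hP hside⟩

theorem isExitTime_meetTime {j : ι} (hj : j ≠ i) {P : ℝ × ℝ × ℝ} (hP : P ∈ wedge) :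
    IsExitTime ε l i j P (meetTime l i j P) := by
  rcases H.gap i j hj.symm with h | h
  · exact Or.inl ⟨Or.inr h, H.le_meetTime_of_above h hP.2.1⟩
  · exact Or.inr ⟨h, H.meetTime_le_of_below h hP.2.1⟩

theorem exists_rowWeight_le (hL : 0 < L) (hR : 1 ≤ R) :
    ∃ B, ∀ a, rowWeight (separationRate ε C / 2) L R σ l i a ≤ B := by
  set A := (1 + separationRate ε C / 2) * (1 / ε)
  refine ⟨R * Real.exp (L * A), fun a => ?_⟩
  by_cases ha : a.2 ∈ wedge
  · refine (rowWeight_le_mul_exp hR a).trans (mul_le_mul_of_nonneg_left ?_ (by linarith))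
    exact Real.exp_le_exp.2 (mul_le_mul_of_nonneg_left (abs_le.1 (H.abs_clock_le ha)).2 hL.le)
  · exact (if_neg ha).trans_le (by positivity)

theorem exists_abs_le_mul_rowWeight (hL : 0 < L) (hR : 1 ≤ R) {g : ι × (ℝ × ℝ × ℝ) → ℝ}
    (hg : ∃ B, ∀ a, |g a| ≤ B) (hg₀ : ∀ j, ∀ P ∉ wedge, g (j, P) = 0) :
    ∃ K, 0 ≤ K ∧ ∀ a, |g a| ≤ K * rowWeight (separationRate ε C / 2) L R σ l i a := by
  obtain ⟨B, hB⟩ := hg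
  have hB₀ : 0 ≤ B := (abs_nonneg _).trans (hB (i, 0))
  set A := (1 + separationRate ε C / 2) * (1 / ε)
  refine ⟨B * Real.exp (L * A), by positivity, fun a => ?_⟩
  by_cases ha : a.2 ∈ wedge
  · have hclock : 1 ≤ Real.exp (L * A) * Real.exp (L * clock (separationRate ε C / 2) l i a.2) := by
      rw [← Real.exp_add, ← mul_add, Real.one_le_exp_iff]
      exact mul_nonneg hL.le (neg_le_iff_add_nonneg'.1 (neg_le_of_abs_le (H.abs_clock_le ha)))
    calc |g a| ≤ B := hB a
      _ ≤ B * (Real.exp (L * A) * Real.exp (L * clock (separationRate ε C / 2) l i a.2)) :=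
        le_mul_of_one_le_right hB₀ hclock
      _ ≤ B * Real.exp (L * A) * rowWeight (separationRate ε C / 2) L R σ l i a := by
        rw [← mul_assoc]
        exact mul_le_mul_of_nonneg_left (exp_le_rowWeight hR ha) (by positivity)
  · rw [hg₀ a.1 a.2 ha, abs_zero]
    exact mul_nonneg (by positivity) (rowWeight_nonneg hR a)

end RowSpeeds

variable [Fintype ι]

/-- The source term of the `j`-th entry along `charPath l i j P`. -/
noncomputable def rowSource (l : ι → ℝ → ℝ → ℝ) (i : ι) (F : RowData ι)
    (u : ι × (ℝ × ℝ × ℝ) → ℝ) (j : ι) (P : ℝ × ℝ × ℝ) (s : ℝ) : ℝ :=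
  ∑ k, u (k, charPath l i j P s) * F.coupling k j s (flow (l j) P.1 P.2.2 s)

/-- The value at `P` of the `j`-th entry if it is transported from the face `ξ = 0`. -/
noncomputable def lowValue (l : ι → ℝ → ℝ → ℝ) (i : ι) (F : RowData ι)
    (u : ι × (ℝ × ℝ × ℝ) → ℝ) (j : ι) (P : ℝ × ℝ × ℝ) : ℝ :=
  F.face j (hitTime (l j) P.1 P.2.2) +
    ∑ k, u (k, exitPoint l i j P) * F.reflection k j (hitTime (l j) P.1 P.2.2) +
    ∫ s in P.1..hitTime (l j) P.1 P.2.2, rowSource l i F u j P s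

/-- The value at `P` of the `j`-th entry if it is transported from the diagonal `ξ = x`. -/
noncomputable def highValue (l : ι → ℝ → ℝ → ℝ) (i : ι) (F : RowData ι)
    (u : ι × (ℝ × ℝ × ℝ) → ℝ) (j : ι) (P : ℝ × ℝ × ℝ) : ℝ :=
  F.diagonal j (meetTime l i j P) (flow (l i) P.1 P.2.1 (meetTime l i j P)) +
    ∫ s in P.1..meetTime l i j P, rowSource l i F u j P s

open Classical in
/-- The integral operator whose fixed points are the solutions of the row `F`. -/
noncomputable def rowStep (ε : ℝ) (σ : ι → ℝ) (l : ι → ℝ → ℝ → ℝ) (i : ι) (F : RowData ι)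
    (u : ι × (ℝ × ℝ × ℝ) → ℝ) : ι × (ℝ × ℝ × ℝ) → ℝ := fun a =>
  if a.2 ∈ wedge then
    if 0 ≤ side ε σ l i a.1 a.2 then lowValue l i F u a.1 a.2 else highValue l i F u a.1 a.2
  else 0

section Step

variable {ε : ℝ} {σ : ι → ℝ} {l : ι → ℝ → ℝ → ℝ} {i : ι} {F : RowData ι}
  {u : ι × (ℝ × ℝ × ℝ) → ℝ} {j : ι} {P : ℝ × ℝ × ℝ}

theorem rowStep_of_notMem (hP : P ∉ wedge) : rowStep ε σ l i F u (j, P) = 0 := if_neg hP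

theorem rowStep_of_side_nonneg (hP : P ∈ wedge) (h : 0 ≤ side ε σ l i j P) :
    rowStep ε σ l i F u (j, P) = lowValue l i F u j P :=
  (if_pos hP).trans (if_pos h)

theorem rowStep_of_side_neg (hP : P ∈ wedge) (h : side ε σ l i j P < 0) :
    rowStep ε σ l i F u (j, P) = highValue l i F u j P :=
  (if_pos hP).trans (if_neg (not_le.2 h))

end Step

namespace RowSpeeds

variable {ε C N : ℝ} {i : ι} {σ : ι → ℝ} {l l' : ι → ℝ → ℝ → ℝ} (H : RowSpeeds ε C i σ l l')
  {F : RowData ι} (hF : F.Admissible N i σ) {u v : ι × (ℝ × ℝ × ℝ) → ℝ}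
include H hF

theorem measurable_source (hu : IsRow ε σ l i u) (j : ι) (P : ℝ × ℝ × ℝ) :
    Measurable (rowSource l i F u j P) := by
  have hY := ((H.speed j).isIntegralCurve_flow P.1 P.2.2).continuous
  have hpath : Continuous (charPath l i j P) :=
    (H.continuous_charPath j).comp (continuous_const.prodMk continuous_id)
  refine Finset.measurable_sum _ fun k _ => ?_
  refine ((H.measurable_row hu k).comp hpath.measurable).mul ?_
  exact ((hF.coupling_cont k j).comp (continuous_id.prodMk hY)).measurable

omit H in
theorem abs_source_le {B : ℝ} (hB : ∀ a, |u a| ≤ B) (j : ι) (P : ℝ × ℝ × ℝ) (s : ℝ) :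
    |rowSource l i F u j P s| ≤ Fintype.card ι * (B * N) := by
  refine abs_sum_le_card_mul fun k => ?_
  rw [abs_mul]
  exact mul_le_mul (hB _) (hF.coupling_bound _ _ _ _) (abs_nonneg _)
    ((abs_nonneg _).trans (hB (k, P)))

theorem intervalIntegrable_source (hu : IsRow ε σ l i u) (j : ι) (P : ℝ × ℝ × ℝ) (a b : ℝ) :
    IntervalIntegrable (rowSource l i F u j P) volume a b :=
  have ⟨_, hB⟩ := hu.bdd
  intervalIntegrable_of_bounded (H.measurable_source hF hu j P) (abs_source_le hF hB j P) a b

theorem continuousOn_integral_source (hu : IsRow ε σ l i u) (j : ι) {e : ℝ × ℝ × ℝ → ℝ}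
    (he : Continuous e) :
    ContinuousOn (fun P => ∫ s in P.1..e P, rowSource l i F u j P s) wedge := by
  intro P₀ _
  obtain ⟨B, hB⟩ := hu.bdd
  refine continuousWithinAt_integral (C := Fintype.card ι * (B * N)) (abs_source_le hF hB j)
    (H.measurable_source hF hu j) ?_ continuous_fst.continuousWithinAt he.continuousWithinAt
  have hrow : ∀ k, ∀ᵐ s, k ≠ j →
      ContinuousWithinAt (fun P => u (k, charPath l i j P s)) wedge P₀ := fun k =>
    eventually_imp_distrib_left.2 fun hkj => H.ae_continuousWithinAt_path hu hkj P₀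
  filter_upwards [ae_all_iff.2 hrow] with s hs
  refine tendsto_finsetSum _ fun k _ => ?_
  rcases eq_or_ne k j with rfl | hkj
  · simp only [hF.coupling_self, mul_zero]
    exact tendsto_const_nhds
  · have hm : Continuous fun P : ℝ × ℝ × ℝ => F.coupling k j s (flow (l j) P.1 P.2.2 s) :=
      (hF.coupling_cont k j).comp (continuous_const.prodMk ((H.speed j).continuous_flow.comp
        (by fun_prop : Continuous fun P : ℝ × ℝ × ℝ => (P.1, P.2.2, s))))
    exact (hs k hkj).mul hm.continuousWithinAt

theorem continuousOn_lowValue (hu : IsRow ε σ l i u) (j : ι) :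
    ContinuousOn (lowValue l i F u j) (wedge ∩ {P | 0 ≤ side ε σ l i j P}) := by
  have hτ := H.continuous_hitTime_snd j
  refine ContinuousOn.add (ContinuousOn.add ?_ ?_)
    ((H.continuousOn_integral_source hF hu j hτ).mono inter_subset_left)
  · exact ((hF.face_cont j).comp hτ).continuousOn
  · refine continuousOn_finsetSum _ fun k _ => ?_
    by_cases hk : σ k = 1
    · refine ContinuousOn.mul ?_ ((hF.reflection_cont k j).comp hτ).continuousOn
      exact (H.continuousOn_pos hu hk).comp (H.continuous_exitPoint j).continuousOn
        fun P hP => H.exitPoint_mem_wedge hP.1 hP.2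
    · simp only [hF.reflection_eq_zero k j _ hk, mul_zero]
      exact continuousOn_const

theorem continuousOn_highValue (hu : IsRow ε σ l i u) {j : ι} (hj : j ≠ i) :
    ContinuousOn (highValue l i F u j) wedge := by
  have hθ := H.continuous_meetTime hj
  refine ContinuousOn.add ?_ (H.continuousOn_integral_source hF hu j hθ)
  have hX : Continuous fun P : ℝ × ℝ × ℝ => flow (l i) P.1 P.2.1 (meetTime l i j P) :=
    (H.speed i).continuous_flow.comp
      (f := fun P : ℝ × ℝ × ℝ => (P.1, P.2.1, meetTime l i j P)) (by fun_prop)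
  exact ((hF.diagonal_cont j hj).comp (hθ.prodMk hX)).continuousOn

end RowSpeeds

namespace RowSpeeds

variable {ε C N : ℝ} {i : ι} {σ : ι → ℝ} {l l' : ι → ℝ → ℝ → ℝ} (H : RowSpeeds ε C i σ l l')
  {u v : ι × (ℝ × ℝ × ℝ) → ℝ} {L R K : ℝ} {F : RowData ι}
  (hF : F.Admissible N i σ)
include H hF

theorem abs_source_sub_le (hL : 0 < L) (hR : 1 ≤ R) (hK : 0 ≤ K)
    (huv : ∀ a, |u a - v a| ≤ K * rowWeight (separationRate ε C / 2) L R σ l i a) {j : ι}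
    {P : ℝ × ℝ × ℝ} {e s : ℝ} (he : IsExitTime ε l i j P e) (hs : s ∈ uIoc P.1 e) :
    |rowSource l i F u j P s - rowSource l i F v j P s| ≤
      Fintype.card ι * (K * R * Real.exp (L * clock (separationRate ε C / 2) l i P) * N) *
        Real.exp (-(L * (separationRate ε C / 2) * |s - P.1|)) := by
  set δ := separationRate ε C / 2
  have hclock : Real.exp (L * clock δ l i (charPath l i j P s)) ≤
      Real.exp (L * clock δ l i P) * Real.exp (-(L * δ * |s - P.1|)) := by
    rw [← Real.exp_add, Real.exp_le_exp]
    exact (mul_le_mul_of_nonneg_left (H.clock_path_le he hs) hL.le).trans_eq (by ring)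
  have hdiff : ∀ k, |u (k, charPath l i j P s) - v (k, charPath l i j P s)| ≤
      K * (R * (Real.exp (L * clock δ l i P) * Real.exp (-(L * δ * |s - P.1|)))) := fun k =>
    (huv _).trans (mul_le_mul_of_nonneg_left ((rowWeight_le_mul_exp hR _).trans
      (mul_le_mul_of_nonneg_left hclock (by linarith))) hK)
  simp only [rowSource, ← Finset.sum_sub_distrib, ← sub_mul]
  refine (abs_sum_le_card_mul fun k => ?_).trans_eq (mul_assoc _ _ _).symm
  rw [abs_mul]
  refine (mul_le_mul (hdiff k) (hF.coupling_bound _ _ _ _) (abs_nonneg _)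
    ((abs_nonneg _).trans (hdiff k))).trans_eq ?_
  ring

theorem abs_integral_source_sub_le (hu : IsRow ε σ l i u) (hv : IsRow ε σ l i v) (hL : 0 < L)
    (hR : 1 ≤ R) (hLR : 4 * (Fintype.card ι * N * R) ≤ L * (separationRate ε C / 2)) (hK : 0 ≤ K)
    (huv : ∀ a, |u a - v a| ≤ K * rowWeight (separationRate ε C / 2) L R σ l i a) {j : ι}
    {P : ℝ × ℝ × ℝ} {e : ℝ} (he : IsExitTime ε l i j P e) :
    |(∫ s in P.1..e, rowSource l i F u j P s) - ∫ s in P.1..e, rowSource l i F v j P s| ≤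
      K / 4 * Real.exp (L * clock (separationRate ε C / 2) l i P) := by
  have hN := hF.nonneg
  have hLδ : 0 < L * (separationRate ε C / 2) := mul_pos hL (half_pos H.base.separationRate_pos)
  rw [← intervalIntegral.integral_sub (H.intervalIntegrable_source hF hu j P _ _)
    (H.intervalIntegrable_source hF hv j P _ _)]
  refine (abs_integral_le_of_exp_decay hLδ (by positivity) fun s hs =>
    H.abs_source_sub_le hF hL hR hK huv he hs).trans ?_
  set E := Real.exp (L * clock (separationRate ε C / 2) l i P)
  rw [div_le_iff₀ hLδ]
  have hKE : 0 ≤ K / 4 * E := by positivity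
  linarith [mul_le_mul_of_nonneg_left hLR hKE]

theorem abs_reflection_sub_le (hL : 0 < L) (hK : 0 ≤ K)
    (huv : ∀ a, |u a - v a| ≤ K * rowWeight (separationRate ε C / 2) L R σ l i a) {j : ι}
    {P : ℝ × ℝ × ℝ} (hP : P ∈ wedge) (hside : 0 ≤ side ε σ l i j P) (t : ℝ) :
    |∑ k, u (k, exitPoint l i j P) * F.reflection k j t -
        ∑ k, v (k, exitPoint l i j P) * F.reflection k j t| ≤
      Fintype.card ι * (K * Real.exp (L * clock (separationRate ε C / 2) l i P) * N) := by
  have hN := hF.nonneg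
  simp only [← Finset.sum_sub_distrib, ← sub_mul]
  refine abs_sum_le_card_mul fun k => ?_
  rw [abs_mul]
  by_cases hk : σ k = 1
  · refine mul_le_mul ((huv _).trans (mul_le_mul_of_nonneg_left ?_ hK)) (hF.reflection_bound _ _ _)
      (abs_nonneg _) (by positivity)
    simp only [rowWeight, if_pos (H.exitPoint_mem_wedge hP hside), if_pos hk, one_mul]
    exact Real.exp_le_exp.2 (mul_le_mul_of_nonneg_left (H.clock_exitPoint_le hP hside) hL.le)
  · rw [hF.reflection_eq_zero k j _ hk, abs_zero, mul_zero]
    positivity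

theorem abs_lowValue_sub_le (hu : IsRow ε σ l i u) (hv : IsRow ε σ l i v) (hL : 0 < L)
    (hR : 4 * (Fintype.card ι * N) + 1 ≤ R)
    (hLR : 4 * (Fintype.card ι * N * R) ≤ L * (separationRate ε C / 2)) (hK : 0 ≤ K)
    (huv : ∀ a, |u a - v a| ≤ K * rowWeight (separationRate ε C / 2) L R σ l i a) {j : ι}
    {P : ℝ × ℝ × ℝ} (hP : P ∈ wedge) (hside : 0 ≤ side ε σ l i j P) :
    |lowValue l i F u j P - lowValue l i F v j P| ≤
      K / 2 * rowWeight (separationRate ε C / 2) L R σ l i (j, P) := by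
  have hN := hF.nonneg
  have hnN : 0 ≤ Fintype.card ι * N := by positivity
  have hσ : σ j ≠ 1 := by rw [H.sign_of_side_nonneg hside]; norm_num
  have hint := H.abs_integral_source_sub_le hF hu hv hL (by linarith) hLR hK huv
    (H.isExitTime_hitTime hP hside)
  have hrefl := H.abs_reflection_sub_le hF hL hK huv hP hside (hitTime (l j) P.1 P.2.2)
  unfold lowValue
  rw [add_sub_add_comm, add_sub_add_left_eq_sub]
  refine (abs_add_le _ _).trans ((add_le_add hrefl hint).trans ?_)
  simp only [rowWeight, if_pos hP, if_neg hσ]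
  set E := Real.exp (L * clock (separationRate ε C / 2) l i P)
  have hKE : 0 ≤ K * E := by positivity
  nlinarith [mul_le_mul_of_nonneg_left hR hKE]

theorem abs_highValue_sub_le (hu : IsRow ε σ l i u) (hv : IsRow ε σ l i v) (hL : 0 < L)
    (hR : 1 ≤ R) (hLR : 4 * (Fintype.card ι * N * R) ≤ L * (separationRate ε C / 2)) (hK : 0 ≤ K)
    (huv : ∀ a, |u a - v a| ≤ K * rowWeight (separationRate ε C / 2) L R σ l i a) {j : ι}
    (hj : j ≠ i) {P : ℝ × ℝ × ℝ} (hP : P ∈ wedge) :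
    |highValue l i F u j P - highValue l i F v j P| ≤
      K / 2 * rowWeight (separationRate ε C / 2) L R σ l i (j, P) := by
  have hint := H.abs_integral_source_sub_le hF hu hv hL hR hLR hK huv (H.isExitTime_meetTime hj hP)
  have hW : Real.exp (L * clock (separationRate ε C / 2) l i P) ≤
      rowWeight (separationRate ε C / 2) L R σ l i (j, P) := exp_le_rowWeight (a := (j, P)) hR hP
  unfold highValue
  rw [add_sub_add_left_eq_sub]
  exact hint.trans (mul_le_mul (by linarith) hW (Real.exp_pos _).le (by linarith))

theorem abs_rowStep_sub_le (hu : IsRow ε σ l i u) (hv : IsRow ε σ l i v) (hL : 0 < L)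
    (hR : 4 * (Fintype.card ι * N) + 1 ≤ R)
    (hLR : 4 * (Fintype.card ι * N * R) ≤ L * (separationRate ε C / 2)) (hK : 0 ≤ K)
    (huv : ∀ a, |u a - v a| ≤ K * rowWeight (separationRate ε C / 2) L R σ l i a)
    (a : ι × (ℝ × ℝ × ℝ)) : |rowStep ε σ l i F u a - rowStep ε σ l i F v a| ≤
      K / 2 * rowWeight (separationRate ε C / 2) L R σ l i a := by
  obtain ⟨j, P⟩ := a
  have hN := hF.nonneg
  have hnN : 0 ≤ Fintype.card ι * N := by positivity
  by_cases hP : P ∈ wedge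
  · rcases le_or_gt 0 (side ε σ l i j P) with hside | hside
    · rw [rowStep_of_side_nonneg hP hside, rowStep_of_side_nonneg hP hside]
      exact H.abs_lowValue_sub_le hF hu hv hL hR hLR hK huv hP hside
    · rw [rowStep_of_side_neg hP hside, rowStep_of_side_neg hP hside]
      exact H.abs_highValue_sub_le hF hu hv hL (by linarith) hLR hK huv (H.ne_of_side_neg hside) hP
  · simp [rowStep, rowWeight, hP]

theorem abs_rowStep_zero_le (a : ι × (ℝ × ℝ × ℝ)) :
    |rowStep ε σ l i F (fun _ => 0) a| ≤ N := by
  obtain ⟨j, P⟩ := a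
  by_cases hP : P ∈ wedge
  · rcases le_or_gt 0 (side ε σ l i j P) with hside | hside
    · simpa [rowStep_of_side_nonneg hP hside, lowValue, rowSource] using hF.face_bound _ _
    · simpa [rowStep_of_side_neg hP hside, highValue, rowSource] using
        hF.diagonal_bound _ (H.ne_of_side_neg hside) _ _
  · simpa [rowStep_of_notMem hP] using hF.nonneg

theorem exists_contracting_weight : ∃ W : ι × (ℝ × ℝ × ℝ) → ℝ, (∃ B, ∀ a, W a ≤ B) ∧
    (∀ g : ι × (ℝ × ℝ × ℝ) → ℝ, (∃ B, ∀ a, |g a| ≤ B) → (∀ j, ∀ P ∉ wedge, g (j, P) = 0) →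
      ∃ K, 0 ≤ K ∧ ∀ a, |g a| ≤ K * W a) ∧
    ∀ u, IsRow ε σ l i u → ∀ v, IsRow ε σ l i v → ∀ K, 0 ≤ K →
      (∀ a, |u a - v a| ≤ K * W a) →
      ∀ a, |rowStep ε σ l i F u a - rowStep ε σ l i F v a| ≤ K / 2 * W a := by
  have hN := hF.nonneg
  have hδ := H.base.separationRate_pos
  set R := 4 * (Fintype.card ι * N) + 1
  have hR : 1 ≤ R := le_add_of_nonneg_left (by positivity)
  set L := (4 * (Fintype.card ι * N * R) + 1) / (separationRate ε C / 2) with hLdef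
  have hL : 0 < L := by positivity
  have hLR : 4 * (Fintype.card ι * N * R) ≤ L * (separationRate ε C / 2) := by
    rw [hLdef, div_mul_cancel₀ _ (half_pos hδ).ne']
    exact le_add_of_nonneg_right zero_le_one
  exact ⟨rowWeight (separationRate ε C / 2) L R σ l i, H.exists_rowWeight_le hL hR,
    fun g => H.exists_abs_le_mul_rowWeight hL hR,
    fun u hu v hv K hK huv => H.abs_rowStep_sub_le hF hu hv hL le_rfl hLR hK huv⟩

theorem isRow_rowStep (hu : IsRow ε σ l i u) : IsRow ε σ l i (rowStep ε σ l i F u) where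
  zero j P hP := rowStep_of_notMem hP
  bdd := by
    obtain ⟨W, ⟨B, hB⟩, hW, hcontr⟩ := H.exists_contracting_weight hF
    obtain ⟨K, hK, huK⟩ := hW u hu.bdd hu.zero
    refine ⟨K / 2 * B + N, fun a => ?_⟩
    have hsub := hcontr u hu _ isRow_zero K hK (fun a => by simpa using huK a) a
    have hle := mul_le_mul_of_nonneg_left (hB a) (by linarith : 0 ≤ K / 2)
    linarith [abs_sub_abs_le_abs_sub (rowStep ε σ l i F u a) (rowStep ε σ l i F (fun _ => 0) a),
      H.abs_rowStep_zero_le hF a]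
  low j := (H.continuousOn_lowValue hF hu j).congr fun _ hP => rowStep_of_side_nonneg hP.1 hP.2
  high j := by
    rcases eq_or_ne j i with rfl | hj
    · exact fun P hP => absurd rfl (H.ne_of_side_neg hP.2)
    · exact ((H.continuousOn_highValue hF hu hj).mono inter_subset_left).congr
        fun _ hP => rowStep_of_side_neg hP.1 hP.2

theorem exists_row : ∃ u, IsRow ε σ l i u ∧ rowStep ε σ l i F u = u := by
  obtain ⟨W, ⟨B, hB⟩, hW, hcontr⟩ := H.exists_contracting_weight hF
  obtain ⟨K, hK, h0K⟩ := hW (rowStep ε σ l i F fun _ => 0) ⟨N, H.abs_rowStep_zero_le hF⟩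
    fun j P => rowStep_of_notMem
  exact exists_fixedPoint_of_weight (S := {u | IsRow ε σ l i u})
    (fun _ _ hw hv => isRow_of_tendstoUniformly hw hv) (fun u hu => H.isRow_rowStep hF hu) hB
    hcontr isRow_zero hK fun a => by simpa [Real.dist_eq] using h0K a

end RowSpeeds

end Row

/-! ### Properties of the solution of a row -/

section Row

variable {ι : Type*}

theorem IsRow.continuousOn_of_not_split {ε : ℝ} {i j : ι} {σ : ι → ℝ} {l : ι → ℝ → ℝ → ℝ}
    {u : ι × (ℝ × ℝ × ℝ) → ℝ} (hu : IsRow ε σ l i u) (hj : ¬ (IsAbove ε l i j ∧ σ j = -1)) :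
    ContinuousOn (fun P => u (j, P)) wedge := by
  by_cases hji : j = i
  · exact (hu.low j).mono fun P hP => ⟨hP, by simp [side, hji]⟩
  · exact (hu.high j).mono fun P hP => ⟨hP, by simp [side, hji, hj]⟩

variable [Fintype ι]

namespace RowSpeeds

variable {ε C N : ℝ} {i : ι} {σ : ι → ℝ} {l l' : ι → ℝ → ℝ → ℝ} (H : RowSpeeds ε C i σ l l')
  {F : RowData ι} (hF : F.Admissible N i σ) {u : ι × (ℝ × ℝ × ℝ) → ℝ}
  (hfix : rowStep ε σ l i F u = u)

include hfix in
theorem row_eq_lowValue {j : ι} {P : ℝ × ℝ × ℝ} (hP : P ∈ wedge) (hs : 0 ≤ side ε σ l i j P) :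
    u (j, P) = lowValue l i F u j P :=
  (congrFun hfix _).symm.trans (rowStep_of_side_nonneg hP hs)

include hfix in
theorem row_eq_highValue {j : ι} {P : ℝ × ℝ × ℝ} (hP : P ∈ wedge)
    (hs : side ε σ l i j P < 0) : u (j, P) = highValue l i F u j P :=
  (congrFun hfix _).symm.trans (rowStep_of_side_neg hP hs)

include H

theorem rowSource_charPath (j : ι) (P : ℝ × ℝ × ℝ) (s : ℝ) :
    rowSource l i F u j (charPath l i j P s) = rowSource l i F u j P := by
  funext t
  unfold rowSource
  rw [H.charPath_charPath, H.flow_charPath_snd]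

omit [Fintype ι] in
theorem exitPoint_charPath (j : ι) (P : ℝ × ℝ × ℝ) (s : ℝ) :
    exitPoint l i j (charPath l i j P s) = exitPoint l i j P := by
  unfold exitPoint
  rw [H.charPath_charPath, H.hitTime_charPath_snd]

/-- Whether a value is transported from the face or from the diagonal does not change along a
path, and neither does the point it is transported from. -/
theorem exists_row_eq_add_integral (hfix : rowStep ε σ l i F u = u) (j : ι) (P : ℝ × ℝ × ℝ) :
    ∃ A e, ∀ s, charPath l i j P s ∈ wedge →
      u (j, charPath l i j P s) = A + ∫ t in s..e, rowSource l i F u j P t := by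
  rcases le_or_gt 0 (side ε σ l i j P) with hs | hs
  · refine ⟨F.face j (hitTime (l j) P.1 P.2.2) + ∑ k, u (k, exitPoint l i j P) *
      F.reflection k j (hitTime (l j) P.1 P.2.2), hitTime (l j) P.1 P.2.2, fun s hmem => ?_⟩
    rw [row_eq_lowValue hfix hmem (by rwa [H.side_charPath]), lowValue, H.hitTime_charPath_snd,
      H.exitPoint_charPath, H.rowSource_charPath]
    rfl
  · refine ⟨F.diagonal j (meetTime l i j P) (flow (l i) P.1 P.2.1 (meetTime l i j P)),
      meetTime l i j P, fun s hmem => ?_⟩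
    rw [row_eq_highValue hfix hmem (by rwa [H.side_charPath]), highValue, H.meetTime_charPath,
      H.flow_charPath_fst, H.rowSource_charPath]
    rfl

include hF in
theorem row_along (hfix : rowStep ε σ l i F u = u) (hu : IsRow ε σ l i u) {j : ι}
    {P : ℝ × ℝ × ℝ} {s₁ s₂ : ℝ} (h₁ : charPath l i j P s₁ ∈ wedge)
    (h₂ : charPath l i j P s₂ ∈ wedge) :
    u (j, charPath l i j P s₂) =
      u (j, charPath l i j P s₁) - ∫ s in s₁..s₂, rowSource l i F u j P s := by
  obtain ⟨A, e, hval⟩ := H.exists_row_eq_add_integral hfix j P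
  have hi := H.intervalIntegrable_source hF hu j P
  rw [hval s₁ h₁, hval s₂ h₂,
    ← intervalIntegral.integral_add_adjacent_intervals (hi s₁ s₂) (hi s₂ e)]
  ring

include hfix

theorem row_diag {j : ι} (hj : j ≠ i) {t x : ℝ} (hx : x ∈ Icc (0 : ℝ) 1)
    (hs : side ε σ l i j (t, x, x) < 0) : u (j, (t, x, x)) = F.diagonal j t x := by
  rw [row_eq_highValue hfix (P := (t, x, x)) ⟨hx.1, le_rfl, hx.2⟩ hs, highValue,
    H.meetTime_diag hj]
  simp [(H.speed i).flow_self]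

theorem row_face {j : ι} (hj : j = i ∨ (IsAbove ε l i j ∧ σ j = -1)) {t x : ℝ}
    (hx : x ∈ Icc (0 : ℝ) 1) :
    u (j, (t, x, 0)) = F.face j t + ∑ k, u (k, (t, x, 0)) * F.reflection k j t := by
  have hs : 0 ≤ side ε σ l i j (t, x, 0) := by
    rcases hj with rfl | hj
    · simp [side]
    · rw [H.side_of_split hj.1 hj.2]
      simp only [(H.speed j).hitTime_zero]
      linarith [H.base.le_hitTime (t := t) hx.1]
  rw [row_eq_lowValue hfix (P := (t, x, 0)) ⟨le_rfl, hx.1, hx.2⟩ hs, lowValue]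
  simp [H.exitPoint_eq, (H.speed j).hitTime_zero, (H.speed i).flow_self]

include hF

theorem row_eq_highValue_of_compatible {j : ι} (hj : IsAbove ε l i j) (hσ : σ j = -1)
    (hcompat : ∀ t, F.face j t + ∑ k, F.diagonal k t 0 * F.reflection k j t = F.diagonal j t 0)
    {P : ℝ × ℝ × ℝ} (hP : P ∈ wedge) (hs : side ε σ l i j P = 0) :
    u (j, P) = highValue l i F u j P := by
  have hτ : hitTime (l j) P.1 P.2.2 = hitTime (l i) P.1 P.2.1 := by
    rw [H.side_of_split hj hσ] at hs
    linarith
  have hX : flow (l i) P.1 P.2.1 (hitTime (l j) P.1 P.2.2) = 0 := by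
    rw [hτ, (H.speed i).flow_hitTime]
  have hθ : hitTime (l j) P.1 P.2.2 = meetTime l i j P :=
    H.eq_meetTime (H.ne_of_isAbove hj).symm (by rw [hX, (H.speed j).flow_hitTime])
  rw [row_eq_lowValue hfix hP hs.ge, lowValue, highValue, ← hθ, hX, ← hcompat, H.exitPoint_eq, hX]
  congr 2
  refine Finset.sum_congr rfl fun k _ => ?_
  by_cases hk : σ k = 1
  · rw [H.row_diag hfix (H.ne_of_isAbove (H.isAbove_of_pos hk)).symm ⟨le_rfl, zero_le_one⟩]
    rw [H.side_of_pos hk]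
    norm_num
  · rw [hF.reflection_eq_zero k j _ hk, mul_zero, mul_zero]

theorem continuousOn_of_compatible {j : ι} (hu : IsRow ε σ l i u) (hj : IsAbove ε l i j)
    (hσ : σ j = -1)
    (hcompat : ∀ t, F.face j t + ∑ k, F.diagonal k t 0 * F.reflection k j t = F.diagonal j t 0) :
    ContinuousOn (fun P => u (j, P)) wedge := by
  have hside := H.continuous_side j
  have hnonpos : ContinuousOn (fun P => u (j, P)) (wedge ∩ {P | side ε σ l i j P ≤ 0}) := by
    refine ((H.continuousOn_highValue hF hu (H.ne_of_isAbove hj).symm).mono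
      inter_subset_left).congr fun P hP => ?_
    rcases lt_or_eq_of_le (show side ε σ l i j P ≤ 0 from hP.2) with hlt | heq
    · exact row_eq_highValue hfix hP.1 hlt
    · exact H.row_eq_highValue_of_compatible hF hfix hj hσ hcompat hP.1 heq
  refine (hnonpos.union_of_isClosed (hu.low j)
    (isClosed_wedge.inter (isClosed_le hside continuous_const))
    (isClosed_wedge.inter (isClosed_le continuous_const hside))).mono fun P hP => ?_
  exact (le_total (side ε σ l i j P) 0).imp (⟨hP, ·⟩) (⟨hP, ·⟩)

end RowSpeeds

/-! ### The zeroth-order diagonal terms -/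

/-- The zeroth-order term of the equation for the `j`-th entry of the row `k`; here `l'` stands for
the space derivatives of the speeds. -/
noncomputable def zerothOrder (l' : ι → ℝ → ℝ → ℝ) (F : RowData ι) (k : ι → ℝ × ℝ × ℝ → ℝ)
    (j : ι) (P : ℝ × ℝ × ℝ) : ℝ :=
  k j P * l' j P.1 P.2.2 + ∑ q, k q P * F.coupling q j P.1 P.2.2

/-- The part of the kernel equations that concerns the row `i`: `k` is a bounded solution along the
characteristics, with the values `F.diagonal` on `ξ = x`. -/
structure IsBroadRow (i : ι) (l l' : ι → ℝ → ℝ → ℝ) (F : RowData ι) (k : ι → ℝ × ℝ × ℝ → ℝ) :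
    Prop where
  bdd : ∃ B, ∀ j P, |k j P| ≤ B
  along : ∀ (j : ι) (s₁ s₂ : ℝ) (X Y : ℝ → ℝ), s₁ ≤ s₂ → IsIntegralCurve X (l i) →
    IsIntegralCurve Y (l j) → (∀ s ∈ Icc s₁ s₂, (s, X s, Y s) ∈ wedge) →
    IntervalIntegrable (fun s => zerothOrder l' F k j (s, X s, Y s)) volume s₁ s₂ ∧
    k j (s₂, X s₂, Y s₂) =
      k j (s₁, X s₁, Y s₁) - ∫ s in s₁..s₂, zerothOrder l' F k j (s, X s, Y s)
  diag : ∀ j, j ≠ i → ∀ t, ∀ x ∈ Ioc (0 : ℝ) 1, k j (t, x, x) = F.diagonal j t x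

/-- A row of the kernel together with its regularity and its boundary condition on `ξ = 0`. The
entries `j` with `IsAbove ε l i j` and `σ j = -1` may jump across the surface where the two hitting
times agree, unless the boundary values are compatible. -/
structure IsKernelRow (ε : ℝ) (i : ι) (σ : ι → ℝ) (l l' : ι → ℝ → ℝ → ℝ) (F : RowData ι)
    (k : ι → ℝ × ℝ × ℝ → ℝ) : Prop extends IsBroadRow i l l' F k where
  cont : ∀ j, ¬ (IsAbove ε l i j ∧ σ j = -1) → ContinuousOn (k j) wedge
  low : ∀ j, IsAbove ε l i j → σ j = -1 → ContinuousOn (k j)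
    (wedge ∩ {P | hitTime (l j) P.1 P.2.2 ≤ hitTime (l i) P.1 P.2.1})
  high : ∀ j, IsAbove ε l i j → σ j = -1 → ∃ g, ContinuousOn g wedge ∧ ∀ P ∈ wedge,
    hitTime (l i) P.1 P.2.1 < hitTime (l j) P.1 P.2.2 → k j P = g P
  compat : ∀ j, IsAbove ε l i j → σ j = -1 →
    (∀ t, F.face j t + ∑ q, F.diagonal q t 0 * F.reflection q j t = F.diagonal j t 0) →
    ContinuousOn (k j) wedge
  face : ∀ j, j = i ∨ (IsAbove ε l i j ∧ σ j = -1) → ∀ t, ∀ x ∈ Icc (0 : ℝ) 1,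
    k j (t, x, 0) = F.face j t + ∑ q, k q (t, x, 0) * F.reflection q j t

/-- The data satisfied by the quotients of the entries of a row by factors `g` that equal `1` on
`ξ = 0`. -/
noncomputable def RowData.rescale (g : ι → ℝ → ℝ → ℝ) (F : RowData ι) : RowData ι where
  coupling q j t x := F.coupling q j t x * (g q t x / g j t x)
  diagonal j t x := F.diagonal j t x / g j t x
  face := F.face
  reflection := F.reflection

omit [Fintype ι] in
theorem RowData.Admissible.rescale {F : RowData ι} {N a : ℝ} {i : ι} {σ : ι → ℝ}
    (hF : F.Admissible N i σ) {g : ι → ℝ → ℝ → ℝ}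
    (hg : ∀ j, Continuous fun q : ℝ × ℝ => g j q.1 q.2) (hg₀ : ∀ j t x, 0 < g j t x)
    (hle : ∀ j t x, g j t x ≤ a) (hge : ∀ j t x, a⁻¹ ≤ g j t x) :
    (F.rescale g).Admissible (N * (a * a)) i σ := by
  have hN := hF.nonneg
  have ha₀ : 0 < a := (hg₀ i 0 0).trans_le (hle i 0 0)
  have ha : 1 ≤ a := by
    by_contra! h
    exact ((one_lt_inv₀ ha₀).2 h).not_ge (((hge i 0 0).trans (hle i 0 0)).trans h.le)
  have haa : a ≤ a * a := le_mul_of_one_le_left ha₀.le ha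
  have hNa : N ≤ N * (a * a) := le_mul_of_one_le_right hN (ha.trans haa)
  have hinv : ∀ j t x, (g j t x)⁻¹ ≤ a := fun j t x => inv_le_of_inv_le₀ ha₀ (hge j t x)
  have hne : ∀ j (q : ℝ × ℝ), g j q.1 q.2 ≠ 0 := fun j q => (hg₀ j _ _).ne'
  refine ⟨fun k j => (hF.coupling_cont k j).mul ((hg k).div (hg j) (hne j)), fun k j t x => ?_,
    fun j t x => by simp [RowData.rescale, hF.coupling_self],
    fun j hj => (hF.diagonal_cont j hj).div (hg j) (hne j), fun j hj t x => ?_, hF.face_cont,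
    fun j t => (hF.face_bound j t).trans hNa, hF.reflection_cont,
    fun k j t => (hF.reflection_bound k j t).trans hNa, hF.reflection_eq_zero⟩
  · rw [RowData.rescale, abs_mul, abs_of_pos (div_pos (hg₀ k t x) (hg₀ j t x)), div_eq_mul_inv]
    exact mul_le_mul (hF.coupling_bound _ _ _ _)
      (mul_le_mul (hle k t x) (hinv j t x) (inv_pos.2 (hg₀ j t x)).le ha₀.le)
      (mul_pos (hg₀ k t x) (inv_pos.2 (hg₀ j t x))).le hN
  · rw [RowData.rescale, abs_div, abs_of_pos (hg₀ j t x), div_eq_mul_inv]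
    exact mul_le_mul (hF.diagonal_bound j hj t x) ((hinv j t x).trans haa)
      (inv_pos.2 (hg₀ j t x)).le hN

theorem SignedSpeed.amplitude_zero {ε C σ : ℝ} {l l' : ℝ → ℝ → ℝ} (hl : SignedSpeed ε C σ l l')
    (t : ℝ) : amplitude l l' t 0 = 1 := by
  simp [amplitude, hl.hitTime_zero]

/-- The row whose quotients by the amplitudes are the entries of `u`. -/
noncomputable def amplifiedRow (l l' : ι → ℝ → ℝ → ℝ) (u : ι × (ℝ × ℝ × ℝ) → ℝ) (j : ι)
    (P : ℝ × ℝ × ℝ) : ℝ :=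
  amplitude (l j) (l' j) P.1 P.2.2 * u (j, P)

namespace RowSpeeds

variable {ε C N N' : ℝ} {i : ι} {σ : ι → ℝ} {l l' : ι → ℝ → ℝ → ℝ} (H : RowSpeeds ε C i σ l l')
  {F : RowData ι} {u : ι × (ℝ × ℝ × ℝ) → ℝ}
include H

omit [Fintype ι] in
theorem continuous_amplitude_snd (j : ι) :
    Continuous fun P : ℝ × ℝ × ℝ => amplitude (l j) (l' j) P.1 P.2.2 :=
  (H.speed j).continuous_amplitude.comp
    (by fun_prop : Continuous fun P : ℝ × ℝ × ℝ => (P.1, P.2.2))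

omit [Fintype ι] in
theorem continuousOn_amplifiedRow {j : ι} {S : Set (ℝ × ℝ × ℝ)}
    (hu : ContinuousOn (fun P => u (j, P)) S) : ContinuousOn (amplifiedRow l l' u j) S :=
  (H.continuous_amplitude_snd j).continuousOn.mul hu

omit [Fintype ι] in
theorem measurable_amplifiedRow (hu : IsRow ε σ l i u) (j : ι) :
    Measurable (amplifiedRow l l' u j) :=
  (H.continuous_amplitude_snd j).measurable.mul (H.measurable_row hu j)

omit [Fintype ι] in
theorem exists_abs_amplifiedRow_le (hu : IsRow ε σ l i u) :
    ∃ B, ∀ j P, |amplifiedRow l l' u j P| ≤ B := by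
  obtain ⟨B, hB⟩ := hu.bdd
  refine ⟨Real.exp (2 * C / ε) * B, fun j P => ?_⟩
  rw [amplifiedRow, abs_mul, abs_of_pos (amplitude_pos _ _ _ _)]
  exact mul_le_mul ((H.speed j).amplitude_le _ _) (hB _) (abs_nonneg _) (Real.exp_pos _).le

theorem intervalIntegrable_zerothOrder (hF : F.Admissible N i σ) {k : ι → ℝ × ℝ × ℝ → ℝ}
    (hk : ∀ j, Measurable (k j)) {B : ℝ} (hB : ∀ j P, |k j P| ≤ B) (j : ι) {X Y : ℝ → ℝ}
    (hX : Continuous X) (hY : Continuous Y) (s₁ s₂ : ℝ) :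
    IntervalIntegrable (fun s => zerothOrder l' F k j (s, X s, Y s)) volume s₁ s₂ := by
  have hB₀ : 0 ≤ B := (abs_nonneg _).trans (hB j 0)
  have hkm : ∀ q, Measurable fun s => k q (s, X s, Y s) := fun q =>
    (hk q).comp (by fun_prop : Continuous fun s => (s, X s, Y s)).measurable
  refine IntervalIntegrable.add (f := fun s => k j (s, X s, Y s) * l' j s (Y s))
    (intervalIntegrable_of_bounded (C := B * C)
      ((hkm j).mul ((H.speed j).measurable_deriv_curve hY)) (fun s => ?_) _ _)
    (intervalIntegrable_of_bounded (C := Fintype.card ι * (B * N))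
      (Finset.measurable_sum _ fun q _ => (hkm q).mul
        ((hF.coupling_cont q j).comp (continuous_id.prodMk hY)).measurable)
      (fun s => abs_sum_le_card_mul fun q => ?_) _ _)
  · rw [Pi.mul_apply, abs_mul]
    exact mul_le_mul (hB _ _) ((H.speed j).abs_deriv_le _ _) (abs_nonneg _) hB₀
  · rw [Pi.mul_apply, abs_mul]
    exact mul_le_mul (hB _ _) (hF.coupling_bound _ _ _ _) (abs_nonneg _) hB₀

theorem amplifiedRow_along
    (hF' : (F.rescale fun j => amplitude (l j) (l' j)).Admissible N' i σ) (hu : IsRow ε σ l i u)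
    (hfix : rowStep ε σ l i (F.rescale fun j => amplitude (l j) (l' j)) u = u) {j : ι}
    {s₁ s₂ : ℝ} (hs : s₁ ≤ s₂) {X Y : ℝ → ℝ} (hX : IsIntegralCurve X (l i))
    (hY : IsIntegralCurve Y (l j)) (hmem : ∀ s ∈ Icc s₁ s₂, (s, X s, Y s) ∈ wedge) :
    amplifiedRow l l' u j (s₂, X s₂, Y s₂) = amplifiedRow l l' u j (s₁, X s₁, Y s₁) -
      ∫ s in s₁..s₂, zerothOrder l' F (amplifiedRow l l' u) j (s, X s, Y s) := by
  set F' := F.rescale fun j => amplitude (l j) (l' j)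
  set P : ℝ × ℝ × ℝ := (s₁, X s₁, Y s₁)
  have hYflow : flow (l j) P.1 P.2.2 = Y := (H.speed j).flow_curve hY s₁
  have hpath : ∀ s, charPath l i j P s = (s, X s, Y s) := fun s => by
    rw [charPath, hYflow, (H.speed i).flow_curve hX s₁]
  have hprod := mul_sub_mul_eq_integral hs (v := fun s => u (j, (s, X s, Y s)))
    ((H.speed j).lipschitzWith_amplitude_curve hY)
    (by filter_upwards [(H.speed j).ae_curve_ne hY 0, (H.speed j).ae_curve_ne hY 1] with s h0 h1 _
        exact (H.speed j).hasDerivAt_amplitude_curve hY h0 h1)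
    (H.intervalIntegrable_source hF' hu j P _ _)
    (fun s hs' => by
      have := H.row_along hF' hfix hu (P := P) (j := j) (s₁ := s₁) (s₂ := s)
        (by rw [hpath]; exact hmem _ ⟨le_rfl, hs⟩) (by rw [hpath]; exact hmem s hs')
      rwa [hpath, hpath] at this)
  have hintegrand : ∀ s, -l' j s (Y s) * amplitude (l j) (l' j) s (Y s) * u (j, (s, X s, Y s)) -
      amplitude (l j) (l' j) s (Y s) * rowSource l i F' u j P s =
        -zerothOrder l' F (amplifiedRow l l' u) j (s, X s, Y s) := fun s => by
    have hne := (amplitude_pos (l j) (l' j) s (Y s)).ne'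
    have hsum : amplitude (l j) (l' j) s (Y s) * rowSource l i F' u j P s =
        ∑ q, amplifiedRow l l' u q (s, X s, Y s) * F.coupling q j s (Y s) := by
      rw [rowSource, Finset.mul_sum]
      refine Finset.sum_congr rfl fun q _ => ?_
      simp only [hpath, hYflow, F', RowData.rescale, amplifiedRow]
      field_simp
    rw [hsum, zerothOrder, amplifiedRow]
    ring
  simp only [hintegrand, intervalIntegral.integral_neg] at hprod
  unfold amplifiedRow at hprod ⊢
  linarith

theorem isBroadRow_amplifiedRow (hF : F.Admissible N i σ)
    (hF' : (F.rescale fun j => amplitude (l j) (l' j)).Admissible N' i σ) (hu : IsRow ε σ l i u)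
    (hfix : rowStep ε σ l i (F.rescale fun j => amplitude (l j) (l' j)) u = u) :
    IsBroadRow i l l' F (amplifiedRow l l' u) := by
  obtain ⟨B, hB⟩ := H.exists_abs_amplifiedRow_le hu
  refine ⟨⟨B, hB⟩, fun j s₁ s₂ X Y hs hX hY hmem => ⟨?_, ?_⟩, fun j hj t x hx => ?_⟩
  · exact H.intervalIntegrable_zerothOrder hF (H.measurable_amplifiedRow hu) hB j
      hX.continuous hY.continuous s₁ s₂
  · exact H.amplifiedRow_along hF' hu hfix hs hX hY hmem
  · rw [amplifiedRow, H.row_diag hfix hj ⟨hx.1.le, hx.2⟩ (H.side_diag_neg hj hx.1)]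
    exact mul_div_cancel₀ _ (amplitude_pos _ _ _ _).ne'

theorem exists_isKernelRow (hF : F.Admissible N i σ) : ∃ k, IsKernelRow ε i σ l l' F k := by
  have hF' := hF.rescale (fun j => (H.speed j).continuous_amplitude)
    (fun j => amplitude_pos (l j) (l' j)) (fun j => (H.speed j).amplitude_le)
    fun j t x => (Real.exp_neg _).symm.trans_le ((H.speed j).le_amplitude t x)
  obtain ⟨u, hu, hfix⟩ := H.exists_row hF'
  refine ⟨amplifiedRow l l' u, H.isBroadRow_amplifiedRow hF hF' hu hfix, fun j hj => ?_,
    fun j hj hσ => ?_, fun j hj hσ => ?_, fun j hj hσ hcompat => ?_, fun j hj t x hx => ?_⟩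
  · exact H.continuousOn_amplifiedRow (hu.continuousOn_of_not_split hj)
  · refine H.continuousOn_amplifiedRow ((hu.low j).mono fun P hP => ⟨hP.1, ?_⟩)
    rw [mem_ofPred_eq, H.side_of_split hj hσ]
    exact sub_nonneg.2 hP.2
  · refine ⟨_, H.continuousOn_amplifiedRow (u := fun a => highValue l i _ u a.1 a.2)
      (H.continuousOn_highValue hF' hu (H.ne_of_isAbove hj).symm), fun P hP hlt => ?_⟩
    rw [amplifiedRow, row_eq_highValue hfix hP (by rw [H.side_of_split hj hσ]; linarith)]
    rfl
  · refine H.continuousOn_amplifiedRow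
      (H.continuousOn_of_compatible hF' hfix hu hj hσ fun t => ?_)
    simpa [RowData.rescale, (H.speed _).amplitude_zero] using hcompat t
  · simpa [amplifiedRow, RowData.rescale, (H.speed _).amplitude_zero]
      using H.row_face hfix hj (t := t) hx

end RowSpeeds

end Row

/-! ### The interface -/

/-- The surface `ξ = ψ(t, x)` carried by the characteristics of `∂ₜ + a ∂ₓ + b ∂_ξ` that end on the
edge `x = ξ = 0`. -/
noncomputable def interface (a b : ℝ → ℝ → ℝ) (t x : ℝ) : ℝ := flow b (hitTime a t x) 0 t

section Interface

variable {ε C : ℝ} {a a' b b' : ℝ → ℝ → ℝ} (ha : SignedSpeed ε C (-1) a a')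
  (hb : SignedSpeed ε C (-1) b b')

include hb in
theorem hitTime_interface (t x : ℝ) : hitTime b t (interface a b t x) = hitTime a t x := by
  rw [interface, hb.hitTime_flow, hb.hitTime_zero]

include hb in
theorem le_interface_iff {t x ξ : ℝ} :
    ξ ≤ interface a b t x ↔ hitTime b t ξ ≤ hitTime a t x := by
  rw [← hitTime_interface (a := a) hb, (hb.strictMono_hitTime t).le_iff_le]

include ha hb

theorem contDiff_interface : ContDiff ℝ 1 fun q : ℝ × ℝ => interface a b q.1 q.2 :=
  hb.contDiff_flow.comp ((ha.contDiff_hitTime.prodMk contDiff_const).prodMk contDiff_fst)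

theorem interface_zero (t : ℝ) : interface a b t 0 = 0 := by
  rw [interface, ha.hitTime_zero, hb.flow_self]

theorem interface_nonneg {t x : ℝ} (hx : 0 ≤ x) : 0 ≤ interface a b t x := by
  rw [le_interface_iff hb, hb.hitTime_zero]
  exact ha.le_hitTime hx

theorem interface_le (hab : ∀ t x, a t x + ε ≤ b t x) {t x : ℝ} (hx : 0 ≤ x) :
    interface a b t x ≤ x := by
  rw [← (hb.strictMono_hitTime t).le_iff_le, hitTime_interface hb]
  have hmono := ((ha.increasesAtRate_hitTime (τ := -1) (fun t x => by linarith [hab t x])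
    (hb.isIntegralCurve_flow t x)).strictMono ha.separationRate_pos).monotone
  simpa [hb.flow_self, hb.flow_hitTime, ha.hitTime_zero] using hmono (hb.le_hitTime (t := t) hx)

omit hb in
theorem interface_flow (t x s : ℝ) :
    interface a b s (flow a t x s) = flow b (hitTime a t x) 0 s := by
  rw [interface, ha.hitTime_flow]

theorem interface_equation {t x : ℝ} {I J : Set ℝ} (hI : UniqueDiffWithinAt ℝ I t)
    (hJ : UniqueDiffWithinAt ℝ J x) :
    derivWithin (fun s => interface a b s x) I t +
      a t x * derivWithin (fun y => interface a b t y) J x - b t (interface a b t x) = 0 := by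
  have hψ := ((contDiff_interface ha hb).differentiable one_ne_zero (t, x)).hasFDerivAt
  set D := fderiv ℝ (fun q : ℝ × ℝ => interface a b q.1 q.2) (t, x)
  have htime : HasDerivAt (fun s => interface a b s x) (D (1, 0)) t :=
    hψ.comp_hasDerivAt (f := fun s => (s, x)) t ((hasDerivAt_id t).prodMk (hasDerivAt_const t x))
  have hspace : HasDerivAt (fun y => interface a b t y) (D (0, 1)) x :=
    hψ.comp_hasDerivAt (f := fun y => (t, y)) x ((hasDerivAt_const x t).prodMk (hasDerivAt_id x))
  have halong : HasDerivAt (fun s => interface a b s (flow a t x s)) (D (1, a t x)) t := by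
    have hX := ha.isIntegralCurve_flow t x t
    rw [← ha.flow_self t x] at hψ
    rw [ha.flow_self] at hX
    exact hψ.comp_hasDerivAt (f := fun s => (s, flow a t x s)) t ((hasDerivAt_id t).prodMk hX)
  simp only [interface_flow ha] at halong
  have hD := halong.unique (hb.isIntegralCurve_flow (hitTime a t x) 0 t)
  have hdir : ((1, a t x) : ℝ × ℝ) = (1, 0) + a t x • (0, 1) := by simp
  rw [hdir, map_add, map_smul, smul_eq_mul] at hD
  rw [htime.hasDerivWithinAt.derivWithin hI, hspace.hasDerivWithinAt.derivWithin hJ, hD]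
  exact sub_self _

theorem isInterface_interface {a₀ b₀ : ℝ → ℝ → ℝ} (hab : ∀ t x, a t x + ε ≤ b t x)
    (ha₀ : ∀ t x, (t, x) ∈ strip → a t x = a₀ t x)
    (hb₀ : ∀ t x, (t, x) ∈ strip → b t x = b₀ t x) : IsInterface a₀ b₀ (interface a b) := by
  have hmem : ∀ t x : ℝ, (t, x) ∈ strip → interface a b t x ∈ Icc (0 : ℝ) 1 := fun t x h =>
    ⟨interface_nonneg ha hb h.2.1, (interface_le ha hb hab h.2.1).trans h.2.2⟩
  refine ⟨(contDiff_interface ha hb).contDiffOn, hmem, fun t x h => ?_,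
    fun t _ => interface_zero ha hb t⟩
  rw [← ha₀ t x h, ← hb₀ t (interface a b t x) ⟨h.1, hmem t x h⟩]
  exact interface_equation ha hb (uniqueDiffOn_Ici 0 t h.1)
    (uniqueDiffOn_Icc zero_lt_one x h.2)

end Interface

/-! ### Rows of positive speed -/

theorem SignedSpeed.reverse {ε C σ : ℝ} {l l' : ℝ → ℝ → ℝ} (hl : SignedSpeed ε C σ l l') :
    SignedSpeed ε C (-σ) (fun t x => -l (-t) x) (fun t x => -l' (-t) x) where
  eps_pos := hl.eps_pos
  sign_mul_self := (neg_mul_neg σ σ).trans hl.sign_mul_self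
  continuous := (hl.continuous.comp (by fun_prop : Continuous fun q : ℝ × ℝ => (-q.1, q.2))).neg
  abs_le t x := (abs_neg _).trans_le (hl.abs_le _ _)
  abs_sub_le t x y := by
    rw [neg_sub_neg, abs_sub_comm]
    exact hl.abs_sub_le _ _ _
  le_sign_mul t x := (hl.le_sign_mul _ _).trans_eq (neg_mul_neg _ _).symm
  hasDerivAt t x h0 h1 := (hl.hasDerivAt (-t) x h0 h1).neg
  continuousOn_deriv := (hl.continuousOn_deriv.comp
    (by fun_prop : Continuous fun q : ℝ × ℝ => (-q.1, q.2)).continuousOn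
    fun _ hq => ⟨trivial, hq.2⟩).neg
  deriv_eq_zero t x hx := neg_eq_zero.2 (hl.deriv_eq_zero _ _ hx)
  abs_deriv_le t x := (abs_neg _).trans_le (hl.abs_deriv_le _ _)

theorem isIntegralCurve_comp_neg {l : ℝ → ℝ → ℝ} {X : ℝ → ℝ} (hX : IsIntegralCurve X l) :
    IsIntegralCurve (fun s => X (-s)) fun t x => -l (-t) x := fun s => by
  simpa [Function.comp_def] using (hX (-s)).scomp s (hasDerivAt_neg s)

section Row

variable {ι : Type*}

open Classical in
/-- Data for the time-reversed row `i`, whose values on `ξ = 0` are chosen compatible with those on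
`ξ = x`, so that its entries are continuous. -/
noncomputable def RowData.reverse (i : ι) (F : RowData ι) : RowData ι where
  coupling q j t x := -F.coupling q j (-t) x
  diagonal j t x := F.diagonal j (-t) x
  face j t := if j = i then 0 else F.diagonal j (-t) 0
  reflection _ _ _ := 0

theorem RowData.Admissible.reverse {F : RowData ι} {N : ℝ} {i : ι} {σ : ι → ℝ}
    (hF : F.Admissible N i σ) : (F.reverse i).Admissible N i fun j => -σ j := by
  have hneg : Continuous fun q : ℝ × ℝ => (-q.1, q.2) := by fun_prop
  refine ⟨fun q j => ((hF.coupling_cont q j).comp hneg).neg,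
    fun q j t x => (abs_neg _).trans_le (hF.coupling_bound q j _ _),
    fun j t x => neg_eq_zero.2 (hF.coupling_self j _ _),
    fun j hj => (hF.diagonal_cont j hj).comp hneg,
    fun j hj t x => hF.diagonal_bound j hj _ _, fun j => ?_, fun j t => ?_,
    fun _ _ => continuous_const, fun _ _ _ => abs_zero.trans_le hF.nonneg, fun _ _ _ _ => rfl⟩
  · by_cases hj : j = i
    · simpa only [RowData.reverse, if_pos hj] using continuous_const
    · simp only [RowData.reverse, if_neg hj]
      exact (hF.diagonal_cont j hj).comp
        (by fun_prop : Continuous fun t : ℝ => (-t, (0 : ℝ)))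
  · by_cases hj : j = i
    · simpa only [RowData.reverse, if_pos hj, abs_zero] using hF.nonneg
    · simpa only [RowData.reverse, if_neg hj] using hF.diagonal_bound j hj _ _

variable [Fintype ι] {ε C N : ℝ} {i : ι} {σ : ι → ℝ} {l l' : ι → ℝ → ℝ → ℝ} {F : RowData ι}

theorem zerothOrder_reverse (k : ι → ℝ × ℝ × ℝ → ℝ) (j : ι) (P : ℝ × ℝ × ℝ) :
    zerothOrder (fun j t x => -l' j (-t) x) (F.reverse i) k j (-P.1, P.2) =
      -zerothOrder l' F (fun j P => k j (-P.1, P.2)) j P := by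
  simp only [zerothOrder, RowData.reverse, neg_neg, mul_neg, Finset.sum_neg_distrib]
  ring

theorem IsBroadRow.reverse {k : ι → ℝ × ℝ × ℝ → ℝ}
    (hk : IsBroadRow i (fun j t x => -l j (-t) x) (fun j t x => -l' j (-t) x) (F.reverse i) k) :
    IsBroadRow i l l' F fun j P => k j (-P.1, P.2) := by
  obtain ⟨B, hB⟩ := hk.bdd
  refine ⟨⟨B, fun j P => hB j _⟩, fun j s₁ s₂ X Y hs hX hY hmem => ?_, fun j hj t x hx => ?_⟩
  · obtain ⟨hint, hval⟩ := hk.along j (-s₂) (-s₁) _ _ (neg_le_neg hs)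
      (isIntegralCurve_comp_neg hX) (isIntegralCurve_comp_neg hY)
      fun s hs' => hmem (-s) ⟨le_neg.1 hs'.2, neg_le.1 hs'.1⟩
    have hrev : ∀ s, zerothOrder (fun j t x => -l' j (-t) x) (F.reverse i) k j (-s, X s, Y s) =
        -zerothOrder l' F (fun j P => k j (-P.1, P.2)) j (s, X s, Y s) := fun s =>
      zerothOrder_reverse k j (s, X s, Y s)
    have hint' := ((IntervalIntegrable.iff_comp_neg (by simp)).1 hint).symm
    rw [← intervalIntegral.integral_comp_neg] at hval
    simp only [neg_neg, hrev, intervalIntegral.integral_neg] at hint' hval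
    refine ⟨by simpa only [Pi.neg_def, neg_neg] using hint'.neg, ?_⟩
    linarith
  · simp only [hk.diag j hj (-t) x hx, RowData.reverse, neg_neg]

theorem exists_isBroadRow_of_pos (hl : ∀ j, SignedSpeed ε C (σ j) (l j) (l' j))
    (hgap : ∀ j k, j ≠ k → IsAbove ε l j k ∨ IsAbove ε l k j) (hi : σ i = 1)
    (hF : F.Admissible N i σ) :
    ∃ k, IsBroadRow i l l' F k ∧ ∀ j, ContinuousOn (k j) wedge := by
  have H : RowSpeeds ε C i (fun j => -σ j) (fun j t x => -l j (-t) x)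
      (fun j t x => -l' j (-t) x) := by
    refine ⟨fun j => (hl j).reverse, congrArg Neg.neg hi, fun j k hjk => ?_⟩
    rcases hgap j k hjk with h | h
    · exact Or.inr fun t x => by linarith [h (-t) x]
    · exact Or.inl fun t x => by linarith [h (-t) x]
  obtain ⟨k, hk⟩ := H.exists_isKernelRow hF.reverse
  refine ⟨_, hk.toIsBroadRow.reverse, fun j => ?_⟩
  have hkj : ContinuousOn (k j) wedge := by
    by_cases hj : IsAbove ε (fun j t x => -l j (-t) x) i j ∧ -σ j = -1
    · refine hk.compat j hj.1 hj.2 fun t => ?_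
      simp [RowData.reverse, (H.ne_of_isAbove hj.1).symm]
    · exact hk.cont j hj
  exact hkj.comp (by fun_prop : Continuous fun P : ℝ × ℝ × ℝ => (-P.1, P.2)).continuousOn
    fun P hP => hP

end Row

/-! ### Extension to all times and positions -/

/-- Extension of a function on the strip to the plane, by projection to the strip. -/
noncomputable def extend (f : ℝ → ℝ → ℝ) (t x : ℝ) : ℝ := f (max t 0) (projIcc 0 1 zero_le_one x)

/-- The space derivative of `extend f`: that of `f` at the projected time, and zero outside
`[0, 1]`. -/
noncomputable def extendDeriv (f : ℝ → ℝ → ℝ) (t : ℝ) : ℝ → ℝ :=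
  indicator (Icc 0 1) (derivWithin (f (max t 0)) (Icc 0 1))

theorem proj_mem_strip (t x : ℝ) : (max t 0, (projIcc 0 1 zero_le_one x : ℝ)) ∈ strip :=
  ⟨mem_Ici.2 (le_max_right _ _), Subtype.coe_prop _⟩

section Extend

variable {ε C σ : ℝ} {f : ℝ → ℝ → ℝ}

theorem extend_of_mem {t x : ℝ} (h : (t, x) ∈ strip) : extend f t x = f t x := by
  rw [extend, max_eq_left (mem_Ici.1 h.1), projIcc_of_mem _ h.2]

theorem extendDeriv_of_mem {t x : ℝ} (h : (t, x) ∈ strip) :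
    extendDeriv f t x = derivWithin (fun y => f t y) (Icc 0 1) x := by
  rw [extendDeriv, indicator_of_mem h.2, max_eq_left (mem_Ici.1 h.1)]

theorem continuous_extend (hf : ContinuousOn (fun q : ℝ × ℝ => f q.1 q.2) strip) :
    Continuous fun q : ℝ × ℝ => extend f q.1 q.2 :=
  hf.comp_continuous (f := fun q : ℝ × ℝ => (max q.1 0, (projIcc 0 1 zero_le_one q.2 : ℝ)))
    (by fun_prop) fun q => proj_mem_strip _ _

theorem hasDerivWithinAt_slice (hf : ContDiffOn ℝ 1 (fun q : ℝ × ℝ => f q.1 q.2) strip) {t x : ℝ}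
    (h : (t, x) ∈ strip) : HasDerivWithinAt (f t)
      (fderivWithin ℝ (fun q : ℝ × ℝ => f q.1 q.2) strip (t, x) (0, 1)) (Icc 0 1) x :=
  (hf.differentiableOn one_ne_zero (t, x) h).hasFDerivWithinAt.comp_hasDerivWithinAt
    (f := fun y => (t, y)) x
    ((hasDerivAt_const x t).prodMk (hasDerivAt_id x)).hasDerivWithinAt fun _ hy => ⟨h.1, hy⟩

theorem differentiableOn_slice (hf : ContDiffOn ℝ 1 (fun q : ℝ × ℝ => f q.1 q.2) strip) {t : ℝ}
    (ht : 0 ≤ t) : DifferentiableOn ℝ (f t) (Icc 0 1) := fun _ hx =>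
  (hasDerivWithinAt_slice hf ⟨ht, hx⟩).differentiableWithinAt

theorem continuousOn_derivWithin_slice
    (hf : ContDiffOn ℝ 1 (fun q : ℝ × ℝ => f q.1 q.2) strip) :
    ContinuousOn (fun q : ℝ × ℝ => derivWithin (f q.1) (Icc 0 1) q.2) strip := by
  have hstrip : UniqueDiffOn ℝ strip :=
    (uniqueDiffOn_Ici 0).prod (uniqueDiffOn_Icc zero_lt_one)
  refine ((hf.continuousOn_fderivWithin hstrip le_rfl).clm_apply
    (continuousOn_const (c := ((0, 1) : ℝ × ℝ)))).congr fun q hq => ?_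
  exact (hasDerivWithinAt_slice hf hq).derivWithin (uniqueDiffOn_Icc zero_lt_one q.2 hq.2)

theorem continuousOn_extendDeriv (hf : ContDiffOn ℝ 1 (fun q : ℝ × ℝ => f q.1 q.2) strip) :
    ContinuousOn (fun q : ℝ × ℝ => extendDeriv f q.1 q.2) (univ ×ˢ Icc 0 1) := by
  refine ((continuousOn_derivWithin_slice hf).comp (f := fun q : ℝ × ℝ => (max q.1 0, q.2))
    (by fun_prop) fun q hq => ⟨mem_Ici.2 (le_max_right _ _), hq.2⟩).congr fun q hq => ?_
  exact indicator_of_mem hq.2 _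

theorem hasDerivAt_extend (hf : ContDiffOn ℝ 1 (fun q : ℝ × ℝ => f q.1 q.2) strip) {t x : ℝ}
    (h₀ : x ≠ 0) (h₁ : x ≠ 1) : HasDerivAt (extend f t) (extendDeriv f t x) x := by
  rcases h₀.lt_or_gt with hx | hx
  · rw [extendDeriv, indicator_of_notMem fun h => hx.not_ge h.1]
    refine (hasDerivAt_const x (f (max t 0) 0)).congr_of_eventuallyEq ?_
    filter_upwards [gt_mem_nhds hx] with y hy
    rw [extend, projIcc_of_le_left _ hy.le]
  rcases h₁.lt_or_gt with hx' | hx'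
  · have hnhds := Icc_mem_nhds hx hx'
    have hmem : x ∈ Icc (0 : ℝ) 1 := ⟨hx.le, hx'.le⟩
    have hdiff := differentiableOn_slice hf (le_max_right t 0) x hmem
    rw [extendDeriv, indicator_of_mem hmem]
    refine (hdiff.hasDerivWithinAt.hasDerivAt hnhds).congr_of_eventuallyEq ?_
    filter_upwards [hnhds] with y hy
    rw [extend, projIcc_of_mem _ hy]
  · rw [extendDeriv, indicator_of_notMem fun h => hx'.not_ge h.2]
    refine (hasDerivAt_const x (f (max t 0) 1)).congr_of_eventuallyEq ?_
    filter_upwards [lt_mem_nhds hx'] with y hy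
    rw [extend, projIcc_of_right_le _ hy.le]

theorem abs_extend_sub_le (hf : ContDiffOn ℝ 1 (fun q : ℝ × ℝ => f q.1 q.2) strip) (hC₀ : 0 ≤ C)
    (hC : ∀ t x : ℝ, (t, x) ∈ strip → |derivWithin (f t) (Icc 0 1) x| ≤ C) (t x y : ℝ) :
    |extend f t x - extend f t y| ≤ C * |x - y| := by
  have ht : (0 : ℝ) ≤ max t 0 := le_max_right _ _
  calc |extend f t x - extend f t y|
      ≤ C * |(projIcc 0 1 zero_le_one x : ℝ) - projIcc 0 1 zero_le_one y| :=
        (convex_Icc 0 1).norm_image_sub_le_of_norm_derivWithin_le (differentiableOn_slice hf ht)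
          (fun z hz => hC _ z ⟨ht, hz⟩) (Subtype.coe_prop _) (Subtype.coe_prop _)
    _ ≤ C * |x - y| := mul_le_mul_of_nonneg_left (abs_projIcc_sub_projIcc _) hC₀

theorem abs_extendDeriv_le (hC₀ : 0 ≤ C)
    (hC : ∀ t x : ℝ, (t, x) ∈ strip → |derivWithin (f t) (Icc 0 1) x| ≤ C) (t x : ℝ) :
    |extendDeriv f t x| ≤ C := by
  by_cases hx : x ∈ Icc (0 : ℝ) 1
  · rw [extendDeriv, indicator_of_mem hx]
    exact hC _ _ ⟨mem_Ici.2 (le_max_right _ _), hx⟩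
  · rwa [extendDeriv, indicator_of_notMem hx, abs_zero]

theorem signedSpeed_extend (hε : 0 < ε) (hσ : σ * σ = 1)
    (hf : ContDiffOn ℝ 1 (fun q : ℝ × ℝ => f q.1 q.2) strip)
    (hC : ∀ t x : ℝ, (t, x) ∈ strip → |f t x| ≤ C ∧ |derivWithin (f t) (Icc 0 1) x| ≤ C)
    (hs : ∀ t x : ℝ, (t, x) ∈ strip → ε ≤ σ * f t x) :
    SignedSpeed ε C σ (extend f) (extendDeriv f) :=
  have hC₀ : 0 ≤ C := (abs_nonneg _).trans (hC _ _ (proj_mem_strip 0 0)).1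
  ⟨hε, hσ, continuous_extend hf.continuousOn, fun t x => (hC _ _ (proj_mem_strip t x)).1,
    abs_extend_sub_le hf hC₀ fun t x h => (hC t x h).2, fun t x => hs _ _ (proj_mem_strip t x),
    fun _ _ => hasDerivAt_extend hf, continuousOn_extendDeriv hf,
    fun _ _ hx => indicator_of_notMem hx _, abs_extendDeriv_le hC₀ fun t x h => (hC t x h).2⟩

end Extend

/-! ### The rows of the kernel -/

section Kernel

variable {m p : ℕ}

/-- The sign of the `j`-th of `n` speeds, the first `m` of which are negative. -/
noncomputable def speedSign (m : ℕ) {n : ℕ} (j : Fin n) : ℝ := if (j : ℕ) < m then -1 else 1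

theorem speedSign_castAdd (i : Fin m) : speedSign m (Fin.castAdd p i) = -1 := by
  simp [speedSign]

theorem speedSign_natAdd (i : Fin p) : speedSign m (Fin.natAdd m i) = 1 := by
  simp [speedSign]

theorem lt_of_speedSign_eq_neg_one {n : ℕ} {j : Fin n} (h : speedSign m j = -1) : (j : ℕ) < m := by
  by_contra hj
  rw [speedSign, if_neg hj] at h
  norm_num at h

namespace AdmissibleSpeeds

variable {ε : ℝ} {lam : Fin (m + p) → ℝ → ℝ → ℝ} (hlam : AdmissibleSpeeds ε lam)
include hlam

theorem exists_signedSpeed (hε : 0 < ε) :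
    ∃ C, ∀ j, SignedSpeed ε C (speedSign m j) (extend (lam j)) (extendDeriv (lam j)) := by
  obtain ⟨C, hC⟩ := hlam.bounded
  refine ⟨C, fun j => signedSpeed_extend hε ?_ (hlam.contDiffOn j) (hC j) fun t x h => ?_⟩
  · unfold speedSign
    split_ifs <;> norm_num
  · refine Fin.addCases (fun i => ?_) (fun i => ?_) j
    · rw [speedSign_castAdd]
      linarith [hlam.neg i t x h]
    · rw [speedSign_natAdd, one_mul]
      exact (hlam.pos i t x h).le

theorem isAbove {i j : Fin (m + p)} (hij : i < j) :
    IsAbove ε (fun j => extend (lam j)) i j := fun t x => by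
  simp only [extend]
  linarith [hlam.gap i j hij _ _ (proj_mem_strip t x)]

theorem isAbove_or {i j : Fin (m + p)} (hij : i ≠ j) :
    IsAbove ε (fun j => extend (lam j)) i j ∨ IsAbove ε (fun j => extend (lam j)) j i :=
  hij.lt_or_gt.imp hlam.isAbove hlam.isAbove

theorem lt_of_isAbove (hε : 0 < ε) {i j : Fin (m + p)}
    (h : IsAbove ε (fun j => extend (lam j)) i j) : i < j := by
  have hij := h 0 0
  by_contra! hji
  rcases hji.lt_or_eq with hlt | rfl
  · linarith [hlam.isAbove hlt 0 0]
  · linarith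

theorem le_abs_extend_sub {i j : Fin (m + p)} (hij : i ≠ j) (t x : ℝ) :
    ε ≤ |extend (lam i) t x - extend (lam j) t x| := by
  rcases hlam.isAbove_or hij with h | h
  · rw [abs_sub_comm]
    exact (le_sub_iff_add_le'.2 (h t x)).trans (le_abs_self _)
  · exact (le_sub_iff_add_le'.2 (h t x)).trans (le_abs_self _)

end AdmissibleSpeeds

/-- The coefficients of the boundary condition `G₋₋ = 0` on `ξ = 0`, solved for the entry `j`: only
the entries `q` of positive speed contribute, and only for `j` of negative speed. -/
noncomputable def faceCoeff (lam : Fin (m + p) → ℝ → ℝ → ℝ) (Q : ℝ → Matrix (Fin p) (Fin m) ℝ)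
    (q j : Fin (m + p)) (t : ℝ) : ℝ :=
  Fin.addCases (motive := fun _ => ℝ) (fun _ => 0) (fun a => Fin.addCases (motive := fun _ => ℝ)
    (fun c => -(extend (lam (Fin.natAdd m a)) t 0 * Q (max t 0) a c) /
      extend (lam (Fin.castAdd p c)) t 0) (fun _ => 0) j) q

section FaceCoeff

variable {ε C : ℝ} {lam : Fin (m + p) → ℝ → ℝ → ℝ} {Q : ℝ → Matrix (Fin p) (Fin m) ℝ}

theorem faceCoeff_natAdd_castAdd (a : Fin p) (c : Fin m) (t : ℝ) :
    faceCoeff lam Q (Fin.natAdd m a) (Fin.castAdd p c) t =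
      -(extend (lam (Fin.natAdd m a)) t 0 * Q (max t 0) a c) /
        extend (lam (Fin.castAdd p c)) t 0 := by
  simp only [faceCoeff, Fin.addCases_left, Fin.addCases_right]

theorem faceCoeff_castAdd (a : Fin m) (j : Fin (m + p)) (t : ℝ) :
    faceCoeff lam Q (Fin.castAdd p a) j t = 0 := by
  simp only [faceCoeff, Fin.addCases_left]

theorem faceCoeff_natAdd (q : Fin (m + p)) (c : Fin p) (t : ℝ) :
    faceCoeff lam Q q (Fin.natAdd m c) t = 0 := by
  induction q using Fin.addCases <;> simp only [faceCoeff, Fin.addCases_left, Fin.addCases_right]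

theorem faceCoeff_eq_zero (q j : Fin (m + p)) (t : ℝ) (hq : speedSign m q ≠ 1) :
    faceCoeff lam Q q j t = 0 := by
  induction q using Fin.addCases with
  | left a => exact faceCoeff_castAdd a j t
  | right a => exact absurd (speedSign_natAdd a) hq

theorem sum_mul_faceCoeff (v : Fin (m + p) → ℝ) {t : ℝ} (ht : 0 ≤ t) (j : Fin m) :
    ∑ q, v q * faceCoeff lam Q q (Fin.castAdd p j) t =
      -(∑ a, v (Fin.natAdd m a) * lam (Fin.natAdd m a) t 0 * Q t a j) /
        lam (Fin.castAdd p j) t 0 := by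
  have hmem : (t, (0 : ℝ)) ∈ strip := ⟨ht, le_rfl, zero_le_one⟩
  simp only [Fin.sum_univ_add, faceCoeff_castAdd, faceCoeff_natAdd_castAdd, extend_of_mem hmem,
    max_eq_left ht, mul_zero, Finset.sum_const_zero, zero_add]
  rw [← Finset.sum_neg_distrib, Finset.sum_div]
  exact Finset.sum_congr rfl fun a _ => by ring

variable (hl : ∀ j, SignedSpeed ε C (speedSign m j) (extend (lam j)) (extendDeriv (lam j)))
include hl

theorem continuous_faceCoeff (hQ : ContinuousOn Q (Ici 0)) (q j : Fin (m + p)) :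
    Continuous (faceCoeff lam Q q j) := by
  induction q using Fin.addCases with
  | left a => simpa only [funext (faceCoeff_castAdd a j)] using continuous_const
  | right a =>
    induction j using Fin.addCases with
    | right c => simpa only [funext (faceCoeff_natAdd _ c)] using continuous_const
    | left c =>
      have hspeed : ∀ j, Continuous fun t => extend (lam j) t 0 := fun j =>
        (hl j).continuous.comp (by fun_prop : Continuous fun t : ℝ => (t, (0 : ℝ)))
      have hQac : Continuous fun t => Q (max t 0) a c := (continuous_apply_apply a c).comp
        (hQ.comp_continuous (by fun_prop) fun t => mem_Ici.2 (le_max_right t 0))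
      rw [funext (faceCoeff_natAdd_castAdd a c)]
      exact (((hspeed _).mul hQac).neg).div (hspeed _) fun t => (hl _).ne_zero t 0

theorem abs_faceCoeff_le {B : ℝ} (hB₀ : 0 ≤ B) (hB : ∀ t : ℝ, 0 ≤ t → ∀ i j, |Q t i j| ≤ B)
    (q j : Fin (m + p)) (t : ℝ) : |faceCoeff lam Q q j t| ≤ C * B / ε := by
  have hC := (hl q).bound_nonneg
  have hε := (hl q).eps_pos
  have hA : 0 ≤ C * B / ε := by positivity
  induction q using Fin.addCases with
  | left a => simpa only [faceCoeff_castAdd, abs_zero] using hA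
  | right a =>
    induction j using Fin.addCases with
    | right c => simpa only [faceCoeff_natAdd, abs_zero] using hA
    | left c =>
      rw [faceCoeff_natAdd_castAdd, abs_div, abs_neg, abs_mul]
      exact div_le_div₀ (mul_nonneg hC hB₀) (mul_le_mul ((hl _).abs_le _ _)
        (hB _ (le_max_right _ _) _ _) (abs_nonneg _) hC) hε ((hl (Fin.castAdd p c)).le_abs t 0)

end FaceCoeff

/-- The data of the row `i` of the kernel. The values on `ξ = x` come from solving the algebraic
equation `k i j * λ j - λ i * k i j = -M i j`. -/
noncomputable def kernelRowData (lam : Fin (m + p) → ℝ → ℝ → ℝ)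
    (M : ℝ → ℝ → Matrix (Fin (m + p)) (Fin (m + p)) ℝ) (Q : ℝ → Matrix (Fin p) (Fin m) ℝ)
    (i : Fin (m + p)) : RowData (Fin (m + p)) where
  coupling q j := extend fun t x => M t x q j
  diagonal j t x :=
    extend (fun t x => M t x i j) t x / (extend (lam i) t x - extend (lam j) t x)
  face _ _ := 0
  reflection := faceCoeff lam Q

variable {ε C : ℝ} {lam : Fin (m + p) → ℝ → ℝ → ℝ}
  {M : ℝ → ℝ → Matrix (Fin (m + p)) (Fin (m + p)) ℝ} {Q : ℝ → Matrix (Fin p) (Fin m) ℝ}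

theorem exists_admissible_kernelRowData (hε : 0 < ε) (hlam : AdmissibleSpeeds ε lam)
    (hM : AdmissibleCoupling M) (hQ : AdmissibleBoundary Q) (i : Fin (m + p)) :
    ∃ N, (kernelRowData lam M Q i).Admissible N i (speedSign m) := by
  obtain ⟨C, hl⟩ := hlam.exists_signedSpeed hε
  obtain ⟨A, hA⟩ := hM.bounded
  obtain ⟨B, hB⟩ := hQ.bounded
  have hA₀ : 0 ≤ A := (abs_nonneg _).trans (hA _ _ (proj_mem_strip 0 0) i i)
  have hAε : 0 ≤ A / ε := by positivity
  have hCB : 0 ≤ C * |B| / ε :=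
    div_nonneg (mul_nonneg (hl i).bound_nonneg (abs_nonneg B)) hε.le
  have hcont : ∀ q j, Continuous fun z : ℝ × ℝ => extend (fun t x => M t x q j) z.1 z.2 :=
    fun q j => continuous_extend ((continuous_apply_apply q j).comp_continuousOn hM.continuousOn)
  have hbound : ∀ q j t x, |extend (fun t x => M t x q j) t x| ≤ A := fun q j t x =>
    hA _ _ (proj_mem_strip t x) q j
  refine ⟨A + A / ε + C * |B| / ε, hcont, fun q j t x => (hbound q j t x).trans (by linarith),
    fun j t x => hM.diag_zero _ _ (proj_mem_strip t x) j, fun j hj => ?_, fun j hj t x => ?_,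
    fun _ => continuous_const, fun _ _ => abs_zero.trans_le (by linarith),
    continuous_faceCoeff hl hQ.continuousOn, fun q j t => ?_, faceCoeff_eq_zero⟩
  · exact (hcont i j).div ((hl i).continuous.sub (hl j).continuous) fun z =>
      abs_pos.1 (hε.trans_le (hlam.le_abs_extend_sub hj.symm z.1 z.2))
  · rw [kernelRowData, abs_div]
    exact (div_le_div₀ hA₀ (hbound i j t x) hε
      (hlam.le_abs_extend_sub hj.symm t x)).trans (by linarith)
  · exact (abs_faceCoeff_le hl (abs_nonneg B)
      (fun t ht a c => (hB t ht a c).trans (le_abs_self B)) q j t).trans (by linarith)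

/-- The family `k` consists of solutions of the equations of all the rows of the kernel, satisfies
the boundary condition on `ξ = 0` in the rows of negative speed, and is continuous in the rows of
positive speed. -/
structure IsKernelFamily (ε : ℝ) (lam : Fin (m + p) → ℝ → ℝ → ℝ)
    (M : ℝ → ℝ → Matrix (Fin (m + p)) (Fin (m + p)) ℝ) (Q : ℝ → Matrix (Fin p) (Fin m) ℝ)
    (k : Fin (m + p) → Fin (m + p) → ℝ × ℝ × ℝ → ℝ) : Prop where
  broad : ∀ i, IsBroadRow i (fun j => extend (lam j)) (fun j => extendDeriv (lam j))
    (kernelRowData lam M Q i) (k i)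
  neg : ∀ i : Fin m, IsKernelRow ε (Fin.castAdd p i) (speedSign m) (fun j => extend (lam j))
    (fun j => extendDeriv (lam j)) (kernelRowData lam M Q (Fin.castAdd p i)) (k (Fin.castAdd p i))
  pos : ∀ (i : Fin p) (j : Fin (m + p)), ContinuousOn (k (Fin.natAdd m i) j) wedge

theorem exists_isKernelFamily (hε : 0 < ε) (hlam : AdmissibleSpeeds ε lam)
    (hM : AdmissibleCoupling M) (hQ : AdmissibleBoundary Q) :
    ∃ k, IsKernelFamily ε lam M Q k := by
  obtain ⟨C, hl⟩ := hlam.exists_signedSpeed hε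
  choose N hN using exists_admissible_kernelRowData hε hlam hM hQ
  choose kneg hneg using fun i : Fin m => RowSpeeds.exists_isKernelRow
    ⟨hl, speedSign_castAdd i, fun _ _ => hlam.isAbove_or⟩ (hN (Fin.castAdd p i))
  choose kpos hpos hcont using fun i : Fin p => exists_isBroadRow_of_pos hl
    (fun _ _ => hlam.isAbove_or) (speedSign_natAdd i) (hN (Fin.natAdd m i))
  refine ⟨fun i => Fin.addCases (motive := fun _ => Fin (m + p) → ℝ × ℝ × ℝ → ℝ) kneg kpos i,
    fun i => ?_, fun i => ?_, fun i j => ?_⟩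
  · induction i using Fin.addCases with
    | left a => simpa only [Fin.addCases_left] using (hneg a).toIsBroadRow
    | right a => simpa only [Fin.addCases_right] using hpos a
  · simpa only [Fin.addCases_left] using hneg i
  · simpa only [Fin.addCases_right] using hcont i j

/-! ### The closed prism -/

theorem closure_prism_subset : closure prism ⊆ {q | 0 ≤ q.1} ∩ wedge :=
  closure_minimal (fun _ hq => ⟨hq.1.le, hq.2.2.1.1.le, hq.2.2.2.le, hq.2.1.2.le⟩)
    ((isClosed_le continuous_const continuous_fst).inter isClosed_wedge)

theorem mem_strip_of_mem_prism {t x ξ : ℝ} (h : (t, x, ξ) ∈ closure prism) : (t, ξ) ∈ strip := by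
  obtain ⟨ht, h0, h1, h2⟩ := closure_prism_subset h
  exact ⟨ht, h0, h1.trans h2⟩

theorem closure_prismBelow_subset {ψ : ℝ → ℝ → ℝ} {S : Set (ℝ × ℝ × ℝ)} (hS : IsClosed S)
    (h : ∀ P ∈ prism, P.2.2 ≤ ψ P.1 P.2.1 → P ∈ S) : closure (prismBelow ψ) ⊆ wedge ∩ S :=
  closure_minimal (fun P hP => ⟨(closure_prism_subset (subset_closure hP.1)).2, h P hP.1 hP.2.le⟩)
    (isClosed_wedge.inter hS)

theorem closure_prismAbove_subset {ψ : ℝ → ℝ → ℝ} : closure (prismAbove ψ) ⊆ wedge :=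
  closure_minimal (fun _ hP => (closure_prism_subset (subset_closure hP.1)).2) isClosed_wedge

theorem IsCharacteristic.eqOn_flow {σ : ℝ} {f f' : ℝ → ℝ → ℝ}
    (hl : SignedSpeed ε C σ (extend f) f') {s₁ s₂ : ℝ} (hs₁ : 0 ≤ s₁) {X : ℝ → ℝ}
    (hX : IsCharacteristic f s₁ s₂ X) : EqOn X (flow (extend f) s₁ (X s₁)) (Icc s₁ s₂) := by
  have hflow := hl.isIntegralCurve_flow s₁ (X s₁)
  refine ODE_solution_unique (v := extend f) (K := C.toNNReal) hl.lipschitzWith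
    (fun s hs => (hX s hs).2.continuousWithinAt) (fun s hs => ?_) hflow.continuous.continuousOn
    (fun s _ => (hflow s).hasDerivWithinAt) (hl.flow_self _ _).symm
  obtain ⟨hmem, hderiv⟩ := hX s (Ico_subset_Icc_self hs)
  rw [extend_of_mem (⟨mem_Ici.2 (hs₁.trans hs.1), hmem⟩ : (s, X s) ∈ strip)]
  exact hderiv.mono_of_mem_nhdsWithin (Icc_mem_nhdsGE_of_mem hs)

theorem IsKernelRow.piecewiseContinuous {ι : Type*} [Fintype ι] {i j : ι} {σ : ι → ℝ}
    {l l' : ι → ℝ → ℝ → ℝ} {F : RowData ι} {k : ι → ℝ × ℝ × ℝ → ℝ}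
    (hk : IsKernelRow ε i σ l l' F k) (hi : SignedSpeed ε C (-1) (l i) (l' i))
    (hj : SignedSpeed ε C (-1) (l j) (l' j)) (hij : IsAbove ε l i j) (hσ : σ j = -1) :
    PiecewiseContinuous (interface (l i) (l j)) fun t x ξ => k j (t, x, ξ) := by
  obtain ⟨g, hg, hkg⟩ := hk.high j hij hσ
  have hbelow : IsClosed {P : ℝ × ℝ × ℝ | hitTime (l j) P.1 P.2.2 ≤ hitTime (l i) P.1 P.2.1} :=
    isClosed_le
      (hj.continuous_hitTime.comp (by fun_prop : Continuous fun P : ℝ × ℝ × ℝ => (P.1, P.2.2)))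
      (hi.continuous_hitTime.comp (by fun_prop : Continuous fun P : ℝ × ℝ × ℝ => (P.1, P.2.1)))
  refine ⟨k j, g, (hk.low j hij hσ).mono
    (closure_prismBelow_subset hbelow fun P _ hP => (le_interface_iff hj).1 hP),
    hg.mono closure_prismAbove_subset, fun P hP => ⟨fun _ => rfl, fun hlt => ?_⟩⟩
  exact hkg P (closure_prism_subset hP).2
    (not_le.1 fun hle => hlt.not_ge ((le_interface_iff hj).2 hle))

/-! ### The kernel -/

/-- The matrix-valued function with entries `k i j`. -/
def kernelMatrix {n : ℕ} (k : Fin n → Fin n → ℝ × ℝ × ℝ → ℝ) (t x ξ : ℝ) :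
    Matrix (Fin n) (Fin n) ℝ :=
  Matrix.of fun i j => k i j (t, x, ξ)

theorem mul_speedMatrixDeriv_add_apply {n : ℕ} (lam : Fin n → ℝ → ℝ → ℝ)
    (A B : Matrix (Fin n) (Fin n) ℝ) (t x : ℝ) (i j : Fin n) :
    (A * (speedMatrixDeriv lam t x + B)) i j =
      A i j * derivWithin (fun y => lam j t y) (Icc 0 1) x + ∑ q, A i q * B q j := by
  rw [mul_add, Matrix.add_apply, speedMatrixDeriv, Matrix.mul_diagonal, Matrix.mul_apply]

theorem gainMM_apply (lam : Fin (m + p) → ℝ → ℝ → ℝ) (Q : ℝ → Matrix (Fin p) (Fin m) ℝ)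
    (K : ℝ → ℝ → ℝ → Matrix (Fin (m + p)) (Fin (m + p)) ℝ) (t x : ℝ) (i j : Fin m) :
    gainMM lam Q K t x i j =
      -(K t x 0 (Fin.castAdd p i) (Fin.castAdd p j) * lam (Fin.castAdd p j) t 0) -
        ∑ a, K t x 0 (Fin.castAdd p i) (Fin.natAdd m a) * lam (Fin.natAdd m a) t 0 * Q t a j := by
  have hMM : blockMM (speedMatrix lam t 0) = Matrix.diagonal fun c => lam (Fin.castAdd p c) t 0 :=
    Matrix.submatrix_diagonal _ _ (Fin.castAdd_injective m p)
  have hPP : blockPP (speedMatrix lam t 0) = Matrix.diagonal fun c => lam (Fin.natAdd m c) t 0 :=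
    Matrix.submatrix_diagonal _ _ (Fin.natAdd_injective p m)
  rw [gainMM, hMM, hPP, Matrix.sub_apply, Matrix.neg_apply, Matrix.mul_diagonal, Matrix.mul_apply]
  simp only [Matrix.mul_diagonal]
  rfl

theorem zerothOrder_kernelRowData (k : Fin (m + p) → Fin (m + p) → ℝ × ℝ × ℝ → ℝ)
    {t x ξ : ℝ} (h : (t, ξ) ∈ strip) (i j : Fin (m + p)) :
    zerothOrder (fun j => extendDeriv (lam j)) (kernelRowData lam M Q i) (k i) j (t, x, ξ) =
      (kernelMatrix k t x ξ * (speedMatrixDeriv lam t ξ + M t ξ)) i j := by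
  simp only [zerothOrder, kernelRowData, kernelMatrix, mul_speedMatrixDeriv_add_apply,
    extendDeriv_of_mem h, extend_of_mem h, Matrix.of_apply]

namespace IsKernelFamily

variable {k : Fin (m + p) → Fin (m + p) → ℝ × ℝ × ℝ → ℝ} (hk : IsKernelFamily ε lam M Q k)
include hk

theorem exists_abs_le : ∃ C : ℝ, ∀ (i j : Fin (m + p)) (P : ℝ × ℝ × ℝ), |k i j P| ≤ C := by
  choose B hB using fun i => (hk.broad i).bdd
  refine ⟨∑ i, |B i|, fun i j P => ?_⟩
  exact ((hB i j P).trans (le_abs_self _)).trans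
    (Finset.single_le_sum (f := fun i => |B i|) (fun _ _ => abs_nonneg _) (Finset.mem_univ i))

theorem solvesAlongCharacteristics (hε : 0 < ε) (hlam : AdmissibleSpeeds ε lam) :
    SolvesAlongCharacteristics lam M (kernelMatrix k) := by
  obtain ⟨C, hl⟩ := hlam.exists_signedSpeed hε
  intro i j s₁ s₂ X Y hs hX hY hmem
  have hs₁ : 0 ≤ s₁ := (closure_prism_subset (hmem s₁ (left_mem_Icc.2 hs))).1
  have hpath : ∀ s ∈ Icc s₁ s₂,
      (s, flow (extend (lam i)) s₁ (X s₁) s, flow (extend (lam j)) s₁ (Y s₁) s) =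
        (s, X s, Y s) := fun s hs' => by
    rw [hX.eqOn_flow (hl i) hs₁ hs', hY.eqOn_flow (hl j) hs₁ hs']
  obtain ⟨hint, hval⟩ := (hk.broad i).along j s₁ s₂ _ _ hs
    ((hl i).isIntegralCurve_flow s₁ (X s₁)) ((hl j).isIntegralCurve_flow s₁ (Y s₁))
    fun s hs' => by
      rw [hpath s hs']
      exact (closure_prism_subset (hmem s hs')).2
  have hterm : EqOn (fun s => zerothOrder (fun j => extendDeriv (lam j)) (kernelRowData lam M Q i)
        (k i) j (s, flow (extend (lam i)) s₁ (X s₁) s, flow (extend (lam j)) s₁ (Y s₁) s))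
      (fun s => (kernelMatrix k s (X s) (Y s) * (speedMatrixDeriv lam s (Y s) + M s (Y s))) i j)
      (uIcc s₁ s₂) := fun s hs' => by
    rw [uIcc_of_le hs] at hs'
    beta_reduce
    rw [hpath s hs', zerothOrder_kernelRowData k (mem_strip_of_mem_prism (hmem s hs'))]
  rw [intervalIntegral.integral_congr hterm, hpath _ (left_mem_Icc.2 hs),
    hpath _ (right_mem_Icc.2 hs)] at hval
  exact ⟨hint.congr (hterm.mono uIoc_subset_uIcc), hval⟩

theorem diagonal_eq (hε : 0 < ε) (hlam : AdmissibleSpeeds ε lam) (hM : AdmissibleCoupling M)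
    {t x : ℝ} (ht : 0 ≤ t) (hx : x ∈ Ioc (0 : ℝ) 1) :
    kernelMatrix k t x x * speedMatrix lam t x - speedMatrix lam t x * kernelMatrix k t x x =
      -M t x := by
  have hmem : (t, x) ∈ strip := ⟨ht, hx.1.le, hx.2⟩
  ext i j
  rw [Matrix.sub_apply, speedMatrix, Matrix.mul_diagonal, Matrix.diagonal_mul, Matrix.neg_apply,
    kernelMatrix, Matrix.of_apply]
  rcases eq_or_ne j i with rfl | hij
  · rw [hM.diag_zero t x hmem]
    ring
  · have hne : lam i t x - lam j t x ≠ 0 := by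
      have := hε.trans_le (hlam.le_abs_extend_sub hij.symm t x)
      rwa [extend_of_mem hmem, extend_of_mem hmem, abs_pos] at this
    rw [(hk.broad i).diag j hij t x hx]
    simp only [kernelRowData, extend_of_mem hmem]
    field_simp
    ring

theorem isBroadSolution (hε : 0 < ε) (hlam : AdmissibleSpeeds ε lam) (hM : AdmissibleCoupling M) :
    IsBroadSolution lam M (kernelMatrix k) :=
  ⟨hk.solvesAlongCharacteristics hε hlam, fun _ _ => hk.diagonal_eq hε hlam hM⟩

theorem continuousOn_of_not_split (hε : 0 < ε) (hlam : AdmissibleSpeeds ε lam)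
    {i j : Fin (m + p)} (hij : ¬ (i < j ∧ (j : ℕ) < m)) : ContinuousOn (k i j) wedge := by
  induction i using Fin.addCases with
  | left a =>
    exact (hk.neg a).cont j fun h =>
      hij ⟨hlam.lt_of_isAbove hε h.1, lt_of_speedSign_eq_neg_one h.2⟩
  | right a => exact hk.pos a j

theorem isInterface_and_piecewiseContinuous (hε : 0 < ε) (hlam : AdmissibleSpeeds ε lam)
    {i j : Fin m} (hij : i < j) :
    IsInterface (lam (Fin.castAdd p i)) (lam (Fin.castAdd p j))
        (interface (extend (lam (Fin.castAdd p i))) (extend (lam (Fin.castAdd p j)))) ∧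
      PiecewiseContinuous
        (interface (extend (lam (Fin.castAdd p i))) (extend (lam (Fin.castAdd p j))))
        fun t x ξ => kernelMatrix k t x ξ (Fin.castAdd p i) (Fin.castAdd p j) := by
  obtain ⟨C, hl⟩ := hlam.exists_signedSpeed hε
  have hneg : ∀ c : Fin m, SignedSpeed ε C (-1) (extend (lam (Fin.castAdd p c)))
      (extendDeriv (lam (Fin.castAdd p c))) := fun c =>
    speedSign_castAdd (p := p) c ▸ hl (Fin.castAdd p c)
  have habove := hlam.isAbove (i := Fin.castAdd p i) (j := Fin.castAdd p j) hij
  exact ⟨isInterface_interface (hneg i) (hneg j) habove (fun _ _ => extend_of_mem)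
    fun _ _ => extend_of_mem, (hk.neg i).piecewiseContinuous (hneg i) (hneg j) habove
      (speedSign_castAdd j)⟩

theorem gainMM_eq_zero (hlam : AdmissibleSpeeds ε lam) (hε : 0 < ε) {t x : ℝ}
    (h : (t, x) ∈ strip) {i j : Fin m} (hij : i ≤ j) :
    gainMM lam Q (kernelMatrix k) t x i j = 0 := by
  have ht : 0 ≤ t := h.1
  have hne : lam (Fin.castAdd p j) t 0 ≠ 0 := by
    linarith [hlam.neg j t 0 ⟨ht, le_rfl, zero_le_one⟩]
  have hface := (hk.neg i).face (Fin.castAdd p j)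
    (hij.eq_or_lt.imp (by rintro rfl; rfl) fun h => ⟨hlam.isAbove h, speedSign_castAdd j⟩) t x h.2
  rw [kernelRowData, sum_mul_faceCoeff _ ht, zero_add, eq_div_iff hne] at hface
  simp only [gainMM_apply, kernelMatrix, Matrix.of_apply, hface]
  ring

theorem continuousOn_gainMM (hε : 0 < ε) (hlam : AdmissibleSpeeds ε lam)
    (hQ : ContinuousOn Q (Ici 0)) :
    ContinuousOn (fun q : ℝ × ℝ => gainMM lam Q (kernelMatrix k) q.1 q.2) strip := by
  refine continuousOn_pi.2 fun i => continuousOn_pi.2 fun j => ?_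
  rcases le_or_gt i j with hij | hij
  · exact continuousOn_const.congr fun q hq => hk.gainMM_eq_zero hlam hε hq hij
  have hspeed : ∀ c, ContinuousOn (fun q : ℝ × ℝ => lam c q.1 0) strip := fun c =>
    (hlam.contDiffOn c).continuousOn.comp (f := fun q : ℝ × ℝ => (q.1, (0 : ℝ))) (by fun_prop)
      fun q hq => ⟨hq.1, le_rfl, zero_le_one⟩
  have hentry : ∀ j : Fin (m + p), ¬ (Fin.castAdd p i < j ∧ (j : ℕ) < m) →
      ContinuousOn (fun q : ℝ × ℝ => k (Fin.castAdd p i) j (q.1, q.2, 0)) strip := fun j hj =>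
    (hk.continuousOn_of_not_split hε hlam hj).comp (by fun_prop)
      fun q hq => ⟨le_rfl, hq.2.1, hq.2.2⟩
  have hQj : ∀ a, ContinuousOn (fun q : ℝ × ℝ => Q q.1 a j) strip := fun a =>
    (continuous_apply_apply a j).comp_continuousOn
      (hQ.comp continuousOn_fst fun q hq => hq.1)
  simp only [gainMM_apply, kernelMatrix, Matrix.of_apply]
  exact (((hentry _ fun h => hij.not_gt h.1).mul (hspeed _)).neg).sub
    (continuousOn_finsetSum _ fun a _ =>
      ((hentry _ fun h => by simpa using h.2).mul (hspeed _)).mul (hQj a))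

end IsKernelFamily

end Kernel

end VolterraKernel

theorem theorem2p3 (m p : ℕ) (hm : 1 ≤ m) (hp : 1 ≤ p)
    (ε : ℝ) (hε : 0 < ε)
    (lam : Fin (m + p) → ℝ → ℝ → ℝ) (hlam : AdmissibleSpeeds ε lam)
    (M : ℝ → ℝ → Matrix (Fin (m + p)) (Fin (m + p)) ℝ) (hM : AdmissibleCoupling M)
    (Q : ℝ → Matrix (Fin p) (Fin m) ℝ) (hQ : AdmissibleBoundary Q) :
    ∃ (K : ℝ → ℝ → ℝ → Matrix (Fin (m + p)) (Fin (m + p)) ℝ)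
      (ψ : Fin m → Fin m → ℝ → ℝ → ℝ),
      -- `K` is bounded
      (∃ C : ℝ, ∀ q ∈ closure prism, ∀ i j, |K q.1 q.2.1 q.2.2 i j| ≤ C) ∧
      -- the entries `k_ij` with `j ∉ {i+1, …, m}` are continuous on the closed prism
      (∀ i j : Fin (m + p), ¬ (i < j ∧ (j : ℕ) < m) →
        ContinuousOn (fun q : ℝ × ℝ × ℝ => K q.1 q.2.1 q.2.2 i j) (closure prism)) ∧
      -- the entries `k_ij` with `i < j ≤ m` are continuous up to the boundary on both sides of
      -- the surface `ξ = ψ_ij(t, x)`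
      (∀ i j : Fin m, i < j →
        IsInterface (lam (Fin.castAdd p i)) (lam (Fin.castAdd p j)) (ψ i j) ∧
        PiecewiseContinuous (ψ i j)
          (fun t x ξ => K t x ξ (Fin.castAdd p i) (Fin.castAdd p j))) ∧
      -- `K` is a broad solution of the kernel equations
      IsBroadSolution lam M K ∧
      -- `G₋₋` is continuous and strictly lower triangular
      (ContinuousOn (fun q : ℝ × ℝ => gainMM lam Q K q.1 q.2) strip ∧
        ∀ t x : ℝ, (t, x) ∈ strip → ∀ i j : Fin m, i ≤ j → gainMM lam Q K t x i j = 0) := by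
  obtain ⟨k, hk⟩ := exists_isKernelFamily hε hlam hM hQ
  obtain ⟨C, hC⟩ := hk.exists_abs_le
  exact ⟨kernelMatrix k,
    fun i j => interface (extend (lam (Fin.castAdd p i))) (extend (lam (Fin.castAdd p j))),
    ⟨C, fun q _ i j => hC i j q⟩,
    fun i j hij => (hk.continuousOn_of_not_split hε hlam hij).mono
      (closure_prism_subset.trans inter_subset_right),
    fun i j hij => hk.isInterface_and_piecewiseContinuous hε hlam hij,
    hk.isBroadSolution hε hlam hM, hk.continuousOn_gainMM hε hlam hQ.continuousOn,
    fun t x h i j hij => hk.gainMM_eq_zero hlam hε h hij⟩
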